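/- Let $\mathfrak g$ be a complex simple Lie algebra with Cartan subalgebra $\mathfrak t$, root system $\Delta$, a set of simple roots $\Pi$, positive roots $\Delta^+$, highest root $\theta$, root spaces $\mathfrak g_\gamma$, and Borel subalgebra $\mathfrak b=\mathfrak t\oplus\bigoplus_{\gamma\in\Delta^+}\mathfrak g_\gamma$; let $(\ ,\ )$ be a Weyl-group-invariant inner product on the real span $V$ of $\Delta$. Let $\widehat W$ be the affine Weyl group, generated by the reflections in the affine simple roots $\Pi\cup\{\delta-\theta\}$, let $\widehat\Delta^+=\Delta^+\cup\{\gamma+k\delta\mid\gamma\in\Delta,\ k\ge 1\}$, and for $w\in\widehat W$ put $\mathcal N(w)=\{\nu\in\widehat\Delta^+\mid w(\nu)\in-\widehat\Delta^+\}$. An abelian ideal of $\mathfrak b$ is a subspace $\mathfrak a\subset\mathfrak b$ with $[\mathfrak b,\mathfrak a]\subset\mathfrak a$ and $[\mathfrak a,\mathfrak a]=0$; it has the form $\mathfrak a=\bigoplus_{\gamma\in I_{\mathfrak a}}\mathfrak g_\gamma$ with $I_{\mathfrak a}\subset\Delta^+$, and there is a unique $w_{\mathfrak a}\in\widehat W$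 with $\mathcal N(w_{\mathfrak a})=\{\delta-\gamma\mid\gamma\in I_{\mathfrak a}\}$. The rootlet of a nonzero abelian ideal $\mathfrak a$ is $\tau(\mathfrak a)=w_{\mathfrak a}(2\delta-\theta)$. Let $\tilde\alpha\in\Pi$ be a long simple root (if all roots have the same length, all are long). Then the set of nonzero abelian ideals of $\mathfrak b$ with rootlet $\tilde\alpha$, ordered by inclusion, has a least element $\mathfrak a[\tilde\alpha]_{\min}$ and a greatest element $\mathfrak a[\tilde\alpha]_{\max}$. Let $\mathfrak p[\tilde\alpha]_{\min}$ and $\mathfrak p[\tilde\alpha]_{\max}$ be their normalisers in $\mathfrak g$, which are parabolic subalgebras containing $\mathfrak b$, and let $\mathcal S[\tilde\alpha]_{\min}$ and $\mathcal S[\tilde\alpha]_{\max}$ be the sets of simple roots that are not roots of the Levi subalgebra containing $\mathfrak t$ of $\mathfrak p[\tilde\alpha]_{\min}$, respectively of $\mathfrak p[\tilde\alpha]_{\max}$. Then $$\mathcal S[\tilde\alpha]_{\max}\subseteq\mathcal S[\tilde\alpha]_{\min}\qquad\text{and}\qquad \mathfrak p[\tilde\alpha]_{\max}\supseteq\mathfrak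 p[\tilde\alpha]_{\min}.$$ Moreover, unless $\Delta$ is of type $A_n$ ($n\ge1$) and $\tilde\alpha$ is one of the two end roots $\alpha_1,\alpha_n$ (in the standard numbering), $$\mathcal S[\tilde\alpha]_{\max}=\mathcal S[\tilde\alpha]_{\min}\cap\theta^\perp,\qquad \theta^\perp=\{x\in V\mid (x,\theta)=0\}.$$ -/

import Mathlib

open LieAlgebra LieAlgebra.IsKilling LieModule

noncomputable section

namespace RootPairing

/-! ### Root-theoretic notions

`P` is a root pairing with roots in `M` (the space `V` of the mathematics) and `b` is a base of it,
with set of simple roots `Π = b.support` and positive roots `b.IsPos`. -/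

section General

variable {ι R M N : Type*} [CommRing R] [AddCommGroup M] [Module R M] [AddCommGroup N] [Module R N]
  {P : RootPairing ι R M N}

/-- `θ` is the highest root: `γ ≼ θ` for every root `γ`, that is, `θ - γ` is a combination of simple
roots with non-negative integer coefficients. -/
def IsHighestRoot (b : P.Base) (θ : ι) : Prop :=
  ∀ γ : ι, P.root θ - P.root γ ∈ AddSubmonoid.closure (P.root '' b.support)

variable (P) in
/-- The affine root `γ + k δ`. The space `V ⊕ R δ` is modelled as `M × R`, with `δ = (0, 1)`.

The affine Weyl group is often made to act on the larger space `V ⊕ R δ ⊕ R λ`. The subspace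
`V ⊕ R δ` is stable, contains all affine roots, and the group acts faithfully on it, so nothing
below is affected by leaving `λ` out. -/
def affineRoot (γ : ι) (k : ℤ) : M × R := (P.root γ, (k : R))

variable (P) in
/-- The reflection in the affine root `γ + k δ`, namely `x ↦ x - (x, γ^∨) (γ + k δ)`. (The
invariant form on `V` is extended to `V ⊕ R δ` with `δ` in its kernel, so `(γ + k δ)^∨` and
`γ^∨` have the same pairing with every `x`.) -/
def affineReflection (γ : ι) (k : ℤ) : (M × R) ≃ₗ[R] (M × R) :=
  Module.reflection (x := P.affineRoot γ k) (f := P.coroot' γ ∘ₗ LinearMap.fst R M R)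
    (by simp [affineRoot])

/-- The affine Weyl group: generated by the reflections in the affine simple roots, which are
the simple roots `α ∈ Π` and `α₀ = -θ + δ`. -/
def affineWeylGroup (b : P.Base) (θ : ι) : Subgroup ((M × R) ≃ₗ[R] (M × R)) :=
  Subgroup.closure ({s | ∃ α ∈ b.support, s = P.affineReflection α 0} ∪
    {s | ∃ γ : ι, P.root γ = -P.root θ ∧ s = P.affineReflection γ 1})

variable [CharZero R]

/-- The positive affine (real) roots: `γ` for `γ` a positive root, and `γ + k δ` for `γ` any root
and `k ≥ 1`. -/
def positiveAffineRoots (b : P.Base) : Set (M × R) :=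
  {x | ∃ (γ : ι) (k : ℤ), x = P.affineRoot γ k ∧ ((k = 0 ∧ b.IsPos γ) ∨ 1 ≤ k)}

/-- The inversion set `N(w)`: the positive affine roots that `w` makes negative. -/
def inversionSet (b : P.Base) (w : (M × R) ≃ₗ[R] (M × R)) : Set (M × R) :=
  {x | x ∈ positiveAffineRoots b ∧ -(w x) ∈ positiveAffineRoots b}

/-- `w` is the minuscule element of the affine Weyl group that corresponds to the set `I` of roots:
`N(w) = {δ - γ | γ ∈ I}`. -/
def IsMinusculeElement (b : P.Base) (θ : ι) (I : Set ι) (w : (M × R) ≃ₗ[R] (M × R)) : Prop :=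
  w ∈ affineWeylGroup b θ ∧
    inversionSet b w = {x | ∃ γ ∈ I, x = ((0, 1) : M × R) - P.affineRoot γ 0}

/-- The root `μ` is the rootlet of the set `I` of roots: `w (2 δ - θ) = μ`, where `w` is the
minuscule element corresponding to `I`. (An element of the affine Weyl group is determined by its
inversion set, so there is at most one such `w`.) -/
def IsRootlet (b : P.Base) (θ : ι) (I : Set ι) (μ : ι) : Prop :=
  ∃ w : (M × R) ≃ₗ[R] (M × R), IsMinusculeElement b θ I w ∧
    w ((0, 2) - P.affineRoot θ 0) = P.affineRoot μ 0

/-- The root `α` is long: no root is longer with respect to the invariant inner product. If all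
roots have the same length, all of them are long. -/
def IsLongRoot (P : RootPairing ι R M N) [P.IsCrystallographic] [Fintype ι] (α : ι) : Prop :=
  ∀ γ : ι, (P.posRootForm ℤ).rootLength γ ≤ (P.posRootForm ℤ).rootLength α

/-- The root system is of type `A_n` for some `n`, and in the standard numbering `α₁, …, α_n` of the
simple roots, `α` is `α₁` or `α_n`. (The numbering is by `0, …, n - 1` here.) -/
def IsEndOfTypeA [IsDomain R] [P.IsCrystallographic] [Finite ι] (b : P.Base) (α : ι) : Prop :=
  ∃ (n : ℕ) (e : Fin n ≃ b.support),
    (∀ i j : Fin n, b.cartanMatrix (e i) (e j) = CartanMatrix.A n i j) ∧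
    ∃ i : Fin n, (e i : ι) = α ∧ ((i : ℕ) = 0 ∨ (i : ℕ) + 1 = n)

end General

end RootPairing

namespace LieAlgebra

/-! ### Abelian ideals of a Borel subalgebra, and their normalisers

`L` is a complex Lie algebra with Cartan subalgebra `H` (written `t` in the comments), `g_γ` is the
root space of `γ`, and `b` is a base of the root system of `(L, H)`. -/

section AbelianIdeals

variable {L : Type*} [LieRing L] [LieAlgebra ℂ L] [FiniteDimensional ℂ L]

section Cartan

variable (H : LieSubalgebra ℂ L) [H.IsCartanSubalgebra]

/-- The set of roots `γ` with `g_γ ⊆ a`. For an abelian ideal `a` of the Borel subalgebra this is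
the set `I_a` of positive roots with `a = ⨁_{γ ∈ I_a} g_γ`. -/
def rootsOf (a : LieSubalgebra ℂ L) : Set H.root :=
  {γ | (rootSpace H γ.1).toSubmodule ≤ a.toSubmodule}

/-- The standard Levi subalgebra of a parabolic subalgebra `p ⊇ t` (the one that contains `t`): the
sum of `t` and of all `g_γ` such that `p` contains both `g_γ` and `g_{-γ}`. -/
def standardLevi (p : LieSubalgebra ℂ L) : Submodule ℂ L :=
  H.toSubmodule ⊔ ⨆ γ ∈ {γ : H.root | (rootSpace H γ.1).toSubmodule ≤ p.toSubmodule ∧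
    (rootSpace H (-(γ.1 : H → ℂ))).toSubmodule ≤ p.toSubmodule}, (rootSpace H γ.1).toSubmodule

end Cartan

variable [IsKilling ℂ L] {H : LieSubalgebra ℂ L} [H.IsCartanSubalgebra]

/-- The Borel subalgebra `t ⊕ ⨁_{γ > 0} g_γ`. -/
def borel (b : (rootSystem H).Base) : Submodule ℂ L :=
  H.toSubmodule ⊔ ⨆ γ ∈ {γ : H.root | b.IsPos γ}, (rootSpace H γ.1).toSubmodule

/-- `a` is an abelian ideal of the Borel subalgebra. -/
structure IsAbelianIdeal (b : (rootSystem H).Base) (a : LieSubalgebra ℂ L) : Prop where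
  le_borel : a.toSubmodule ≤ borel b
  lie_mem : ∀ x ∈ borel b, ∀ y ∈ a, ⁅x, y⁆ ∈ a
  lie_eq_zero : ∀ x ∈ a, ∀ y ∈ a, ⁅x, y⁆ = 0

/-- The set (ordered by inclusion) of the non-zero abelian ideals of the Borel subalgebra with
rootlet `μ`. -/
def abelianIdealsWithRootlet (b : (rootSystem H).Base) (θ μ : H.root) : Set (LieSubalgebra ℂ L) :=
  {a | IsAbelianIdeal b a ∧ a ≠ ⊥ ∧ RootPairing.IsRootlet b θ (rootsOf H a) μ}

/-- The simple roots that do not belong to the standard Levi subalgebra of `p`. -/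
def simpleRootsOutsideLevi (b : (rootSystem H).Base) (p : LieSubalgebra ℂ L) : Set H.root :=
  {α | α ∈ b.support ∧ ¬ (rootSpace H α.1).toSubmodule ≤ standardLevi H p}

end AbelianIdeals

end LieAlgebra

end

set_option linter.unusedSectionVars false

/-! Write ⟨γ, η⟩ for the pairing of γ with the coroot of η. An affine root γ + kδ (level k) becomes
a pair `(γ, k)`, and the affine Weyl group acts by permutations of such pairs.

Let v be the shortest element of the finite Weyl group with vθ = α, and s₀ the reflection in δ - θ.
Then v s₀ is minuscule and sends 2δ - θ to α; its ideal has the set of roots I_min = {γ | ⟨γ, θ⟩ >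
0, vγ > 0} (`mem_leastSet_iff`). From any other minuscule element with rootlet α, the inversions δ -
γ with γ ⟂ θ can be stripped off one at a time by simple affine reflections fixing α
(`exists_removable`), and what remains is v s₀ (`eq_of_forall_mem`). Hence the element is u v s₀
with u in the subgroup generated by the affine simple reflections orthogonal to α (`exists_eq_mul`),
and its ideal adds to I_min only roots γ ⟂ θ for which δ - vγ is in the span of those simple roots.
All such positive γ occur at once in the largest case (`exists_ncard_lt`); this is I_max.

A simple root σ is in the Levi subalgebra of the normaliser exactly when σ ∉ I and I is stable under
subtracting σ (`IsSubStable`), so the theorem compares this stability for I_min and I_max. If σ ⟂ θ,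
the two are equivalent: subtracting σ respects the pairing with θ, and stability of I_min forces vσ
to be simple (`apply_mem_support`), so subtracting it preserves the span condition. If σ is not
orthogonal to θ and σ ∉ I_min, then I_max is stable: a chain of roots from v(γ - σ) up to θ uses
only simple roots orthogonal to α (`pairingIn_eq_zero_of_chain`). If σ ∈ I_min, the inclusion of the
sets of simple roots asks nothing, and for σ not orthogonal to θ this happens only for the end roots
of type A (`isEndOfTypeA`). -/

namespace RootPairing

variable {ι R M N : Type*} [Field R] [CharZero R] [AddCommGroup M] [Module R M]
  [AddCommGroup N] [Module R N] {P : RootPairing ι R M N}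

/-! ### Negatives of roots, additive functions, coefficients at simple roots -/

section Opp

variable (P) in
/-- The index of the root `-γ`. -/
def opp (γ : ι) : ι := P.reflectionPerm γ γ

@[simp] lemma root_opp (γ : ι) : P.root (P.opp γ) = -P.root γ := by
  simp [opp]

@[simp] lemma opp_opp (γ : ι) : P.opp (P.opp γ) = γ :=
  P.root.injective (by simp)

lemma eq_opp_iff {γ η : ι} : γ = P.opp η ↔ P.root γ = -P.root η := by
  rw [← P.root.injective.eq_iff, root_opp]

lemma opp_injective : Function.Injective P.opp :=
  Function.LeftInverse.injective (g := P.opp) opp_opp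

variable [P.IsCrystallographic]

@[simp] lemma pairingIn_opp_left (γ η : ι) :
    P.pairingIn ℤ (P.opp γ) η = -P.pairingIn ℤ γ η := by
  simp [opp]

@[simp] lemma pairingIn_opp_right (γ η : ι) :
    P.pairingIn ℤ γ (P.opp η) = -P.pairingIn ℤ γ η := by
  simp [opp]

lemma root_reflectionPerm_eq (γ η : ι) :
    P.root (P.reflectionPerm η γ) = P.root γ - P.pairingIn ℤ γ η • P.root η := by
  rw [root_reflectionPerm, reflection_apply_root' ℤ]

end Opp

/-- An integer-valued function on the roots that respects addition and negation. -/
structure IsAdd (P : RootPairing ι R M N) (ψ : ι → ℤ) : Prop where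
  add : ∀ i j k, P.root k = P.root i + P.root j → ψ k = ψ i + ψ j
  opp : ∀ i, ψ (P.opp i) = -ψ i

namespace IsAdd

lemma sub {ψ : ι → ℤ} (h : P.IsAdd ψ) {i j k : ι}
    (hk : P.root k = P.root i - P.root j) : ψ k = ψ i - ψ j := by
  have := h.add k j i (by rw [hk]; abel)
  omega

lemma pairingIn [P.IsCrystallographic] (η : ι) : P.IsAdd (fun γ ↦ P.pairingIn ℤ γ η) where
  add i j k h := P.pairingIn_eq_add_of_root_eq_add h
  opp i := by simp

end IsAdd

namespace Base

variable (b : P.Base)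

/-- The coefficient of the simple root `σ` in the root `γ`. -/
noncomputable def coeff (σ γ : ι) : ℤ := (b.exists_root_eq_sum_int γ).choose σ

lemma coeff_spec (γ : ι) : P.root γ = ∑ σ ∈ b.support, b.coeff σ γ • P.root σ :=
  (b.exists_root_eq_sum_int γ).choose_spec.2.2

lemma coeff_of_notMem {σ : ι} (h : σ ∉ b.support) (γ : ι) : b.coeff σ γ = 0 := by
  have := (b.exists_root_eq_sum_int γ).choose_spec.1
  by_contra h'
  exact h (this h')

variable {b}

lemma eq_of_sum_eq {f g : ι → ℤ}
    (h : ∑ σ ∈ b.support, f σ • P.root σ = ∑ σ ∈ b.support, g σ • P.root σ) {σ : ι}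
    (hσ : σ ∈ b.support) : f σ = g σ := by
  rw [b.support.sum_subtype (p := (· ∈ b.support)) (by simp) (F := inferInstance),
    b.support.sum_subtype (p := (· ∈ b.support)) (by simp) (F := inferInstance)] at h
  exact Fintype.linearIndependent_iffₛ.mp
      (b.linearIndepOn_root.restrict_scalars' ℤ) (f ∘ (↑)) (g ∘ (↑)) (by simpa) ⟨σ, hσ⟩

lemma coeff_eq {γ : ι} {f : ι → ℤ} (h : P.root γ = ∑ σ ∈ b.support, f σ • P.root σ) {σ : ι}
    (hσ : σ ∈ b.support) : b.coeff σ γ = f σ :=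
  eq_of_sum_eq ((b.coeff_spec γ).symm.trans h) hσ

variable (b)

lemma isAdd_coeff (σ : ι) : P.IsAdd (b.coeff σ) := by
  by_cases hσ : σ ∈ b.support
  · refine ⟨fun i j k h ↦ ?_, fun i ↦ ?_⟩
    · refine coeff_eq (f := fun σ ↦ b.coeff σ i + b.coeff σ j) ?_ hσ
      simp_rw [add_smul, Finset.sum_add_distrib, ← b.coeff_spec, h]
    · refine coeff_eq (f := fun σ ↦ -b.coeff σ i) ?_ hσ
      simp_rw [neg_smul, Finset.sum_neg_distrib, ← b.coeff_spec, root_opp]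
  · refine ⟨fun i j k h ↦ ?_, fun i ↦ ?_⟩ <;> simp [b.coeff_of_notMem hσ]

lemma isAdd_height : P.IsAdd b.height where
  add _ _ _ h := b.height_add h
  opp i := b.height_reflectionPerm_self i

@[simp] lemma coeff_opp (σ γ : ι) : b.coeff σ (P.opp γ) = -b.coeff σ γ :=
  (b.isAdd_coeff σ).opp γ

@[simp] lemma height_opp (γ : ι) : b.height (P.opp γ) = -b.height γ :=
  b.isAdd_height.opp γ

lemma coeff_simple [DecidableEq ι] {τ : ι} (hτ : τ ∈ b.support) (σ : ι) :
    b.coeff σ τ = if σ = τ then 1 else 0 := by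
  by_cases hσ : σ ∈ b.support
  · refine coeff_eq (f := fun σ ↦ if σ = τ then 1 else 0) ?_ hσ
    simp [hτ]
  · rw [b.coeff_of_notMem hσ, if_neg]
    rintro rfl; exact hσ hτ

lemma coeff_self {τ : ι} (hτ : τ ∈ b.support) : b.coeff τ τ = 1 := by
  classical simp [b.coeff_simple hτ]

lemma coeff_ne {σ τ : ι} (hτ : τ ∈ b.support) (h : σ ≠ τ) : b.coeff σ τ = 0 := by
  classical simp [b.coeff_simple hτ, h]

lemma isPos_opp {γ : ι} : b.IsPos (P.opp γ) ↔ ¬ b.IsPos γ :=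
  IsPos.neg_iff_not b γ

variable {b}

lemma IsPos.coeff_nonneg {γ : ι} (h : b.IsPos γ) (σ : ι) : 0 ≤ b.coeff σ γ := by
  obtain ⟨hs, hf, hr⟩ := (b.exists_root_eq_sum_int γ).choose_spec
  rcases hf with hf | hf
  · exact hf.le σ
  · exfalso
    have h' : 0 < ∑ σ ∈ b.support, b.coeff σ γ := h
    exact absurd h' (not_lt.mpr (Finset.sum_nonpos fun i _ ↦ hf.le i))

lemma not_isPos_coeff_nonpos {γ : ι} (h : ¬ b.IsPos γ) (σ : ι) : b.coeff σ γ ≤ 0 := by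
  have := (b.isPos_opp.mpr h).coeff_nonneg σ
  rw [coeff_opp] at this
  omega

lemma isPos_of_coeff_pos {σ γ : ι} (h : 0 < b.coeff σ γ) : b.IsPos γ := by
  by_contra h'
  have := not_isPos_coeff_nonpos h' σ
  omega

lemma eq_of_coeff_eq {γ η : ι} (h : ∀ σ ∈ b.support, b.coeff σ γ = b.coeff σ η) : γ = η := by
  apply P.root.injective
  rw [b.coeff_spec γ, b.coeff_spec η]
  exact Finset.sum_congr rfl fun σ hσ ↦ by rw [h σ hσ]

/-- A simple root is not the sum of two positive roots. -/
lemma IsPos.root_add_ne {γ η σ : ι} (hγ : b.IsPos γ) (hη : b.IsPos η) (hσ : σ ∈ b.support) :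
    P.root σ ≠ P.root γ + P.root η := by
  intro h
  have h1 := b.height_add h
  rw [height_one_of_mem_support hσ] at h1
  rw [isPos_iff] at hγ hη
  omega

section Crystallographic

variable [Finite ι] [P.IsCrystallographic]

/-- Every root is reached from simple roots by negation and by adding simple roots, so an additive
function is the restriction of a linear form on the root lattice. -/
lemma _root_.RootPairing.IsAdd.eq_sum {ψ : ι → ℤ} (h : P.IsAdd ψ) (b : P.Base) (γ : ι) :
    ψ γ = ∑ σ ∈ b.support, b.coeff σ γ * ψ σ := by
  refine b.induction_add γ (p := fun γ ↦ ψ γ = ∑ σ ∈ b.support, b.coeff σ γ * ψ σ)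
    (fun i hi ↦ ?_) (fun i hi ↦ ?_) (fun i j k hk hi hj ↦ ?_)
  · change ψ (P.opp i) = ∑ σ ∈ b.support, b.coeff σ (P.opp i) * ψ σ
    simp [h.opp, hi]
  · classical
    simp [b.coeff_simple hi, hi]
  · classical
    simp_rw [h.add i j k hk, (b.isAdd_coeff _).add i j k hk, add_mul, Finset.sum_add_distrib, ← hi]
    simp [b.coeff_simple hj, hj]

/-- A positive root which is not simple is the sum of a positive and a simple root. -/
lemma IsPos.exists_eq_add {γ : ι} (h : b.IsPos γ) (hγ : γ ∉ b.support) :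
    ∃ η, ∃ σ ∈ b.support, b.IsPos η ∧ P.root γ = P.root η + P.root σ := by
  obtain ⟨j, hj, hj'⟩ := h.exists_mem_support_pos_pairingIn
  rw [P.zero_lt_pairingIn_iff'] at hj'
  have hij : γ ≠ j := by rintro rfl; exact hγ hj
  obtain ⟨k, hk⟩ := P.root_sub_root_mem_of_pairingIn_pos hj' hij
  exact ⟨k, j, hj, h.sub hj hk, by rw [hk]; abel⟩

/-- If an additive function is nonnegative on the simple roots where the coefficients of
`γ` and `η` differ, it is monotone. -/
lemma _root_.RootPairing.IsAdd.le_of_coeff_le {ψ : ι → ℤ} (h : P.IsAdd ψ) {γ η : ι}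
    (hle : ∀ σ ∈ b.support, b.coeff σ γ ≤ b.coeff σ η)
    (hψ : ∀ σ ∈ b.support, b.coeff σ γ < b.coeff σ η → 0 ≤ ψ σ) : ψ γ ≤ ψ η := by
  rw [h.eq_sum b γ, h.eq_sum b η]
  refine Finset.sum_le_sum fun σ hσ ↦ ?_
  rcases (hle σ hσ).eq_or_lt with h1 | h1
  · rw [h1]
  · exact mul_le_mul_of_nonneg_right h1.le (hψ σ hσ h1)

end Crystallographic

end Base

/-! ### The highest root -/

section Highest

variable {b : P.Base} {θ : ι}

namespace IsHighestRoot

lemma coeff_le (hθ : IsHighestRoot b θ) (σ γ : ι) : b.coeff σ γ ≤ b.coeff σ θ := by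
  by_cases hσ : σ ∈ b.support
  swap
  · simp [b.coeff_of_notMem hσ]
  have key : ∀ x ∈ AddSubmonoid.closure (P.root '' b.support),
      ∃ f : ι → ℕ, x = ∑ σ ∈ b.support, (f σ : ℤ) • P.root σ := by
    intro x hx
    induction hx using AddSubmonoid.closure_induction with
    | mem x hx =>
      classical
      obtain ⟨j, hj, rfl⟩ := hx
      refine ⟨fun i ↦ if i = j then 1 else 0, ?_⟩
      have hj' : j ∈ b.support := hj
      simp [hj']
    | zero => exact ⟨0, by simp⟩
    | add x y _ _ hx hy =>
      obtain ⟨f, rfl⟩ := hx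
      obtain ⟨g, rfl⟩ := hy
      exact ⟨f + g, by simp [add_smul, Finset.sum_add_distrib]⟩
  obtain ⟨f, hf⟩ := key _ (hθ γ)
  have h1 : P.root θ = ∑ σ ∈ b.support, ((f σ : ℤ) + b.coeff σ γ) • P.root σ := by
    simp_rw [add_smul, Finset.sum_add_distrib, ← hf, ← b.coeff_spec]
    abel
  rw [Base.coeff_eq h1 hσ]
  omega

lemma neg_coeff_le (hθ : IsHighestRoot b θ) (σ γ : ι) : -b.coeff σ θ ≤ b.coeff σ γ := by
  have := hθ.coeff_le σ (P.opp γ)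
  rw [Base.coeff_opp] at this
  omega

lemma one_le_coeff (hθ : IsHighestRoot b θ) {σ : ι} (hσ : σ ∈ b.support) :
    1 ≤ b.coeff σ θ := by
  rw [← b.coeff_self hσ]; exact hθ.coeff_le σ σ

lemma height_le (hθ : IsHighestRoot b θ) (γ : ι) : b.height γ ≤ b.height θ :=
  Finset.sum_le_sum fun σ _ ↦ hθ.coeff_le σ γ

variable [Finite ι] [P.IsCrystallographic]

lemma isPos (hθ : IsHighestRoot b θ) : b.IsPos θ := by
  obtain ⟨σ, hσ, -⟩ := Base.exists_mem_support_pos_pairingIn_ne_zero (b := b) θ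
  exact Base.isPos_of_coeff_pos (hθ.one_le_coeff hσ)

lemma eq_of_height_le (hθ : IsHighestRoot b θ) {γ : ι} (h : b.height θ ≤ b.height γ) : γ = θ := by
  refine Base.eq_of_coeff_eq (b := b) fun σ hσ ↦ ?_
  have h1 := (Finset.sum_eq_sum_iff_of_le (fun σ _ ↦ hθ.coeff_le σ γ)).mp
    (le_antisymm (hθ.height_le γ) h)
  exact h1 σ hσ

lemma root_ne_add (hθ : IsHighestRoot b θ) {σ : ι} (hσ : b.IsPos σ) (γ : ι) :
    P.root γ ≠ P.root θ + P.root σ := by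
  intro h
  have h1 := b.height_add h
  have h2 := hθ.height_le γ
  rw [Base.isPos_iff] at hσ
  omega

lemma pairingIn_simple_nonneg (hθ : IsHighestRoot b θ) {σ : ι} (hσ : σ ∈ b.support) :
    0 ≤ P.pairingIn ℤ σ θ := by
  by_contra! h
  have h' : P.pairingIn ℤ θ σ < 0 := by
    have := P.zero_lt_pairingIn_iff' (S := ℤ) (i := P.opp σ) (j := θ)
    simp only [pairingIn_opp_left, pairingIn_opp_right] at this
    omega
  have hne : P.root θ ≠ -P.root σ := by
    intro he
    rw [← eq_opp_iff] at he
    have := hθ.isPos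
    rw [he, Base.isPos_opp] at this
    exact this (Base.isPos_of_mem_support hσ)
  obtain ⟨k, hk⟩ := P.root_add_root_mem_of_pairingIn_neg h' hne
  exact hθ.root_ne_add (Base.isPos_of_mem_support hσ) k hk

lemma pairingIn_nonneg (hθ : IsHighestRoot b θ) {γ : ι} (hγ : b.IsPos γ) :
    0 ≤ P.pairingIn ℤ γ θ := by
  rw [(IsAdd.pairingIn θ).eq_sum b γ]
  exact Finset.sum_nonneg fun σ hσ ↦
    mul_nonneg (hγ.coeff_nonneg σ) (hθ.pairingIn_simple_nonneg hσ)

lemma pairingIn_nonpos (hθ : IsHighestRoot b θ) {γ : ι} (hγ : ¬ b.IsPos γ) :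
    P.pairingIn ℤ γ θ ≤ 0 := by
  have := hθ.pairingIn_nonneg (b.isPos_opp.mpr hγ)
  rw [pairingIn_opp_left] at this
  omega

lemma isPos_of_pairingIn_pos (hθ : IsHighestRoot b θ) {γ : ι} (h : 0 < P.pairingIn ℤ γ θ) :
    b.IsPos γ := by
  by_contra h'
  have := hθ.pairingIn_nonpos h'
  omega

/-- A positive root orthogonal to the highest root involves only simple roots with the same
property. -/
lemma coeff_eq_zero (hθ : IsHighestRoot b θ) {γ σ : ι} (hγ : b.IsPos γ)
    (h : P.pairingIn ℤ γ θ = 0) (hσ : 0 < P.pairingIn ℤ σ θ) : b.coeff σ γ = 0 := by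
  by_cases hs : σ ∈ b.support
  swap
  · exact b.coeff_of_notMem hs γ
  rw [(IsAdd.pairingIn θ).eq_sum b γ, Finset.sum_eq_zero_iff_of_nonneg fun σ hσ ↦
    mul_nonneg (hγ.coeff_nonneg σ) (hθ.pairingIn_simple_nonneg hσ)] at h
  have := h σ hs
  simp only [mul_eq_zero] at this
  omega

end IsHighestRoot

end Highest

/-! ### Roots of maximal length -/

section Long

variable [Finite ι] [P.IsCrystallographic] [P.IsReduced]

/-- A root for which no other root has pairing greater than one; equivalently, by
`IsLongRoot.isMaxLength` a root of maximal length. -/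
def IsMaxLength (P : RootPairing ι R M N) [P.IsCrystallographic] (μ : ι) : Prop :=
  ∀ γ : ι, γ = μ ∨ P.pairingIn ℤ γ μ ≤ 1

lemma IsLongRoot.isMaxLength [Fintype ι] {μ : ι} (h : IsLongRoot P μ) : P.IsMaxLength μ := by
  intro γ
  by_cases h1 : γ = μ
  · exact Or.inl h1
  right
  by_contra! h2
  have hne : P.root γ ≠ P.root μ := fun h ↦ h1 (P.root.injective h)
  have hne' : P.root γ ≠ -P.root μ := by
    intro h
    rw [← eq_opp_iff] at h
    simp [h] at h2
  have := RootPositiveForm.rootLength_lt_of_pairingIn_notMem (P.posRootForm ℤ) hne hne'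
    (by simp; omega)
  exact absurd (h γ) (not_le.mpr this)

lemma IsMaxLength.neg_one_le {μ : ι} (h : P.IsMaxLength μ) (γ : ι) :
    γ = P.opp μ ∨ -1 ≤ P.pairingIn ℤ γ μ := by
  rcases h (P.opp γ) with h1 | h1
  · left; rw [← h1, opp_opp]
  · right; rw [pairingIn_opp_left] at h1; omega

/-- A dominant root of maximal length is the highest root. -/
lemma IsMaxLength.eq_of_dominant {b : P.Base} {θ : ι} (hθ : IsHighestRoot b θ) {μ : ι}
    (h : P.IsMaxLength μ) (hdom : ∀ σ ∈ b.support, 0 ≤ P.pairingIn ℤ σ μ) : θ = μ := by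
  refine (h θ).resolve_right ?_
  -- As θ - μ is a nonnegative combination of simple roots and μ is dominant, ⟨θ, μ⟩ ≥ ⟨μ, μ⟩ = 2,
  -- against maximal length unless θ = μ.
  have h1 : P.pairingIn ℤ μ μ ≤ P.pairingIn ℤ θ μ :=
    (IsAdd.pairingIn μ).le_of_coeff_le (b := b) (fun σ _ ↦ hθ.coeff_le σ μ) fun σ hσ _ ↦ hdom σ hσ
  rw [pairingIn_same] at h1
  omega

end Long

end RootPairing

/-! ### Affine roots and the permutations of them induced by linear maps -/

namespace RootPairing

variable {ι R M N : Type*} [Field R] [CharZero R] [AddCommGroup M] [Module R M]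
  [AddCommGroup N] [Module R N] {P : RootPairing ι R M N}

lemma affineRoot_injective {γ η : ι} {k l : ℤ} (h : P.affineRoot γ k = P.affineRoot η l) :
    γ = η ∧ k = l := by
  simpa [affineRoot] using h

lemma affineRoot_eq_add {γ η ζ : ι} {k l m : ℤ} :
    P.affineRoot γ k = P.affineRoot η l + P.affineRoot ζ m ↔
      P.root γ = P.root η + P.root ζ ∧ k = l + m := by
  simp only [affineRoot, Prod.mk_add_mk, Prod.mk.injEq]
  norm_cast

lemma perm_apply_inv {α : Type*} (g : Equiv.Perm α) (x : α) : g (g⁻¹ x) = x :=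
  g.apply_symm_apply x

lemma perm_inv_apply {α : Type*} (g : Equiv.Perm α) (x : α) : g⁻¹ (g x) = x :=
  g.symm_apply_apply x

section AffineRoots

/-- The negative of the affine root `x = (γ, k)`, which stands for `γ + k δ`. -/
def affineNeg (P : RootPairing ι R M N) (x : ι × ℤ) : ι × ℤ := (P.opp x.1, -x.2)

@[simp] lemma affineNeg_fst (x : ι × ℤ) : (P.affineNeg x).1 = P.opp x.1 := rfl

@[simp] lemma affineNeg_snd (x : ι × ℤ) : (P.affineNeg x).2 = -x.2 := rfl

@[simp] lemma affineNeg_affineNeg (x : ι × ℤ) : P.affineNeg (P.affineNeg x) = x := by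
  ext <;> simp

lemma affineRoot_affineNeg (x : ι × ℤ) :
    P.affineRoot (P.affineNeg x).1 (P.affineNeg x).2 = -P.affineRoot x.1 x.2 := by
  simp [affineRoot]

variable [P.IsCrystallographic]

lemma reflectionPerm_opp (γ η : ι) : P.reflectionPerm (P.opp γ) η = P.reflectionPerm γ η := by
  apply P.root.injective
  simp only [root_reflectionPerm_eq, root_opp, pairingIn_opp_right]
  module

/-- The reflection in an affine root, as a permutation of the affine roots. -/
noncomputable def affinePerm (P : RootPairing ι R M N) [P.IsCrystallographic] (β : ι × ℤ) :
    Equiv.Perm (ι × ℤ) :=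
  Function.Involutive.toPerm
    (fun x ↦ (P.reflectionPerm β.1 x.1, x.2 - P.pairingIn ℤ x.1 β.1 * β.2)) fun x ↦ by
      ext
      · simp
      · simp only [← pairingIn_reflectionPerm, pairingIn_reflectionPerm_self_right]
        ring

@[simp] lemma affinePerm_apply (β x : ι × ℤ) :
    P.affinePerm β x = (P.reflectionPerm β.1 x.1, x.2 - P.pairingIn ℤ x.1 β.1 * β.2) := rfl

@[simp] lemma affinePerm_mul_self (β : ι × ℤ) : P.affinePerm β * P.affinePerm β = 1 := by
  ext1 x
  exact (Function.Involutive.toPerm_involutive _) x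

@[simp] lemma affinePerm_affinePerm (β x : ι × ℤ) :
    P.affinePerm β (P.affinePerm β x) = x := by
  rw [← Equiv.Perm.mul_apply, affinePerm_mul_self]; rfl

@[simp] lemma affinePerm_inv (β : ι × ℤ) : (P.affinePerm β)⁻¹ = P.affinePerm β :=
  inv_eq_of_mul_eq_one_left (affinePerm_mul_self β)

lemma affinePerm_self (β : ι × ℤ) : P.affinePerm β β = P.affineNeg β := by
  ext
  · rfl
  · simp; ring

lemma affineRoot_affinePerm (β x : ι × ℤ) :
    P.affineRoot (P.affinePerm β x).1 (P.affinePerm β x).2 =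
      P.affineRoot x.1 x.2 - P.pairingIn ℤ x.1 β.1 • P.affineRoot β.1 β.2 := by
  simp [affineRoot, root_reflectionPerm_eq, -root_reflectionPerm]

lemma affineReflection_affineRoot (β x : ι × ℤ) :
    P.affineReflection β.1 β.2 (P.affineRoot x.1 x.2) =
      P.affineRoot (P.affinePerm β x).1 (P.affinePerm β x).2 := by
  rw [affineRoot_affinePerm, affineReflection, Module.reflection_apply]
  have : (P.coroot' β.1 ∘ₗ LinearMap.fst R M R) (P.affineRoot x.1 x.2) =
      ((P.pairingIn ℤ x.1 β.1 : ℤ) : R) := by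
    simpa [affineRoot] using (P.algebraMap_pairingIn ℤ x.1 β.1).symm
  rw [this, Int.cast_smul_eq_zsmul]

/-- A permutation of the affine roots which comes from a linear map, preserves the pairings of the
underlying roots, and commutes with adding `δ`. -/
structure IsAffineAut (P : RootPairing ι R M N) [P.IsCrystallographic]
    (g : Equiv.Perm (ι × ℤ)) : Prop where
  exists_linear : ∃ w : (M × R) ≃ₗ[R] (M × R), ∀ x : ι × ℤ,
    w (P.affineRoot x.1 x.2) = P.affineRoot (g x).1 (g x).2
  pairingIn : ∀ x y, P.pairingIn ℤ (g x).1 (g y).1 = P.pairingIn ℤ x.1 y.1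
  shift : ∀ γ k, g (γ, k) = ((g (γ, 0)).1, (g (γ, 0)).2 + k)

namespace IsAffineAut

lemma one : P.IsAffineAut 1 :=
  ⟨⟨1, fun x ↦ rfl⟩, fun x y ↦ rfl, fun γ k ↦ by simp⟩

lemma mul {g h : Equiv.Perm (ι × ℤ)} (hg : P.IsAffineAut g) (hh : P.IsAffineAut h) :
    P.IsAffineAut (g * h) := by
  obtain ⟨w, hw⟩ := hg.exists_linear
  obtain ⟨v, hv⟩ := hh.exists_linear
  refine ⟨⟨w * v, fun x ↦ ?_⟩, fun x y ↦ ?_, fun γ k ↦ ?_⟩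
  · rw [LinearEquiv.mul_apply, hv, hw]; rfl
  · rw [Equiv.Perm.mul_apply, Equiv.Perm.mul_apply, hg.pairingIn, hh.pairingIn]
  · simp only [Equiv.Perm.mul_apply]
    rw [hh.shift γ k, hg.shift, hg.shift (h (γ, 0)).1 (h (γ, 0)).2]
    simp [add_assoc]

lemma inv {g : Equiv.Perm (ι × ℤ)} (hg : P.IsAffineAut g) : P.IsAffineAut g⁻¹ := by
  obtain ⟨w, hw⟩ := hg.exists_linear
  refine ⟨⟨w⁻¹, fun x ↦ ?_⟩, fun x y ↦ ?_, fun γ k ↦ ?_⟩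
  · have h1 := hw (g⁻¹ x)
    rw [perm_apply_inv] at h1
    rw [← h1]
    exact w.symm_apply_apply _
  · rw [← hg.pairingIn, perm_apply_inv, perm_apply_inv]
  · rw [Equiv.Perm.inv_eq_iff_eq, hg.shift]
    have h1 : g (g⁻¹ (γ, 0)) = (γ, 0) := perm_apply_inv _ _
    rw [← Prod.mk.eta (p := g⁻¹ (γ, 0)), hg.shift] at h1
    rw [Prod.ext_iff] at h1 ⊢
    simp only at h1 ⊢
    refine ⟨h1.1.symm, ?_⟩
    rw [← add_assoc, h1.2, zero_add]

lemma affinePerm (β : ι × ℤ) : P.IsAffineAut (P.affinePerm β) := by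
  refine ⟨⟨P.affineReflection β.1 β.2, affineReflection_affineRoot β⟩, fun x y ↦ ?_, fun γ k ↦ ?_⟩
  · simp [P.pairingIn_reflectionPerm]
  · simp; ring

variable {g : Equiv.Perm (ι × ℤ)} (hg : P.IsAffineAut g)
include hg

lemma apply_neg (x : ι × ℤ) : g (P.affineNeg x) = P.affineNeg (g x) := by
  obtain ⟨w, hw⟩ := hg.exists_linear
  have h1 := hw (P.affineNeg x)
  rw [affineRoot_affineNeg, map_neg, hw, ← affineRoot_affineNeg] at h1
  have := affineRoot_injective h1
  exact (Prod.ext this.1 this.2).symm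

lemma apply_add {x y z : ι × ℤ} (hr : P.root x.1 = P.root y.1 + P.root z.1)
    (hl : x.2 = y.2 + z.2) :
    P.root (g x).1 = P.root (g y).1 + P.root (g z).1 ∧ (g x).2 = (g y).2 + (g z).2 := by
  obtain ⟨w, hw⟩ := hg.exists_linear
  rw [← affineRoot_eq_add, ← hw, ← hw, ← hw, ← map_add, affineRoot_eq_add.mpr ⟨hr, hl⟩]

lemma apply_affinePerm (β x : ι × ℤ) :
    g (P.affinePerm β x) = P.affinePerm (g β) (g x) := by
  obtain ⟨w, hw⟩ := hg.exists_linear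
  have h1 := hw (P.affinePerm β x)
  rw [affineRoot_affinePerm, map_sub, map_zsmul, hw, hw, ← hg.pairingIn x β,
    ← affineRoot_affinePerm] at h1
  have := affineRoot_injective h1
  exact (Prod.ext this.1 this.2).symm

lemma conj_affinePerm (β : ι × ℤ) : g * P.affinePerm β = P.affinePerm (g β) * g :=
  _root_.Equiv.ext fun x ↦ hg.apply_affinePerm β x

lemma isAdd_comp {φ : ι → ℤ} (hφ : P.IsAdd φ) : P.IsAdd fun γ ↦ φ (g (γ, 0)).1 where
  add i j k h := hφ.add _ _ _
    (hg.apply_add (x := (k, 0)) (y := (i, 0)) (z := (j, 0)) h (by simp)).1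
  opp i := by
    have := hg.apply_neg (i, 0)
    simp only [affineNeg, neg_zero] at this
    rw [this, hφ.opp]

lemma isAdd_level : P.IsAdd fun γ ↦ (g (γ, 0)).2 where
  add i j k h := (hg.apply_add (x := (k, 0)) (y := (i, 0)) (z := (j, 0)) h (by simp)).2
  opp i := by
    have := hg.apply_neg (i, 0)
    simp only [affineNeg, neg_zero] at this
    rw [this]

end IsAffineAut

end AffineRoots

lemma IsAdd.add_fun {φ ψ : ι → ℤ} (hφ : P.IsAdd φ) (hψ : P.IsAdd ψ) :
    P.IsAdd fun γ ↦ φ γ + ψ γ where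
  add i j k h := by rw [hφ.add i j k h, hψ.add i j k h]; ring
  opp i := by rw [hφ.opp, hψ.opp]; ring

lemma IsAdd.neg_fun {φ : ι → ℤ} (hφ : P.IsAdd φ) : P.IsAdd fun γ ↦ -φ γ where
  add i j k h := by rw [hφ.add i j k h]; ring
  opp i := by rw [hφ.opp]

/-! ### Positive affine roots -/

section Positivity

variable (b : P.Base) (θ : ι)

/-- Positivity of affine roots. -/
def AffinePos (x : ι × ℤ) : Prop := (x.2 = 0 ∧ b.IsPos x.1) ∨ 1 ≤ x.2

/-- The affine simple roots. -/
def affineSimple : Set (ι × ℤ) := {x | x.1 ∈ b.support ∧ x.2 = 0} ∪ {(P.opp θ, 1)}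

lemma mem_positiveAffineRoots {x : M × R} :
    x ∈ positiveAffineRoots b ↔ ∃ y : ι × ℤ, x = P.affineRoot y.1 y.2 ∧ AffinePos b y := by
  simp [positiveAffineRoots, AffinePos]

lemma affineRoot_mem_positiveAffineRoots {x : ι × ℤ} :
    P.affineRoot x.1 x.2 ∈ positiveAffineRoots b ↔ AffinePos b x := by
  rw [mem_positiveAffineRoots]
  refine ⟨?_, fun h ↦ ⟨x, rfl, h⟩⟩
  rintro ⟨y, hy, h⟩
  have := affineRoot_injective hy
  rwa [Prod.ext this.1 this.2]

variable {b}

lemma affinePos_neg {x : ι × ℤ} : AffinePos b (P.affineNeg x) ↔ ¬ AffinePos b x := by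
  simp only [AffinePos, affineNeg, Base.isPos_opp]
  by_cases h : b.IsPos x.1 <;> simp [h] <;> omega

lemma AffinePos.add {x y z : ι × ℤ} (hx : AffinePos b x) (hy : AffinePos b y)
    (hr : P.root z.1 = P.root x.1 + P.root y.1) (hl : z.2 = x.2 + y.2) : AffinePos b z := by
  rcases hx with hx | hx <;> rcases hy with hy | hy
  · exact Or.inl ⟨by omega, hx.2.add hy.2 hr⟩
  all_goals right; omega

lemma affinePos_of_mem_affineSimple {β : ι × ℤ} (h : β ∈ affineSimple b θ) : AffinePos b β := by
  rcases h with h | rfl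
  · exact Or.inl ⟨h.2, Base.isPos_of_mem_support h.1⟩
  · exact Or.inr le_rfl

variable {θ} [Finite ι] [P.IsCrystallographic]

/-- A function which is affine and nonnegative on the affine simple roots that occur in a
positive affine root is nonnegative on this affine root. -/
lemma AffinePos.nonneg_of_isAdd (hθ : IsHighestRoot b θ) {x : ι × ℤ} (hx : AffinePos b x)
    {ψ : ι → ℤ} (hψ : P.IsAdd ψ) {c : ℤ}
    (h1 : ∀ σ ∈ b.support, b.coeff σ x.1 + x.2 * b.coeff σ θ ≠ 0 → 0 ≤ ψ σ)
    (h2 : x.2 ≠ 0 → ψ θ ≤ c) : 0 ≤ ψ x.1 + x.2 * c := by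
  have h3 : 0 ≤ ψ x.1 + x.2 * ψ θ := by
    rw [hψ.eq_sum b x.1, hψ.eq_sum b θ, Finset.mul_sum, ← Finset.sum_add_distrib]
    refine Finset.sum_nonneg fun σ hσ ↦ ?_
    rw [← mul_assoc, ← add_mul]
    -- In terms of affine simple roots, γ + kδ has coefficient k at δ - θ, and this expression is
    -- its coefficient at σ.
    have h4 : 0 ≤ b.coeff σ x.1 + x.2 * b.coeff σ θ := by
      rcases hx with hx | hx
      · rw [hx.1]; simpa using hx.2.coeff_nonneg σ
      · have := hθ.neg_coeff_le σ x.1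
        have := hθ.one_le_coeff hσ
        nlinarith
    by_cases h5 : b.coeff σ x.1 + x.2 * b.coeff σ θ = 0
    · rw [h5, zero_mul]
    · exact mul_nonneg h4 (h1 σ hσ h5)
  have h6 : 0 ≤ x.2 := by rcases hx with hx | hx <;> omega
  by_cases h7 : x.2 = 0
  · rw [h7] at h3 ⊢; simpa using h3
  · have := h2 h7
    nlinarith

/-- The reflection of -γ in θ is -γ + ⟨γ, θ⟩θ. If ⟨γ, θ⟩ ≥ 2, the bound on its height gives γ at
least the height of θ, so γ = θ. -/
lemma IsHighestRoot.isMaxLength (hθ : IsHighestRoot b θ) : P.IsMaxLength θ := by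
  intro γ
  by_contra! h
  have h1 := root_reflectionPerm_eq (P := P) (P.opp γ) θ
  apply h.1
  refine hθ.eq_of_height_le ?_
  have h2 : b.height (P.reflectionPerm θ (P.opp γ)) =
      b.height (P.opp γ) + (-P.pairingIn ℤ (P.opp γ) θ) • b.height θ :=
    b.height_add_zsmul (by rw [h1]; module)
  have h3 := hθ.height_le (P.reflectionPerm θ (P.opp γ))
  have h4 := hθ.isPos
  rw [Base.isPos_iff] at h4
  simp only [Base.height_opp, pairingIn_opp_left, neg_neg, smul_eq_mul] at h2
  nlinarith [h.2]

variable [P.IsReduced]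

/-- A simple affine reflection permutes the other positive affine roots. -/
lemma AffinePos.affinePerm (hθ : IsHighestRoot b θ) {x β : ι × ℤ} (hβ : β ∈ affineSimple b θ)
    (hx : AffinePos b x) (hne : x ≠ β) : AffinePos b (P.affinePerm β x) := by
  obtain ⟨γ, k⟩ := x
  rcases hβ with hβ | rfl
  · obtain ⟨σ, l⟩ := β
    obtain ⟨hσ, rfl⟩ := hβ
    rcases hx with ⟨rfl, hx⟩ | hx
    · refine Or.inl ⟨by simp, hx.reflectionPerm hσ ?_⟩
      rintro rfl
      exact hne rfl
    · right; simpa using hx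
  · simp only [AffinePos, affinePerm_apply, reflectionPerm_opp, pairingIn_opp_right] at hx ⊢
    rcases hx with ⟨rfl, hx⟩ | hx
    · have := hθ.pairingIn_nonneg hx
      rcases this.eq_or_lt with h | h
      · left
        rw [P.reflectionPerm_eq_of_pairing_eq_zero
          (by rw [← P.algebraMap_pairingIn ℤ, ← h, map_zero])]
        exact ⟨by omega, hx⟩
      · right; omega
    -- Apart from γ = -θ the level drops by at most one, so only level 1 with ⟨γ, θ⟩ = -1 reaches
    -- level 0, and then the finite part is γ + θ.
    · rcases hθ.isMaxLength.neg_one_le γ with h | h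
      · subst h
        have hk : k ≠ 1 := by rintro rfl; exact hne rfl
        simp only [pairingIn_opp_left, pairingIn_same]
        by_cases hk2 : k = 2
        · left
          refine ⟨by omega, ?_⟩
          have : P.reflectionPerm θ (P.opp θ) = θ := P.reflectionPerm_self θ θ
          rw [this]; exact hθ.isPos
        · right; omega
      · by_cases h0 : k = 1 ∧ P.pairingIn ℤ γ θ = -1
        · left
          refine ⟨by omega, ?_⟩
          have h1 : P.root (P.reflectionPerm θ γ) = P.root γ + P.root θ := by
            rw [root_reflectionPerm_eq, h0.2]; module
          rw [Base.isPos_iff', b.height_add h1]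
          have := hθ.height_le (P.opp γ)
          rw [Base.height_opp] at this
          omega
        · right; omega

end Positivity

/-! ### The affine Weyl group: words, deletion, and triviality of inversion-free elements -/

section AffineWeyl

variable (b : P.Base) (θ : ι) [P.IsCrystallographic]

/-- The affine Weyl group as a group of permutations of the affine roots. -/
def affineWeylPerm : Subgroup (Equiv.Perm (ι × ℤ)) :=
  Subgroup.closure (P.affinePerm '' affineSimple b θ)

variable {b θ}

lemma affinePerm_mem_affineWeylPerm {β : ι × ℤ} (h : β ∈ affineSimple b θ) :
    P.affinePerm β ∈ affineWeylPerm b θ :=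
  Subgroup.subset_closure ⟨β, h, rfl⟩

lemma isAffineAut_of_mem_closure {S : Set (ι × ℤ)} {g : Equiv.Perm (ι × ℤ)}
    (hg : g ∈ Subgroup.closure (P.affinePerm '' S)) : P.IsAffineAut g := by
  induction hg using Subgroup.closure_induction with
  | mem x hx => obtain ⟨β, -, rfl⟩ := hx; exact .affinePerm β
  | one => exact .one
  | mul x y _ _ hx hy => exact hx.mul hy
  | inv x _ hx => exact hx.inv

/-- With `exists_mem_affineWeylPerm`, this allows linear maps to be traded for permutations; only
the action on affine roots matters. -/
lemma exists_mem_affineWeylGroup {g : Equiv.Perm (ι × ℤ)} (hg : g ∈ affineWeylPerm b θ) :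
    ∃ w ∈ affineWeylGroup b θ, ∀ x : ι × ℤ,
      w (P.affineRoot x.1 x.2) = P.affineRoot (g x).1 (g x).2 := by
  induction hg using Subgroup.closure_induction with
  | mem x hx =>
    obtain ⟨β, hβ, rfl⟩ := hx
    refine ⟨P.affineReflection β.1 β.2, Subgroup.subset_closure ?_, affineReflection_affineRoot β⟩
    rcases hβ with hβ | rfl
    · exact Or.inl ⟨β.1, hβ.1, by rw [hβ.2]⟩
    · exact Or.inr ⟨P.opp θ, by simp, rfl⟩
  | one => exact ⟨1, one_mem _, fun x ↦ rfl⟩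
  | mul x y _ _ hx hy =>
    obtain ⟨w, hw, hw'⟩ := hx
    obtain ⟨v, hv, hv'⟩ := hy
    refine ⟨w * v, mul_mem hw hv, fun z ↦ ?_⟩
    rw [LinearEquiv.mul_apply, hv', hw']; rfl
  | inv x _ hx =>
    obtain ⟨w, hw, hw'⟩ := hx
    refine ⟨w⁻¹, inv_mem hw, fun z ↦ ?_⟩
    have h1 := hw' (x⁻¹ z)
    rw [perm_apply_inv] at h1
    rw [← h1]
    exact w.symm_apply_apply _

lemma exists_mem_affineWeylPerm {w : (M × R) ≃ₗ[R] (M × R)} (hw : w ∈ affineWeylGroup b θ) :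
    ∃ g ∈ affineWeylPerm b θ, ∀ x : ι × ℤ,
      w (P.affineRoot x.1 x.2) = P.affineRoot (g x).1 (g x).2 := by
  induction hw using Subgroup.closure_induction with
  | mem x hx =>
    rcases hx with ⟨σ, hσ, rfl⟩ | ⟨γ, hγ, rfl⟩
    · exact ⟨P.affinePerm (σ, 0), affinePerm_mem_affineWeylPerm (Or.inl ⟨hσ, rfl⟩),
        affineReflection_affineRoot (σ, 0)⟩
    · obtain rfl := eq_opp_iff.mpr hγ
      exact ⟨P.affinePerm (P.opp θ, 1), affinePerm_mem_affineWeylPerm (Or.inr rfl),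
        affineReflection_affineRoot (P.opp θ, 1)⟩
  | one => exact ⟨1, one_mem _, fun x ↦ rfl⟩
  | mul x y _ _ hx hy =>
    obtain ⟨w, hw, hw'⟩ := hx
    obtain ⟨v, hv, hv'⟩ := hy
    refine ⟨w * v, mul_mem hw hv, fun z ↦ ?_⟩
    rw [LinearEquiv.mul_apply, hv', hw']; rfl
  | inv x _ hx =>
    obtain ⟨g, hg, hg'⟩ := hx
    refine ⟨g⁻¹, inv_mem hg, fun z ↦ ?_⟩
    have h1 := hg' (g⁻¹ z)
    rw [perm_apply_inv] at h1
    rw [← h1]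
    exact x.symm_apply_apply _

variable [Finite ι] [P.IsReduced]

/-- The deletion condition for words in the simple affine reflections. -/
lemma exists_deletion (hθ : IsHighestRoot b θ) (l : List (ι × ℤ))
    (hl : ∀ β ∈ l, β ∈ affineSimple b θ) {σ : ι × ℤ} (hσ : AffinePos b σ)
    (hneg : ¬ AffinePos b ((l.map P.affinePerm).prod σ)) :
    ∃ l' : List (ι × ℤ), (∀ β ∈ l', β ∈ affineSimple b θ) ∧ l'.length + 1 = l.length ∧
      (l.map P.affinePerm).prod * P.affinePerm σ = (l'.map P.affinePerm).prod := by
  induction l with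
  | nil => simp [hσ] at hneg
  | cons β t ih =>
    have ht : ∀ β ∈ t, β ∈ affineSimple b θ := fun x hx ↦ hl x (List.mem_cons_of_mem _ hx)
    by_cases h : AffinePos b ((t.map P.affinePerm).prod σ)
    · have h1 : (t.map P.affinePerm).prod σ = β := by
        by_contra hne
        refine hneg ?_
        simpa using h.affinePerm hθ (hl β (by simp)) hne
      refine ⟨t, ht, by simp, ?_⟩
      have h2 : P.IsAffineAut (t.map P.affinePerm).prod := by
        clear * -
        induction t with
        | nil => exact .one
        | cons a t ih => simpa using (IsAffineAut.affinePerm a).mul ih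
      rw [List.map_cons, List.prod_cons, mul_assoc, h2.conj_affinePerm, h1, ← mul_assoc,
        affinePerm_mul_self, one_mul]
    · obtain ⟨l', h1, h2, h3⟩ := ih ht h
      refine ⟨β :: l', ?_, by simp [h2], ?_⟩
      · intro x hx
        rcases List.mem_cons.mp hx with rfl | hx
        · exact hl x (by simp)
        · exact h1 x hx
      · simp [mul_assoc, h3]

lemma exists_word {g : Equiv.Perm (ι × ℤ)} (hg : g ∈ affineWeylPerm b θ) :
    ∃ l : List (ι × ℤ), (∀ β ∈ l, β ∈ affineSimple b θ) ∧ (l.map P.affinePerm).prod = g := by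
  induction hg using Subgroup.closure_induction with
  | mem x hx => obtain ⟨β, hβ, rfl⟩ := hx; exact ⟨[β], by simpa using hβ, by simp⟩
  | one => exact ⟨[], by simp, by simp⟩
  | mul x y _ _ hx hy =>
    obtain ⟨l, hl, rfl⟩ := hx
    obtain ⟨m, hm, rfl⟩ := hy
    refine ⟨l ++ m, ?_, by simp⟩
    intro β hβ
    rcases List.mem_append.mp hβ with h | h
    exacts [hl β h, hm β h]
  | inv x _ hx =>
    obtain ⟨l, hl, rfl⟩ := hx
    refine ⟨l.reverse, by simpa using hl, ?_⟩
    rw [List.prod_inv_reverse]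
    simp [Function.comp_def]

/-- An element of the affine Weyl group which preserves positivity of simple roots is trivial. -/
lemma eq_one_of_forall_affineSimple (hθ : IsHighestRoot b θ) {g : Equiv.Perm (ι × ℤ)}
    (hg : g ∈ affineWeylPerm b θ) (h : ∀ β ∈ affineSimple b θ, AffinePos b (g β)) : g = 1 := by
  obtain ⟨l, hl, hlg⟩ := exists_word hg
  generalize hn : l.length = n
  induction n using Nat.strong_induction_on generalizing l with | _ n ih
  rcases l.eq_nil_or_concat' with rfl | ⟨t, σ, rfl⟩
  · simpa using hlg.symm
  have hσ : σ ∈ affineSimple b θ := hl σ (by simp)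
  have h1 := h σ hσ
  rw [← hlg] at h1
  have ht : P.IsAffineAut (t.map P.affinePerm).prod := by
    clear * -
    induction t with
    | nil => exact .one
    | cons a t ih => simpa using (IsAffineAut.affinePerm a).mul ih
  -- The last letter σ satisfies gσ = -tσ > 0, so t makes σ negative and the deletion condition
  -- shortens the word.
  rw [List.map_append, List.prod_append, List.map_singleton, List.prod_singleton,
    Equiv.Perm.mul_apply, affinePerm_self, ht.apply_neg, affinePos_neg] at h1
  obtain ⟨l', h2, h3, h4⟩ := exists_deletion hθ t (fun β hβ ↦ hl β (by simp [hβ]))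
    (affinePos_of_mem_affineSimple θ hσ) h1
  refine ih l'.length ?_ l' h2 (by rw [← h4, ← hlg]; simp) rfl
  simp at hn
  omega

end AffineWeyl

end RootPairing

/-! ### The shortest Weyl group element taking θ to a long root -/

namespace RootPairing

variable {ι R M N : Type*} [Field R] [CharZero R] [AddCommGroup M] [Module R M]
  [AddCommGroup N] [Module R N] {P : RootPairing ι R M N} [P.IsCrystallographic]

/-- Additivity is only assumed for sums that are roots; expansion in simple roots extends it to the
integer combination that defines a reflection. -/
lemma IsAdd.reflectionPerm [Finite ι] {ψ : ι → ℤ} (h : P.IsAdd ψ) (b : P.Base) (γ η : ι) :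
    ψ (P.reflectionPerm η γ) = ψ γ - P.pairingIn ℤ γ η * ψ η := by
  have h1 : ∀ σ ∈ b.support, b.coeff σ (P.reflectionPerm η γ) =
      b.coeff σ γ - P.pairingIn ℤ γ η * b.coeff σ η := fun σ hσ ↦ by
    refine Base.coeff_eq (f := fun σ ↦ b.coeff σ γ - P.pairingIn ℤ γ η * b.coeff σ η) ?_ hσ
    simp_rw [sub_smul, mul_smul, Finset.sum_sub_distrib, ← Finset.smul_sum, ← b.coeff_spec]
    exact root_reflectionPerm_eq γ η
  rw [h.eq_sum b, h.eq_sum b γ, h.eq_sum b η, Finset.mul_sum, ← Finset.sum_sub_distrib]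
  refine Finset.sum_congr rfl fun σ hσ ↦ ?_
  rw [h1 σ hσ]
  ring

/-- A permutation of the roots which preserves pairings and sums. -/
structure IsRootAut (P : RootPairing ι R M N) [P.IsCrystallographic] (e : Equiv.Perm ι) :
    Prop where
  pairingIn : ∀ γ η, P.pairingIn ℤ (e γ) (e η) = P.pairingIn ℤ γ η
  add : ∀ i j k, P.root k = P.root i + P.root j → P.root (e k) = P.root (e i) + P.root (e j)
  apply_opp : ∀ γ, e (P.opp γ) = P.opp (e γ)

namespace IsRootAut

lemma of_isAffineAut {e : Equiv.Perm ι} {v : Equiv.Perm (ι × ℤ)} (hv : P.IsAffineAut v)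
    (h : ∀ γ k, v (γ, k) = (e γ, k)) : P.IsRootAut e where
  pairingIn γ η := by simpa [h] using hv.pairingIn (γ, 0) (η, 0)
  add i j k hk := by
    simpa [h] using (hv.apply_add (x := (k, 0)) (y := (i, 0)) (z := (j, 0)) hk (by simp)).1
  apply_opp γ := by
    have := hv.apply_neg (γ, 0)
    simp only [affineNeg, h] at this
    exact congrArg Prod.fst this

variable {e : Equiv.Perm ι} (he : P.IsRootAut e)
include he

lemma isAdd_comp {φ : ι → ℤ} (hφ : P.IsAdd φ) : P.IsAdd fun γ ↦ φ (e γ) where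
  add i j k h := hφ.add _ _ _ (he.add i j k h)
  opp i := by rw [he.apply_opp, hφ.opp]

lemma sub {i j k : ι} (h : P.root k = P.root i - P.root j) :
    P.root (e k) = P.root (e i) - P.root (e j) := by
  rw [he.add k j i (by rw [h]; abel)]
  abel

end IsRootAut

/-- `e` is the permutation of the roots given by the shortest element of the Weyl group which maps
the highest root `θ` to `α`, and `v` is its action on the affine roots. -/
structure IsShortestTo (b : P.Base) (θ α : ι) (v : Equiv.Perm (ι × ℤ)) (e : Equiv.Perm ι) :
    Prop where
  mem : v ∈ affineWeylPerm b θ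
  apply : ∀ γ k, v (γ, k) = (e γ, k)
  apply_highest : e θ = α
  isPos : ∀ γ, b.IsPos γ → P.pairingIn ℤ γ θ = 0 → b.IsPos (e γ)

namespace IsShortestTo

variable {b : P.Base} {θ α : ι} {v : Equiv.Perm (ι × ℤ)} {e : Equiv.Perm ι}

lemma isRootAut (h : IsShortestTo b θ α v e) : P.IsRootAut e :=
  .of_isAffineAut (isAffineAut_of_mem_closure h.mem) h.apply

lemma inv_apply (h : IsShortestTo b θ α v e) (γ : ι) (k : ℤ) : v⁻¹ (γ, k) = (e.symm γ, k) := by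
  rw [Equiv.Perm.inv_eq_iff_eq, h.apply]
  simp

lemma isRootAut_symm (h : IsShortestTo b θ α v e) : P.IsRootAut e.symm :=
  .of_isAffineAut (isAffineAut_of_mem_closure h.mem).inv h.inv_apply

lemma pairingIn (h : IsShortestTo b θ α v e) (γ : ι) :
    P.pairingIn ℤ (e γ) α = P.pairingIn ℤ γ θ := by
  rw [← h.apply_highest, h.isRootAut.pairingIn]

lemma pairingIn_symm (h : IsShortestTo b θ α v e) (γ : ι) :
    P.pairingIn ℤ (e.symm γ) θ = P.pairingIn ℤ γ α := by
  rw [← h.pairingIn, Equiv.apply_symm_apply]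

lemma isPos_symm (h : IsShortestTo b θ α v e) {γ : ι} (hγ : b.IsPos γ)
    (h0 : P.pairingIn ℤ γ α = 0) : b.IsPos (e.symm γ) := by
  by_contra h1
  have h2 := h.isPos _ (b.isPos_opp.mpr h1) (by rw [pairingIn_opp_left, h.pairingIn_symm, h0]; rfl)
  rw [h.isRootAut.apply_opp, Equiv.apply_symm_apply, Base.isPos_opp] at h2
  exact h2 hγ

/-- Induction on the height missing to θ. If μ is not dominant, reflecting in a simple σ with ⟨σ, μ⟩
< 0 raises it, and the element found for the raised root is followed by that reflection. Positivity
on θ^⊥ survives because the image of θ^⊥ does not contain σ. -/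
lemma exists_of_isMaxLength [Finite ι] [P.IsReduced] (hθ : IsHighestRoot b θ) {μ : ι}
    (hμ : P.IsMaxLength μ) (hpos : b.IsPos μ) : ∃ v e, IsShortestTo b θ μ v e := by
  generalize hn : (b.height θ - b.height μ).toNat = n
  induction n using Nat.strong_induction_on generalizing μ with | _ n ih
  by_cases hdom : ∀ σ ∈ b.support, 0 ≤ P.pairingIn ℤ σ μ
  · exact ⟨1, 1, one_mem _, fun _ _ ↦ rfl, hμ.eq_of_dominant hθ hdom, fun γ h _ ↦ h⟩
  push Not at hdom
  obtain ⟨σ, hσ, hneg⟩ := hdom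
  have hσμ : μ ≠ σ := by
    rintro rfl
    simp at hneg
  have hneg' : P.pairingIn ℤ μ σ < 0 := by
    have := P.zero_lt_pairingIn_iff' (S := ℤ) (i := P.opp σ) (j := μ)
    simp only [pairingIn_opp_left, pairingIn_opp_right] at this
    omega
  set μ' := P.reflectionPerm σ μ with hμ'
  have hpos' : b.IsPos μ' := hpos.reflectionPerm hσ hσμ
  have hht : b.height μ' = b.height μ - P.pairingIn ℤ μ σ := by
    rw [hμ', b.isAdd_height.reflectionPerm b, Base.height_one_of_mem_support hσ, mul_one]
  have hmax : P.IsMaxLength μ' := by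
    intro γ
    rw [hμ', P.pairingIn_reflectionPerm]
    rcases hμ (P.reflectionPerm σ γ) with h | h
    · left; rw [← h]; simp
    · exact Or.inr h
  have := hθ.height_le μ'
  obtain ⟨v, e, h⟩ := ih _ (by omega) hmax hpos' rfl
  have hr : ∀ γ k, P.affinePerm (σ, 0) (γ, k) = (P.reflectionPerm σ γ, k) := by simp
  refine ⟨P.affinePerm (σ, 0) * v, P.reflectionPerm σ * e, mul_mem
    (affinePerm_mem_affineWeylPerm (Or.inl ⟨hσ, rfl⟩)) h.mem, fun γ k ↦ ?_, ?_, fun γ hγ h0 ↦ ?_⟩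
  · rw [Equiv.Perm.mul_apply, h.apply, hr]; rfl
  · rw [Equiv.Perm.mul_apply, h.apply_highest, hμ']; simp
  · refine (h.isPos γ hγ h0).reflectionPerm hσ ?_
    intro h1
    have h2 := h.pairingIn γ
    rw [h1, h0, hμ', P.pairingIn_reflectionPerm, pairingIn_reflectionPerm_self_left] at h2
    omega

end IsShortestTo

end RootPairing

namespace RootPairing

variable {ι R M N : Type*} [Field R] [CharZero R] [AddCommGroup M] [Module R M]
  [AddCommGroup N] [Module R N] {P : RootPairing ι R M N} [P.IsCrystallographic]

/-! ### Minuscule elements with rootlet α -/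

section Minuscule

/-- The set of roots `γ > 0` such that `g` makes `δ - γ` negative. -/
def minusculeSet (b : P.Base) (g : Equiv.Perm (ι × ℤ)) : Set ι :=
  {γ | b.IsPos γ ∧ ¬ AffinePos b (g (P.opp γ, 1))}

/-- `g` is a minuscule element of the affine Weyl group with rootlet `α`. -/
structure HasRootlet (b : P.Base) (θ α : ι) (g : Equiv.Perm (ι × ℤ)) : Prop where
  mem : g ∈ affineWeylPerm b θ
  minuscule : ∀ x, AffinePos b x → ¬ AffinePos b (g x) → ∃ γ, b.IsPos γ ∧ x = (P.opp γ, 1)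
  rootlet : g (P.opp θ, 2) = (α, 0)

/-- The set of roots of the least abelian ideal with rootlet `α`. -/
def leastSet (b : P.Base) (θ : ι) (e : Equiv.Perm ι) : Set ι :=
  {γ | γ = θ ∨ b.IsPos γ ∧ P.pairingIn ℤ γ θ = 1 ∧ b.IsPos (e (P.reflectionPerm θ γ))}

/-- The positive roots orthogonal to `α` whose coefficients at the simple roots not orthogonal
to `α` agree with those of the highest root; there are none unless `α` is orthogonal to `θ`. -/
def extremalSet (b : P.Base) (θ α : ι) : Set ι :=
  {η | b.IsPos η ∧ P.pairingIn ℤ η α = 0 ∧ P.pairingIn ℤ θ α = 0 ∧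
    ∀ σ ∈ b.support, P.pairingIn ℤ σ α ≠ 0 → b.coeff σ η = b.coeff σ θ}

/-- The set of roots of the greatest abelian ideal with rootlet `α`. -/
def greatestSet (b : P.Base) (θ α : ι) (e : Equiv.Perm ι) : Set ι :=
  leastSet b θ e ∪ {γ | b.IsPos γ ∧ P.pairingIn ℤ γ θ = 0 ∧ e γ ∈ extremalSet b θ α}

/-- The affine simple roots orthogonal to `α`. -/
def orthogonalSimple (b : P.Base) (θ α : ι) : Set (ι × ℤ) :=
  {β | β ∈ affineSimple b θ ∧ P.pairingIn ℤ β.1 α = 0}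

/-- The affine roots in the span of the affine simple roots orthogonal to `α`. -/
def orthogonalSpan (b : P.Base) (θ α : ι) : Set (ι × ℤ) :=
  {x | (∀ σ ∈ b.support, P.pairingIn ℤ σ α ≠ 0 → b.coeff σ x.1 + x.2 * b.coeff σ θ = 0) ∧
    (P.pairingIn ℤ θ α ≠ 0 → x.2 = 0)}

variable {b : P.Base} {θ α : ι} {g : Equiv.Perm (ι × ℤ)}

lemma HasRootlet.isAffineAut (hg : HasRootlet b θ α g) : P.IsAffineAut g :=
  isAffineAut_of_mem_closure hg.mem

lemma orthogonalSimple_subset_orthogonalSpan :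
    orthogonalSimple b θ α ⊆ orthogonalSpan b θ α := by
  rintro β ⟨hβ, h0⟩
  rcases hβ with ⟨h1, h2⟩ | rfl
  · refine ⟨fun τ _ hτ ↦ ?_, fun _ ↦ h2⟩
    rw [h2, zero_mul, add_zero]
    refine b.coeff_ne h1 ?_
    rintro rfl
    exact hτ h0
  · refine ⟨fun τ _ _ ↦ by simp, fun h ↦ ?_⟩
    simp only [pairingIn_opp_left, neg_eq_zero] at h0
    exact absurd h0 h

lemma affineNeg_mem_orthogonalSpan {x : ι × ℤ} (hx : x ∈ orthogonalSpan b θ α) :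
    P.affineNeg x ∈ orthogonalSpan b θ α := by
  refine ⟨fun σ hσ h ↦ ?_, fun h ↦ ?_⟩
  · have := hx.1 σ hσ h
    simp only [affineNeg_fst, affineNeg_snd, Base.coeff_opp]
    linarith
  · simp [hx.2 h]

variable [Finite ι]

lemma affinePerm_mem_orthogonalSpan {x β : ι × ℤ} (hx : x ∈ orthogonalSpan b θ α)
    (hβ : β ∈ orthogonalSpan b θ α) : P.affinePerm β x ∈ orthogonalSpan b θ α := by
  refine ⟨fun σ hσ h ↦ ?_, fun h ↦ ?_⟩
  · simp only [affinePerm_apply, (b.isAdd_coeff σ).reflectionPerm b]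
    linear_combination hx.1 σ hσ h - P.pairingIn ℤ x.1 β.1 * hβ.1 σ hσ h
  · simp [hx.2 h, hβ.2 h]

lemma apply_mem_orthogonalSpan {u : Equiv.Perm (ι × ℤ)}
    (hu : u ∈ Subgroup.closure (P.affinePerm '' orthogonalSimple b θ α)) {x : ι × ℤ}
    (hx : x ∈ orthogonalSpan b θ α) : u x ∈ orthogonalSpan b θ α := by
  induction hu using Subgroup.closure_induction_left generalizing x with
  | one => exact hx
  | mul_left y hy z _ ih =>
    obtain ⟨β, hβ, rfl⟩ := hy
    exact affinePerm_mem_orthogonalSpan (ih hx) (orthogonalSimple_subset_orthogonalSpan hβ)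
  | inv_mul_cancel y hy z _ ih =>
    obtain ⟨β, hβ, rfl⟩ := hy
    rw [affinePerm_inv]
    exact affinePerm_mem_orthogonalSpan (ih hx) (orthogonalSimple_subset_orthogonalSpan hβ)

lemma affinePerm_apply_of_pairingIn_eq_zero {β x : ι × ℤ} (h : P.pairingIn ℤ x.1 β.1 = 0) :
    P.affinePerm β x = x := by
  have h1 : P.reflectionPerm β.1 x.1 = x.1 :=
    P.reflectionPerm_eq_of_pairing_eq_zero (by rw [← P.algebraMap_pairingIn ℤ, h, map_zero])
  ext <;> simp [h1, h]

lemma apply_eq_self_of_mem_closure {u : Equiv.Perm (ι × ℤ)}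
    (hu : u ∈ Subgroup.closure (P.affinePerm '' orthogonalSimple b θ α)) : u (α, 0) = (α, 0) := by
  have key : ∀ β ∈ orthogonalSimple b θ α, P.affinePerm β (α, 0) = (α, 0) := fun β hβ ↦
    affinePerm_apply_of_pairingIn_eq_zero (P.pairingIn_eq_zero_iff.mp hβ.2)
  induction hu using Subgroup.closure_induction with
  | mem x hx => obtain ⟨β, hβ, rfl⟩ := hx; exact key β hβ
  | one => rfl
  | mul x y _ _ hx hy => rw [Equiv.Perm.mul_apply, hy, hx]
  | inv x _ hx => rw [Equiv.Perm.inv_eq_iff_eq, hx]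

/-- If a function which is linear on the affine roots is negative at a positive affine root, it is
negative at some simple affine root which occurs in this root. -/
lemma exists_affineSimple_neg (hθ : IsHighestRoot b θ) {h : Equiv.Perm (ι × ℤ)}
    (hh : P.IsAffineAut h) {φ : ι → ℤ} (hφ : P.IsAdd φ) (c : ℤ) {x : ι × ℤ}
    (hx : AffinePos b x) (hneg : φ (h x).1 + c * (h x).2 < 0) (T : Set (ι × ℤ))
    (hT : ∀ σ ∈ b.support, b.coeff σ x.1 + x.2 * b.coeff σ θ ≠ 0 → (σ, 0) ∈ T)
    (hT' : x.2 ≠ 0 → (P.opp θ, 1) ∈ T) :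
    ∃ β ∈ affineSimple b θ, β ∈ T ∧ φ (h β).1 + c * (h β).2 < 0 := by
  by_contra! hcon
  -- Pulled back along h, the function "φ plus c times the level" is linear with value c at δ. If it
  -- were nonnegative at all affine simple roots occurring in x, it would be so at x.
  have hψ : P.IsAdd fun η ↦ φ (h (η, 0)).1 + c * (h (η, 0)).2 :=
    (hh.isAdd_comp hφ).add_fun
      ⟨fun i j k hk ↦ by rw [hh.isAdd_level.add i j k hk]; ring,
        fun i ↦ by rw [hh.isAdd_level.opp]; ring⟩
  have h1 : ∀ η k, φ (h (η, k)).1 + c * (h (η, k)).2 =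
      (φ (h (η, 0)).1 + c * (h (η, 0)).2) + k * c := fun η k ↦ by
    rw [hh.shift η k]; ring
  have h2 := hx.nonneg_of_isAdd hθ hψ (c := c)
    (fun σ hσ h0 ↦ hcon (σ, 0) (Or.inl ⟨hσ, rfl⟩) (hT σ hσ h0)) fun h0 ↦ by
      have h3 := hcon _ (Or.inr rfl) (hT' h0)
      have h4 := hψ.opp θ
      rw [h1] at h3
      linarith
  have h5 := h1 x.1 x.2
  simp only [Prod.mk.eta] at h5
  linarith

lemma affinePos_affinePerm_iff [P.IsReduced] (hθ : IsHighestRoot b θ) {x β : ι × ℤ}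
    (hβ : β ∈ affineSimple b θ) (h1 : x ≠ β) (h2 : x ≠ P.affineNeg β) :
    AffinePos b (P.affinePerm β x) ↔ AffinePos b x := by
  refine ⟨fun h ↦ ?_, fun h ↦ h.affinePerm hθ hβ h1⟩
  by_contra h3
  rw [← affinePos_neg] at h3
  have h4 := h3.affinePerm hθ hβ (fun h ↦ h2 (by rw [← h, affineNeg_affineNeg]))
  rw [(IsAffineAut.affinePerm β).apply_neg, affinePos_neg] at h4
  exact h4 h

variable [P.IsReduced]

/-- The highest root belongs to the set of roots of every minuscule element with a rootlet. -/
lemma HasRootlet.highest_mem (hθ : IsHighestRoot b θ) (hg : HasRootlet b θ α g) :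
    θ ∈ minusculeSet b g := by
  refine ⟨hθ.isPos, fun h ↦ ?_⟩
  -- Inversions have level 1, so no finite simple root is inverted. If δ - θ is not inverted either,
  -- then g = 1, which cannot move 2δ - θ to level 0.
  have h1 : g = 1 := by
    refine eq_one_of_forall_affineSimple hθ hg.mem fun β hβ ↦ ?_
    rcases hβ with hβ | rfl
    · by_contra h2
      obtain ⟨γ, -, hγ⟩ := hg.minuscule β (affinePos_of_mem_affineSimple θ (Or.inl hβ)) h2
      have := hβ.2
      rw [hγ] at this
      exact one_ne_zero this
    · exact h
  have h2 := hg.rootlet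
  rw [h1] at h2
  exact two_ne_zero (congrArg Prod.snd h2)

/-- Multiplying a minuscule element by a simple reflection which adds or removes a root orthogonal
to `θ`. -/
lemma HasRootlet.affinePerm_mul (hθ : IsHighestRoot b θ) (hg : HasRootlet b θ α g)
    {β : ι × ℤ} (hβ : β ∈ affineSimple b θ) {c : ι} (hc : b.IsPos c)
    (hcθ : P.pairingIn ℤ c θ = 0)
    (h : g (P.opp c, 1) = β ∨ g (P.opp c, 1) = P.affineNeg β) :
    P.pairingIn ℤ β.1 α = 0 ∧ HasRootlet b θ α (P.affinePerm β * g) ∧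
      (∀ γ ≠ c, γ ∈ minusculeSet b (P.affinePerm β * g) ↔ γ ∈ minusculeSet b g) ∧
      (c ∈ minusculeSet b (P.affinePerm β * g) ↔ c ∉ minusculeSet b g) := by
  have hA := hg.isAffineAut
  -- Up to sign β is the image of δ - c, and α is the image of 2δ - θ; orthogonality of c and θ is
  -- transported by g.
  have hβα : P.pairingIn ℤ β.1 α = 0 := by
    have h1 := hA.pairingIn (P.opp c, 1) (P.opp θ, 2)
    rw [hg.rootlet] at h1
    rcases h with h | h <;> rw [h] at h1 <;> simpa [hcθ] using h1
  have hx : ∀ x, x ≠ (P.opp c, 1) → x ≠ P.affineNeg (P.opp c, 1) →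
      (AffinePos b (P.affinePerm β (g x)) ↔ AffinePos b (g x)) := by
    intro x h1 h2
    refine affinePos_affinePerm_iff hθ hβ (fun h3 ↦ ?_) fun h3 ↦ ?_
    · rcases h with h | h
      · exact h1 (g.injective (h3.trans h.symm))
      · refine h2 (g.injective ?_)
        rw [h3, hA.apply_neg, h, affineNeg_affineNeg]
    · rcases h with h | h
      · refine h2 (g.injective ?_)
        rw [h3, hA.apply_neg, h]
      · exact h1 (g.injective (h3.trans h.symm))
  refine ⟨hβα, ⟨mul_mem (affinePerm_mem_affineWeylPerm hβ) hg.mem, fun x hxp hxn ↦ ?_, ?_⟩,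
    fun γ hγ ↦ ?_, ?_⟩
  · by_cases h1 : x = (P.opp c, 1)
    · exact ⟨c, hc, h1⟩
    · refine hg.minuscule x hxp fun h2 ↦ hxn ?_
      rw [Equiv.Perm.mul_apply, hx x h1]
      · exact h2
      · rintro rfl
        rcases hxp with hxp | hxp <;> simp at hxp
  · rw [Equiv.Perm.mul_apply, hg.rootlet]
    exact affinePerm_apply_of_pairingIn_eq_zero (P.pairingIn_eq_zero_iff.mp hβα)
  · simp only [minusculeSet, Set.mem_ofPred_eq, Equiv.Perm.mul_apply]
    rw [hx]
    · intro h1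
      exact hγ (opp_injective (congrArg Prod.fst h1))
    · intro h1
      have := congrArg Prod.snd h1
      simp at this
  · simp only [minusculeSet, Set.mem_ofPred_eq, Equiv.Perm.mul_apply, hc, true_and, not_not]
    have hβp := affinePos_of_mem_affineSimple θ hβ
    rcases h with h | h
    · rw [h, affinePerm_self, affinePos_neg, not_not]
    · rw [h, (IsAffineAut.affinePerm β).apply_neg, affinePerm_self, affineNeg_affineNeg,
        affinePos_neg]

end Minuscule

/-! ### The least minuscule element -/

section Least

variable [Finite ι] [P.IsReduced] {b : P.Base} {θ α : ι} {v g : Equiv.Perm (ι × ℤ)}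
  {e : Equiv.Perm ι}

lemma IsShortestTo.mul_affinePerm_apply (h : IsShortestTo b θ α v e) (γ : ι) (k : ℤ) :
    (v * P.affinePerm (P.opp θ, 1)) (γ, k) =
      (e (P.reflectionPerm θ γ), k + P.pairingIn ℤ γ θ) := by
  rw [Equiv.Perm.mul_apply, affinePerm_apply, h.apply]
  simp [reflectionPerm_opp]

lemma reflectionPerm_eq_self {γ : ι} (h : P.pairingIn ℤ γ θ = 0) :
    P.reflectionPerm θ γ = γ :=
  P.reflectionPerm_eq_of_pairing_eq_zero (by rw [← P.algebraMap_pairingIn ℤ, h, map_zero])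

lemma reflectionPerm_apply_opp (γ : ι) :
    P.reflectionPerm θ (P.opp γ) = P.opp (P.reflectionPerm θ γ) := by
  apply P.root.injective
  simp

/-- s₀ changes the level of γ + kδ by ⟨γ, θ⟩, which is at least -1 unless γ = -θ, while v keeps
levels and keeps positivity on θ^⊥. So a positive root can only be inverted at level 1, and then -γ
is θ or pairs to 1 with it. -/
lemma IsShortestTo.hasRootlet (hθ : IsHighestRoot b θ) (hα : b.IsPos α)
    (h : IsShortestTo b θ α v e) : HasRootlet b θ α (v * P.affinePerm (P.opp θ, 1)) where
  mem := mul_mem h.mem (affinePerm_mem_affineWeylPerm (Or.inr rfl))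
  minuscule := by
    rintro ⟨γ, k⟩ hp hn
    rw [h.mul_affinePerm_apply] at hn
    simp only [AffinePos, not_or, not_and] at hp hn
    rcases hp with ⟨rfl, hp⟩ | hp
    · exfalso
      have h1 := hθ.pairingIn_nonneg hp
      have h2 : P.pairingIn ℤ γ θ = 0 := by omega
      exact hn.1 (by omega) (by rw [reflectionPerm_eq_self h2]; exact h.isPos γ hp h2)
    · rcases hθ.isMaxLength.neg_one_le γ with rfl | h1
      · refine ⟨θ, hθ.isPos, ?_⟩
        rw [reflectionPerm_apply_opp] at hn
        simp only [pairingIn_opp_left, pairingIn_same] at hn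
        have h2 : e (P.opp (P.reflectionPerm θ θ)) = α := by
          rw [← h.apply_highest]; congr 1; exact opp_opp θ
        rw [h2] at hn
        have : k ≠ 2 := fun hk ↦ hn.1 (by omega) hα
        have : k = 1 := by omega
        rw [this]
      · have hk : k = 1 := by omega
        have h2 : P.pairingIn ℤ γ θ = -1 := by omega
        refine ⟨P.opp γ, ?_, by simp [hk]⟩
        refine hθ.isPos_of_pairingIn_pos ?_
        rw [pairingIn_opp_left]; omega
  rootlet := by
    rw [h.mul_affinePerm_apply]
    ext
    · simp only [← h.apply_highest]
      congr 1
      exact P.reflectionPerm_self θ θ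
    · simp

lemma IsShortestTo.minusculeSet_eq (hθ : IsHighestRoot b θ) (h : IsShortestTo b θ α v e) :
    minusculeSet b (v * P.affinePerm (P.opp θ, 1)) = leastSet b θ e := by
  ext γ
  simp only [minusculeSet, leastSet, Set.mem_ofPred_eq, h.mul_affinePerm_apply, AffinePos,
    pairingIn_opp_left, reflectionPerm_apply_opp, h.isRootAut.apply_opp, Base.isPos_opp]
  rcases eq_or_ne γ θ with rfl | hne
  · simp [hθ.isPos]
  · by_cases hγ : b.IsPos γ
    · have h1 := hθ.pairingIn_nonneg hγ
      have h2 := (hθ.isMaxLength γ).resolve_left hne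
      by_cases h3 : b.IsPos (e (P.reflectionPerm θ γ)) <;> simp [h3, hne, hγ] <;> omega
    · simp [hγ, hne]

/-- An element of the affine Weyl group whose inversions lie in the finite root system
preserves this root system. -/
lemma level_eq_of_inversions (hθ : IsHighestRoot b θ) (hg : g ∈ affineWeylPerm b θ)
    (h : ∀ x, AffinePos b x → ¬ AffinePos b (g x) → x.2 = 0) (γ : ι) :
    (g (γ, 0)).2 = 0 := by
  generalize hn : {x : ι | b.IsPos x ∧ ¬ AffinePos b (g (x, 0))}.ncard = n
  induction n using Nat.strong_induction_on generalizing g γ with | _ n ih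
  by_cases hs : ∀ β ∈ affineSimple b θ, AffinePos b (g β)
  · rw [eq_one_of_forall_affineSimple hθ hg hs]; rfl
  push Not at hs
  obtain ⟨β, hβ, hneg⟩ := hs
  have hβp := affinePos_of_mem_affineSimple θ hβ
  obtain ⟨σ, l⟩ := β
  obtain rfl : l = 0 := h _ hβp hneg
  have hσ : σ ∈ b.support := by
    rcases hβ with hβ | hβ
    · exact hβ.1
    · exact absurd (congrArg Prod.snd hβ) (by simp)
  have hσp := Base.isPos_of_mem_support (b := b) hσ
  have hA := isAffineAut_of_mem_closure hg
  have hr : ∀ γ k, P.affinePerm (σ, 0) (γ, k) = (P.reflectionPerm σ γ, k) := by simp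
  have hself : ¬ ¬ AffinePos b ((g * P.affinePerm (σ, 0)) (σ, 0)) := by
    rwa [not_not, Equiv.Perm.mul_apply, affinePerm_self, hA.apply_neg, affinePos_neg]
  -- Multiplying by the reflection in σ on the right removes the inversion σ and permutes the
  -- others, so the number of inversions drops.
  have key := ih _ ?_ (g := g * P.affinePerm (σ, 0))
    (mul_mem hg (affinePerm_mem_affineWeylPerm hβ)) ?_ (P.reflectionPerm σ γ) rfl
  · rw [Equiv.Perm.mul_apply, hr] at key
    simpa using key
  · rw [← hn]
    have h1 : P.reflectionPerm σ '' {x : ι | b.IsPos x ∧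
        ¬ AffinePos b ((g * P.affinePerm (σ, 0)) (x, 0))} ⊂
        {x : ι | b.IsPos x ∧ ¬ AffinePos b (g (x, 0))} := by
      refine ⟨?_, fun hsub ↦ ?_⟩
      · rintro _ ⟨x, ⟨hx, hx'⟩, rfl⟩
        refine ⟨hx.reflectionPerm hσ ?_, by rwa [Equiv.Perm.mul_apply, hr] at hx'⟩
        rintro rfl
        exact hself hx'
      · obtain ⟨x, ⟨hx, hx'⟩, hxσ⟩ := hsub ⟨hσp, hneg⟩
        have : x = P.opp σ := by
          rw [← P.reflectionPerm_self σ x, hxσ]; rfl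
        rw [this, Base.isPos_opp] at hx
        exact hx hσp
    calc _ = _ := (Set.ncard_image_of_injective _ (P.reflectionPerm σ).injective).symm
      _ < _ := Set.ncard_lt_ncard h1 (Set.toFinite _)
  · intro x hx hx'
    have hne : x ≠ (σ, 0) := by
      rintro rfl
      exact hself hx'
    have := h _ (hx.affinePerm hθ hβ hne) hx'
    simpa using this

/-- The least minuscule element with rootlet `α`. -/
lemma HasRootlet.eq_of_forall_mem (hθ : IsHighestRoot b θ) (h : IsShortestTo b θ α v e)
    (hg : HasRootlet b θ α g) (hI : ∀ γ ∈ minusculeSet b g, P.pairingIn ℤ γ θ ≠ 0) :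
    g = v * P.affinePerm (P.opp θ, 1) := by
  have hs : (P.opp θ, (1 : ℤ)) ∈ affineSimple b θ := Or.inr rfl
  set y := g * P.affinePerm (P.opp θ, 1) with hy
  have hymem : y ∈ affineWeylPerm b θ := mul_mem hg.mem (affinePerm_mem_affineWeylPerm hs)
  have hyA := isAffineAut_of_mem_closure hymem
  have hyapply : ∀ x, y x = g (P.affinePerm (P.opp θ, 1) x) := fun x ↦ rfl
  -- An inversion of g s₀ is s₀(δ - γ) with γ an element of the set other than θ. Then ⟨γ, θ⟩ = 1,
  -- so s₀ lowers the level from 1 to 0.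
  have hinv : ∀ x, AffinePos b x → ¬ AffinePos b (y x) → x.2 = 0 ∧ P.pairingIn ℤ x.1 θ ≠ 0 := by
    intro x hx hx'
    have hne : x ≠ (P.opp θ, 1) := by
      rintro rfl
      rw [hyapply, affinePerm_self, hg.isAffineAut.apply_neg, affinePos_neg, not_not] at hx'
      exact (hg.highest_mem hθ).2 hx'
    have h1 := hx.affinePerm hθ hs hne
    obtain ⟨γ, hγ, h2⟩ := hg.minuscule _ h1 hx'
    have hγI : γ ∈ minusculeSet b g := ⟨hγ, by rwa [← h2]⟩
    have h3 : x = P.affinePerm (P.opp θ, 1) (P.opp γ, 1) := by rw [← h2, affinePerm_affinePerm]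
    have h4 : γ ≠ θ := by
      rintro rfl
      rw [h3, affinePerm_self, affinePos_neg] at hx
      exact hx (Or.inr le_rfl)
    have h5 := hθ.pairingIn_nonneg hγ
    have h6 := (hθ.isMaxLength γ).resolve_left h4
    have h7 := hI γ hγI
    rw [h3]
    simp only [affinePerm_apply, reflectionPerm_opp, reflectionPerm_apply_opp, pairingIn_opp_left,
      pairingIn_opp_right, ← P.pairingIn_reflectionPerm, pairingIn_reflectionPerm_self_right]
    omega
  have hlev : ∀ γ, (y (γ, 0)).2 = 0 := level_eq_of_inversions hθ hymem fun x h1 h2 ↦ (hinv x h1 h2).1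
  have hyθ : y (θ, 0) = (α, 0) := by
    rw [hyapply, ← hg.rootlet]
    congr 1
    ext
    · simp only [affinePerm_apply, reflectionPerm_opp]; rfl
    · simp
  have hzmem : v⁻¹ * y ∈ affineWeylPerm b θ := mul_mem (inv_mem h.mem) hymem
  have hzA := isAffineAut_of_mem_closure hzmem
  have hz0 : ∀ γ, (v⁻¹ * y) (γ, 0) = (e.symm (y (γ, 0)).1, 0) := fun γ ↦ by
    rw [Equiv.Perm.mul_apply, ← Prod.mk.eta (p := y (γ, 0)), hlev, h.inv_apply]
  have hzθ : (v⁻¹ * y) (θ, 0) = (θ, 0) := by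
    rw [hz0, hyθ, ← h.apply_highest]; simp
  -- v⁻¹y fixes θ, so if it made a simple σ negative, ⟨σ, θ⟩ would be both ≥ 0 and ≤ 0. Then v
  -- preserves the sign, and σ would be an inversion of y orthogonal to θ, which `hinv` excludes.
  have hz : v⁻¹ * y = 1 := by
    refine eq_one_of_forall_affineSimple hθ hzmem fun β hβ ↦ ?_
    rcases hβ with hβ | rfl
    · obtain ⟨σ, l⟩ := β
      obtain ⟨hσ, rfl⟩ := hβ
      replace hσ : σ ∈ b.support := hσ
      have hσp := Base.isPos_of_mem_support (b := b) hσ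
      by_contra hcon
      have h1 : P.pairingIn ℤ ((v⁻¹ * y) (σ, 0)).1 θ = P.pairingIn ℤ σ θ := by
        have := hzA.pairingIn (σ, 0) (θ, 0)
        rwa [hzθ] at this
      rw [hz0] at hcon h1
      dsimp only at h1
      have h2 : ¬ b.IsPos (e.symm (y (σ, 0)).1) := fun h3 ↦ hcon (Or.inl ⟨rfl, h3⟩)
      have h3 := hθ.pairingIn_nonpos h2
      have h4 := hθ.pairingIn_nonneg hσp
      have h5 := h.isPos _ (b.isPos_opp.mpr h2) (by rw [pairingIn_opp_left]; omega)
      rw [h.isRootAut.apply_opp, Equiv.apply_symm_apply, Base.isPos_opp] at h5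
      have h6 : ¬ AffinePos b (y (σ, 0)) := by
        simp only [AffinePos, hlev, h5, and_false, false_or]
        omega
      exact (hinv (σ, 0) (Or.inl ⟨rfl, hσp⟩) h6).2 (by dsimp only; omega)
    · right
      have h1 := hzA.apply_neg (θ, 0)
      rw [hzθ] at h1
      simp only [affineNeg, neg_zero] at h1
      rw [hzA.shift, h1]
      simp
  have h8 : y = v := by
    rw [inv_mul_eq_one] at hz
    exact hz.symm
  rw [← h8, hy, mul_assoc, affinePerm_mul_self, mul_one]

end Least

end RootPairing

namespace RootPairing

variable {ι R M N : Type*} [Field R] [CharZero R] [AddCommGroup M] [Module R M]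
  [AddCommGroup N] [Module R N] {P : RootPairing ι R M N} [P.IsCrystallographic]

/-! ### All minuscule elements with rootlet α, and the greatest one -/

section Interval

variable [Finite ι] [P.IsReduced] {b : P.Base} {θ α : ι} {v g : Equiv.Perm (ι × ℤ)}
  {e : Equiv.Perm ι}

lemma IsShortestTo.mul_affinePerm_apply_opp (h : IsShortestTo b θ α v e) {γ : ι}
    (hγ : P.pairingIn ℤ γ θ = 0) :
    (v * P.affinePerm (P.opp θ, 1)) (P.opp γ, 1) = (P.opp (e γ), 1) := by
  rw [h.mul_affinePerm_apply, reflectionPerm_apply_opp, reflectionPerm_eq_self hγ,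
    h.isRootAut.apply_opp, pairingIn_opp_left, hγ]
  rfl

/-- If a minuscule element has an inversion orthogonal to `θ`, then it has one that can be removed
by a simple reflection. -/
lemma HasRootlet.exists_removable (hθ : IsHighestRoot b θ) (hg : HasRootlet b θ α g) {γ : ι}
    (hγ : γ ∈ minusculeSet b g) (h0 : P.pairingIn ℤ γ θ = 0) :
    ∃ β ∈ affineSimple b θ, ∃ c ∈ minusculeSet b g, P.pairingIn ℤ c θ = 0 ∧
      g (P.opp c, 1) = P.affineNeg β := by
  have hA := hg.isAffineAut
  -- The linear function "pairing with θ plus level" is -1 at γ - δ, and among positive affine roots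
  -- it is negative only at δ - θ. So g⁻¹β is a negative root for some affine simple β; being the
  -- negative of an inversion it is c - δ, and ⟨c, θ⟩ < 1.
  obtain ⟨β, hβ, -, hneg⟩ := exists_affineSimple_neg hθ hA.inv (IsAdd.pairingIn θ) 1
    (x := P.affineNeg (g (P.opp γ, 1))) (affinePos_neg.mpr hγ.2)
    (by rw [hA.inv.apply_neg, perm_inv_apply]; simp [affineNeg, h0]) Set.univ
    (fun _ _ _ ↦ trivial) (fun _ ↦ trivial)
  have hβp := affinePos_of_mem_affineSimple θ hβ
  obtain ⟨⟨c, k⟩, hck⟩ : ∃ y, g⁻¹ β = y := ⟨_, rfl⟩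
  have hgc : g (c, k) = β := by rw [← hck, perm_apply_inv]
  rw [hck] at hneg
  dsimp only at hneg
  have h1 : ¬ AffinePos b (c, k) := by
    rintro (⟨hk, hc⟩ | hk)
    · have := hθ.pairingIn_nonneg hc
      dsimp only at hk this
      omega
    · dsimp only at hk
      rcases hθ.isMaxLength.neg_one_le c with rfl | h2
      · rw [pairingIn_opp_left, pairingIn_same] at hneg
        obtain rfl : k = 1 := by omega
        exact (hg.highest_mem hθ).2 (by rwa [hgc])
      · omega
  have h2 : g (P.affineNeg (c, k)) = P.affineNeg β := by rw [hA.apply_neg, hgc]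
  have h3 : ¬ AffinePos b (g (P.affineNeg (c, k))) := by rwa [h2, affinePos_neg, not_not]
  obtain ⟨c', hc', h4⟩ := hg.minuscule _ (affinePos_neg.mpr h1) h3
  have h5 := congrArg Prod.fst h4
  have h6 := congrArg Prod.snd h4
  simp only [affineNeg_fst, affineNeg_snd] at h5 h6
  obtain rfl := opp_injective h5
  rw [h4] at h2 h3
  refine ⟨β, hβ, c, ⟨hc', h3⟩, ?_, h2⟩
  have := hθ.pairingIn_nonneg hc'
  omega

/-- Every minuscule element with rootlet `α` is obtained from the least one by an element of the
parabolic subgroup generated by the affine simple roots orthogonal to `α`. -/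
lemma HasRootlet.exists_eq_mul (hθ : IsHighestRoot b θ) (h : IsShortestTo b θ α v e)
    (hg : HasRootlet b θ α g) :
    ∃ u ∈ Subgroup.closure (P.affinePerm '' orthogonalSimple b θ α),
      g = u * (v * P.affinePerm (P.opp θ, 1)) ∧
      (∀ γ ∈ minusculeSet b g, P.pairingIn ℤ γ θ = 0 →
        (P.opp (e γ), (1 : ℤ)) ∈ orthogonalSpan b θ α) ∧
      ∀ γ, P.pairingIn ℤ γ θ ≠ 0 → (γ ∈ minusculeSet b g ↔ γ ∈ leastSet b θ e) := by
  generalize hn : {γ | γ ∈ minusculeSet b g ∧ P.pairingIn ℤ γ θ = 0}.ncard = n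
  induction n using Nat.strong_induction_on generalizing g with | _ n ih
  by_cases hI : ∀ γ ∈ minusculeSet b g, P.pairingIn ℤ γ θ ≠ 0
  · have h1 := hg.eq_of_forall_mem hθ h hI
    refine ⟨1, one_mem _, by rw [one_mul, h1], fun γ hγ h0 ↦ absurd h0 (hI γ hγ), fun γ _ ↦ ?_⟩
    rw [h1, h.minusculeSet_eq hθ]
  push Not at hI
  obtain ⟨γ, hγ, h0⟩ := hI
  obtain ⟨β, hβ, c, hc, hc0, hgc⟩ := hg.exists_removable hθ hγ h0
  obtain ⟨hβα, hg', hne, hself⟩ := hg.affinePerm_mul hθ hβ hc.1 hc0 (Or.inr hgc)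
  have hβT : β ∈ orthogonalSimple b θ α := ⟨hβ, hβα⟩
  have hcn : c ∉ minusculeSet b (P.affinePerm β * g) := fun h ↦ hself.mp h hc
  have hlt : {γ | γ ∈ minusculeSet b (P.affinePerm β * g) ∧ P.pairingIn ℤ γ θ = 0}.ncard < n := by
    rw [← hn]
    refine Set.ncard_lt_ncard ⟨fun η hη ↦ ?_, fun hsub ↦ ?_⟩ (Set.toFinite _)
    · exact ⟨(hne η (by rintro rfl; exact hcn hη.1)).mp hη.1, hη.2⟩
    · exact hcn (hsub ⟨hc, hc0⟩).1
  obtain ⟨u, hu, hgu, hsp, hiff⟩ := ih _ hlt hg' rfl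
  refine ⟨P.affinePerm β * u, mul_mem (Subgroup.subset_closure ⟨β, hβT, rfl⟩) hu, ?_, ?_, ?_⟩
  · rw [mul_assoc, ← hgu, ← mul_assoc, affinePerm_mul_self, one_mul]
  · intro η hη hη0
    rcases eq_or_ne η c with rfl | hηc
    · have h1 : (v * P.affinePerm (P.opp θ, 1)) (P.opp η, 1) =
          u⁻¹ ((P.affinePerm β * g) (P.opp η, 1)) := by
        rw [hgu, Equiv.Perm.mul_apply u, perm_inv_apply]
      rw [h.mul_affinePerm_apply_opp hη0] at h1
      rw [h1]
      refine apply_mem_orthogonalSpan (inv_mem hu) ?_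
      rw [Equiv.Perm.mul_apply, hgc]
      exact affinePerm_mem_orthogonalSpan
        (affineNeg_mem_orthogonalSpan (orthogonalSimple_subset_orthogonalSpan hβT))
        (orthogonalSimple_subset_orthogonalSpan hβT)
    · exact hsp η ((hne η hηc).mpr hη) hη0
  · intro η hη
    rw [← hiff η hη, hne η (by rintro rfl; exact hη hc0)]

lemma HasRootlet.leastSet_subset (hθ : IsHighestRoot b θ) (h : IsShortestTo b θ α v e)
    (hg : HasRootlet b θ α g) : leastSet b θ e ⊆ minusculeSet b g := by
  obtain ⟨u, -, -, -, hiff⟩ := hg.exists_eq_mul hθ h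
  intro γ hγ
  refine (hiff γ ?_).mpr hγ
  rcases hγ with rfl | hγ
  · simp
  · rw [hγ.2.1]; simp

/-- For γ ⟂ θ, `extremalSet` spells out that δ - vγ is in the span of the affine simple roots
orthogonal to α: its coefficient at δ - θ is 1, and at a simple σ it is the difference of the
coefficients of θ and vγ. -/
lemma HasRootlet.subset_greatestSet (hθ : IsHighestRoot b θ) (h : IsShortestTo b θ α v e)
    (hg : HasRootlet b θ α g) : minusculeSet b g ⊆ greatestSet b θ α e := by
  obtain ⟨u, -, -, hsp, hiff⟩ := hg.exists_eq_mul hθ h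
  intro γ hγ
  by_cases h0 : P.pairingIn ℤ γ θ = 0
  · right
    obtain ⟨h1, h2⟩ := hsp γ hγ h0
    refine ⟨hγ.1, h0, h.isPos γ hγ.1 h0, by rw [h.pairingIn, h0], by_contra fun h3 ↦ ?_,
      fun σ hσ h3 ↦ ?_⟩
    · exact one_ne_zero (h2 h3)
    · have := h1 σ hσ h3
      simp only [Base.coeff_opp] at this
      linarith
  · exact Or.inl ((hiff γ h0).mp hγ)

/-- A set that is not yet the greatest can be enlarged by one root through a simple reflection
orthogonal to α; the greatest set is then reached by maximality. -/
lemma HasRootlet.exists_ncard_lt (hθ : IsHighestRoot b θ) (hα : α ∈ b.support)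
    (h : IsShortestTo b θ α v e) (hg : HasRootlet b θ α g) {γ : ι}
    (hγ : γ ∈ greatestSet b θ α e) (hγg : γ ∉ minusculeSet b g) :
    ∃ g', HasRootlet b θ α g' ∧ (minusculeSet b g).ncard < (minusculeSet b g').ncard := by
  obtain ⟨u, hu, hgu, hsp, hiff⟩ := hg.exists_eq_mul hθ h
  have hA := hg.isAffineAut
  have huA : P.IsAffineAut u := isAffineAut_of_mem_closure hu
  rcases hγ with hγ | ⟨hγp, hγ0, hK⟩
  · exact absurd (hg.leastSet_subset hθ h hγ) hγg
  have hx0 : (P.opp (e γ), (1 : ℤ)) ∈ orthogonalSpan b θ α :=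
    ⟨fun σ hσ h1 ↦ by simp [hK.2.2.2 σ hσ h1], fun h1 ↦ absurd hK.2.2.1 h1⟩
  have hx : g (P.opp γ, 1) = u (P.opp (e γ), 1) := by
    rw [hgu, Equiv.Perm.mul_apply u, h.mul_affinePerm_apply_opp hγ0]
  have hxE : g (P.opp γ, 1) ∈ orthogonalSpan b θ α := by
    rw [hx]; exact apply_mem_orthogonalSpan hu hx0
  -- u⁻¹ sends this positive root of the span back to δ - vγ, of level 1. Minus the level is
  -- negative there, so some simple β of the span has u⁻¹β of positive level k.
  obtain ⟨β, hβ, hβT, hneg⟩ := exists_affineSimple_neg hθ huA.inv (φ := 0)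
    ⟨by simp, by simp⟩ (-1) (x := g (P.opp γ, 1))
    (by by_contra h1; exact hγg ⟨hγp, h1⟩) (by rw [hx, perm_inv_apply]; simp)
    (orthogonalSimple b θ α)
    (fun σ hσ h1 ↦ ⟨Or.inl ⟨hσ, rfl⟩, by_contra fun h2 ↦ h1 (hxE.1 σ hσ h2)⟩)
    (fun h1 ↦ ⟨Or.inr rfl, by
      by_contra h2
      rw [pairingIn_opp_left, neg_eq_zero] at h2
      exact h1 (hxE.2 h2)⟩)
  obtain ⟨⟨c, k⟩, hck⟩ : ∃ y, u⁻¹ β = y := ⟨_, rfl⟩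
  have huc : u (c, k) = β := by rw [← hck, perm_apply_inv]
  rw [hck] at hneg
  simp only [Pi.zero_apply] at hneg
  have hcα : P.pairingIn ℤ c α = 0 := by
    have := huA.pairingIn (c, k) (α, 0)
    rw [huc, apply_eq_self_of_mem_closure hu] at this
    rw [← this]; exact hβT.2
  set d := P.opp (e.symm c) with hd
  have hd0 : P.pairingIn ℤ d θ = 0 := by
    rw [hd, pairingIn_opp_left, h.pairingIn_symm, hcα]; rfl
  have hgd : g (P.opp d, k) = β := by
    rw [hgu, Equiv.Perm.mul_apply u, h.mul_affinePerm_apply, hd, opp_opp, reflectionPerm_eq_self,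
      Equiv.apply_symm_apply, h.pairingIn_symm, hcα, add_zero, huc]
    rw [h.pairingIn_symm, hcα]
  have hshift : ∀ l, g (P.opp d, l) = (β.1, β.2 + (l - k)) := fun l ↦ by
    rw [← hgd, hA.shift _ l, hA.shift _ k]
    ext
    · rfl
    · simp
  have hβE := orthogonalSimple_subset_orthogonalSpan hβT
  have hβ01 : β.2 = 0 ∨ β.2 = 1 := by
    rcases hβ with h1 | rfl
    · exact Or.inl h1.2
    · exact Or.inr rfl
  have hnp : β.2 = 0 ∨ ¬ b.IsPos β.1 := by
    rcases hβ with h1 | rfl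
    · exact Or.inl h1.2
    · right
      simp only [Base.isPos_opp, not_not]
      exact hθ.isPos
  have hneg1 : ¬ AffinePos b (g (P.opp d, k - 1)) := by
    rw [hshift]
    simp only [AffinePos, not_or, not_and]
    constructor
    · intro h1
      exact hnp.resolve_left (by omega)
    · omega
  -- If k ≥ 2, then g sends (k - 1)δ - d to the negative root β - δ, so this is an inversion of
  -- level 1 and β - δ lies in the span. But β does too, while δ has the coefficient of α in θ, at
  -- least 1, at α, which is not orthogonal to itself.
  have hlev : k = 1 := by
    by_contra hk
    obtain ⟨γ', hγ', h1⟩ := hg.minuscule (P.opp d, k - 1) (Or.inr (by simp only; omega)) hneg1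
    have h2 := congrArg Prod.fst h1
    have h3 := congrArg Prod.snd h1
    simp only at h2 h3
    obtain rfl := opp_injective h2
    rw [h3] at hneg1
    have h4 := hsp d ⟨hγ', hneg1⟩ hd0
    rw [← h.mul_affinePerm_apply_opp hd0] at h4
    have h5 := apply_mem_orthogonalSpan hu h4
    rw [← Equiv.Perm.mul_apply u, ← hgu, hshift] at h5
    have hαα : P.pairingIn ℤ α α ≠ 0 := by simp
    have h6 := h5.1 α hα hαα
    have h7 := hβE.1 α hα hαα
    have h8 := hθ.one_le_coeff hα
    have h9 : (1 : ℤ) - k = -1 := by omega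
    simp only [h9] at h6
    linarith
  subst hlev
  have hdp : b.IsPos d := by
    by_contra h1
    obtain ⟨γ', -, h1⟩ := hg.minuscule (P.opp d, 1 - 1)
      (Or.inl ⟨rfl, b.isPos_opp.mpr h1⟩) hneg1
    have h3 := congrArg Prod.snd h1
    simp at h3
  obtain ⟨-, hg', hne, hself⟩ := hg.affinePerm_mul hθ hβ hdp hd0 (Or.inl hgd)
  have hdg : d ∉ minusculeSet b g := fun h1 ↦
    h1.2 (by rw [hgd]; exact affinePos_of_mem_affineSimple θ hβ)
  refine ⟨_, hg', Set.ncard_lt_ncard ⟨fun η hη ↦ ?_, fun hsub ↦ ?_⟩ (Set.toFinite _)⟩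
  · exact (hne η (by rintro rfl; exact hdg hη)).mpr hη
  · exact hdg (hsub (hself.mpr hdg))

/-- There is a greatest minuscule element with rootlet `α`. -/
lemma IsShortestTo.exists_minusculeSet_eq (hθ : IsHighestRoot b θ) (hα : α ∈ b.support)
    (h : IsShortestTo b θ α v e) :
    ∃ g, HasRootlet b θ α g ∧ minusculeSet b g = greatestSet b θ α e := by
  have h1 : ∃ n, ∃ g, HasRootlet b θ α g ∧ (minusculeSet b g).ncard + n = Nat.card ι := by
    refine ⟨_, _, h.hasRootlet hθ (Base.isPos_of_mem_support hα), Nat.add_sub_of_le ?_⟩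
    exact Set.ncard_le_card _
  classical
  -- The minimised number counts the roots missing from the set.
  obtain ⟨g, hg, hn⟩ := Nat.find_spec h1
  refine ⟨g, hg, (hg.subset_greatestSet hθ h).antisymm fun γ hγ ↦ by_contra fun hγg ↦ ?_⟩
  obtain ⟨g', hg', hlt⟩ := hg.exists_ncard_lt hθ hα h hγ hγg
  have h2 : (minusculeSet b g').ncard ≤ Nat.card ι := Set.ncard_le_card _
  have h3 := Nat.find_min' h1 (m := Nat.card ι - (minusculeSet b g').ncard)
    ⟨g', hg', Nat.add_sub_of_le h2⟩
  omega

end Interval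

end RootPairing

namespace RootPairing

variable {ι R M N : Type*} [Field R] [CharZero R] [AddCommGroup M] [Module R M]
  [AddCommGroup N] [Module R N] {P : RootPairing ι R M N} [P.IsCrystallographic]

/-! ### Chains of roots between comparable roots -/

section Chain

variable [Finite ι]

lemma exists_root_eq_sub {γ η : ι} (h : 0 < P.pairingIn ℤ γ η) (hne : γ ≠ η) :
    ∃ ζ, P.root ζ = P.root γ - P.root η :=
  P.root_sub_root_mem_of_pairingIn_pos h hne

lemma exists_root_eq_add {γ η : ι} (h : P.pairingIn ℤ γ η < 0) (hne : γ ≠ P.opp η) :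
    ∃ ζ, P.root ζ = P.root γ + P.root η :=
  P.root_add_root_mem_of_pairingIn_neg h fun h1 ↦ hne (eq_opp_iff.mpr h1)

lemma pairingIn_pos_comm {γ η : ι} : 0 < P.pairingIn ℤ γ η ↔ 0 < P.pairingIn ℤ η γ :=
  P.zero_lt_pairingIn_iff' ℤ

lemma pairingIn_neg_comm {γ η : ι} : P.pairingIn ℤ γ η < 0 ↔ P.pairingIn ℤ η γ < 0 := by
  have := pairingIn_pos_comm (P := P) (γ := P.opp γ) (η := η)
  simpa using this

lemma eq_of_two_le_pairingIn [P.IsReduced] {γ η : ι} (h1 : 2 ≤ P.pairingIn ℤ γ η)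
    (h2 : 2 ≤ P.pairingIn ℤ η γ) : γ = η := by
  have h3 := P.pairingIn_pairingIn_mem_set_of_isCrystallographic γ η
  have h4 : P.pairingIn ℤ γ η = 2 ∧ P.pairingIn ℤ η γ = 2 := by
    simp only [Set.mem_insert_iff, Set.mem_singleton_iff, Prod.mk.injEq] at h3
    omega
  exact (P.pairingIn_two_two_iff ℤ γ η).mp h4

variable [P.IsReduced] {b : P.Base}

/-- Two roots `μ < ν` with `μ` positive admit a simple root which can be added to `μ` or subtracted
from `ν`. -/
lemma Base.exists_pairingIn_neg_or_pos {μ ν : ι}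
    (hle : ∀ σ ∈ b.support, b.coeff σ μ ≤ b.coeff σ ν) (hne : μ ≠ ν) :
    ∃ τ ∈ b.support, b.coeff τ μ < b.coeff τ ν ∧
      (P.pairingIn ℤ μ τ < 0 ∨ 0 < P.pairingIn ℤ ν τ) := by
  by_contra! hcon
  have := Fintype.ofFinite ι
  set B := P.posRootForm ℤ
  -- Both sides are multiples of the inner product of ζ with ν - μ. Without a suitable τ this
  -- product is ≥ 0 at μ and ≤ 0 at ν, which forces both pairings of μ and ν to be at least 2.
  have key : ∀ ζ, ∑ τ ∈ b.support, (b.coeff τ ν - b.coeff τ μ) *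
      (P.pairingIn ℤ ζ τ * B.rootLength τ) =
      (P.pairingIn ℤ ν ζ - P.pairingIn ℤ μ ζ) * B.rootLength ζ := fun ζ ↦ by
    rw [(IsAdd.pairingIn ζ).eq_sum b ν, (IsAdd.pairingIn ζ).eq_sum b μ, ← Finset.sum_sub_distrib,
      Finset.sum_mul]
    refine Finset.sum_congr rfl fun τ _ ↦ ?_
    linear_combination -(b.coeff τ ν - b.coeff τ μ) * B.pairingIn_mul_eq_pairingIn_mul_swap ζ τ
  have h1 : 0 ≤ (P.pairingIn ℤ ν μ - P.pairingIn ℤ μ μ) * B.rootLength μ := by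
    rw [← key]
    refine Finset.sum_nonneg fun τ hτ ↦ ?_
    rcases (hle τ hτ).eq_or_lt with h | h
    · simp [h]
    · exact mul_nonneg (by omega) (mul_nonneg (hcon τ hτ h).1 (B.rootLength_pos τ).le)
  have h2 : (P.pairingIn ℤ ν ν - P.pairingIn ℤ μ ν) * B.rootLength ν ≤ 0 := by
    rw [← key]
    refine Finset.sum_nonpos fun τ hτ ↦ ?_
    rcases (hle τ hτ).eq_or_lt with h | h
    · simp [h]
    · exact mul_nonpos_of_nonneg_of_nonpos (by omega)
        (mul_nonpos_of_nonpos_of_nonneg (hcon τ hτ h).2 (B.rootLength_pos τ).le)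
  have h3 := nonneg_of_mul_nonneg_left h1 (B.rootLength_pos μ)
  have h4 := nonpos_of_mul_nonpos_left h2 (B.rootLength_pos ν)
  rw [pairingIn_same] at h3 h4
  exact hne (eq_of_two_le_pairingIn (P := P) (by omega) (by omega))

/-- Any two roots `μ ≤ ν` with `μ` positive are joined by a chain of roots in which each is obtained
from the previous one by adding a simple root. -/
lemma Base.exists_chain {μ ν : ι} (hμ : b.IsPos μ)
    (hle : ∀ σ ∈ b.support, b.coeff σ μ ≤ b.coeff σ ν) :
    Relation.ReflTransGen (fun x y ↦ ∃ τ ∈ b.support, P.root y = P.root x + P.root τ) μ ν := by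
  generalize hn : (b.height ν - b.height μ).toNat = n
  induction n using Nat.strong_induction_on generalizing μ ν with | _ n ih
  by_cases hne : μ = ν
  · rw [hne]
  have hht : b.height μ ≤ b.height ν := Finset.sum_le_sum hle
  obtain ⟨τ, hτ, hlt, h⟩ := exists_pairingIn_neg_or_pos hle hne
  have hht' : b.height μ < b.height ν := Finset.sum_lt_sum hle ⟨τ, hτ, hlt⟩
  have hτ1 := Base.height_one_of_mem_support hτ
  rcases h with h | h
  · obtain ⟨x, hx⟩ := exists_root_eq_add h fun h1 ↦ by
      rw [h1, Base.isPos_opp] at hμ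
      exact hμ (Base.isPos_of_mem_support hτ)
    have hhx := b.height_add hx
    refine Relation.ReflTransGen.head ⟨τ, hτ, hx⟩ (ih _ (by omega)
      (hμ.add (Base.isPos_of_mem_support hτ) hx) (fun σ hσ ↦ ?_) rfl)
    rw [(b.isAdd_coeff σ).add _ _ _ hx]
    rcases eq_or_ne σ τ with rfl | h1
    · rw [b.coeff_self hτ]; omega
    · rw [b.coeff_ne hτ h1, add_zero]; exact hle σ hσ
  · have hντ : ν ≠ τ := by
      rintro rfl
      rw [Base.isPos_iff] at hμ
      omega
    obtain ⟨x, hx⟩ := exists_root_eq_sub h hντ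
    have hx' : P.root ν = P.root x + P.root τ := by rw [hx]; abel
    have hhx := b.height_add hx'
    refine Relation.ReflTransGen.tail (ih _ (by omega) hμ (fun σ hσ ↦ ?_) rfl) ⟨τ, hτ, hx'⟩
    rw [(b.isAdd_coeff σ).sub hx]
    rcases eq_or_ne σ τ with rfl | h1
    · rw [b.coeff_self hτ]; omega
    · rw [b.coeff_ne hτ h1, sub_zero]; exact hle σ hσ

end Chain

/-- The set `I` is stable under subtracting `σ`, and `σ` is not in `I`: the root space of `-σ`
normalises the span of the root spaces of the elements of `I`. -/
def IsSubStable (P : RootPairing ι R M N) (I : Set ι) (σ : ι) : Prop :=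
  σ ∉ I ∧ ∀ γ ∈ I, ∀ η, P.root η = P.root γ - P.root σ → η ∈ I

/-! ### Stability of the least and greatest sets under subtracting a simple root -/

namespace IsShortestTo

variable [Finite ι] [P.IsReduced] {b : P.Base} {θ α : ι} {v : Equiv.Perm (ι × ℤ)}
  {e : Equiv.Perm ι}

/-- If ⟨γ, θ⟩ = 1, then e maps the reflection of γ in θ to eγ - α. As α is simple, this root is
positive exactly when eγ is. -/
lemma mem_leastSet_iff (hθ : IsHighestRoot b θ) (hα : α ∈ b.support)
    (h : IsShortestTo b θ α v e) {γ : ι} :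
    γ ∈ leastSet b θ e ↔ 0 < P.pairingIn ℤ γ θ ∧ b.IsPos (e γ) := by
  have hαp := Base.isPos_of_mem_support (b := b) hα
  by_cases hγθ : γ = θ
  · simp [leastSet, hγθ, h.apply_highest, hαp]
  have h1 := (hθ.isMaxLength γ).resolve_left hγθ
  have h2 : P.pairingIn ℤ γ θ = 1 → (b.IsPos (e (P.reflectionPerm θ γ)) ↔ b.IsPos (e γ)) := by
    intro h3
    have h4 := root_reflectionPerm_eq (P := P) γ θ
    rw [h3, one_smul] at h4
    have h5 := h.isRootAut.sub h4
    rw [h.apply_highest] at h5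
    exact ⟨fun h6 ↦ h6.add hαp (by rw [h5]; abel), fun h6 ↦ h6.sub hα h5⟩
  simp only [leastSet, Set.mem_ofPred_eq, hγθ, false_or]
  constructor
  · rintro ⟨-, h3, h4⟩
    exact ⟨by omega, (h2 h3).mp h4⟩
  · rintro ⟨h3, h4⟩
    exact ⟨hθ.isPos_of_pairingIn_pos h3, by omega, (h2 (by omega)).mpr h4⟩

/-- Pairing with θ is monotone in the coefficients, so here γ and η differ only by simple roots
orthogonal to θ, and e keeps these positive. -/
lemma height_le (hθ : IsHighestRoot b θ) (h : IsShortestTo b θ α v e) {γ η : ι}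
    (hle : ∀ σ ∈ b.support, b.coeff σ γ ≤ b.coeff σ η)
    (hp : P.pairingIn ℤ η θ ≤ P.pairingIn ℤ γ θ) : b.height (e γ) ≤ b.height (e η) := by
  refine (h.isRootAut.isAdd_comp b.isAdd_height).le_of_coeff_le hle fun σ hσ hlt ↦ ?_
  have h1 : ∀ τ ∈ b.support, b.coeff τ γ * P.pairingIn ℤ τ θ ≤ b.coeff τ η * P.pairingIn ℤ τ θ :=
    fun τ hτ ↦ mul_le_mul_of_nonneg_right (hle τ hτ) (hθ.pairingIn_simple_nonneg hτ)
  have h2 := Finset.sum_le_sum h1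
  rw [(IsAdd.pairingIn θ).eq_sum b γ, (IsAdd.pairingIn θ).eq_sum b η] at hp
  have h3 := (Finset.sum_eq_sum_iff_of_le h1).mp (le_antisymm h2 hp) σ hσ
  have h4 : P.pairingIn ℤ σ θ = 0 := by
    by_contra h5
    exact hlt.ne (mul_right_cancel₀ h5 h3)
  have := h.isPos σ (Base.isPos_of_mem_support hσ) h4
  rw [Base.isPos_iff] at this
  exact this.le

/-! ### Simple roots orthogonal to θ -/

section Orthogonal

variable {σ : ι}

/-- Subtracting σ keeps the pairing with θ, and the least set is the part of the greatest set that
pairs positively with θ. -/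
lemma isSubStable_leastSet (h : IsShortestTo b θ α v e) (hθ : IsHighestRoot b θ)
    (hα : α ∈ b.support) (h0 : P.pairingIn ℤ σ θ = 0)
    (hs : P.IsSubStable (greatestSet b θ α e) σ) : P.IsSubStable (leastSet b θ e) σ := by
  refine ⟨fun h1 ↦ hs.1 (Or.inl h1), fun γ hγ η hη ↦ ?_⟩
  have h1 := (IsAdd.pairingIn θ).sub hη
  have h2 := ((h.mem_leastSet_iff hθ hα).mp hγ).1
  rcases hs.2 γ (Or.inl hγ) η hη with h3 | ⟨-, h3, -⟩
  · exact h3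
  · omega

/-- Suppose eσ is a sum of two positive roots eγ₁ + eγ₂. As σ is simple, one of γ₁, γ₂ is negative,
say γ₁; then ⟨γ₁, θ⟩ = -1 and ⟨γ₂, θ⟩ = 1. Now γ₁ + θ is in the least set, so stability puts γ₁ + θ
- σ = θ - γ₂ there, and α = e(θ - γ₂) + eγ₂ splits into positive roots. -/
lemma apply_mem_support (h : IsShortestTo b θ α v e) (hθ : IsHighestRoot b θ)
    (hα : α ∈ b.support) (hσ : σ ∈ b.support) (h0 : P.pairingIn ℤ σ θ = 0)
    (hs : P.IsSubStable (leastSet b θ e) σ) : e σ ∈ b.support := by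
  have key : ∀ γ₁ γ₂, P.root σ = P.root γ₁ + P.root γ₂ → b.IsPos (e γ₁) → b.IsPos (e γ₂) →
      b.IsPos γ₁ := by
    intro γ₁ γ₂ hadd h1 h2
    by_contra h3
    have hp := (IsAdd.pairingIn θ).add _ _ _ hadd
    simp only [h0] at hp
    have h4 := hθ.pairingIn_nonpos h3
    have h5 : P.pairingIn ℤ γ₁ θ ≠ 0 := fun h5 ↦ by
      have := h.isPos _ (b.isPos_opp.mpr h3) (by rw [pairingIn_opp_left, h5]; rfl)
      rw [h.isRootAut.apply_opp, Base.isPos_opp] at this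
      exact this h1
    have h6 : γ₂ ≠ θ := by
      rintro rfl
      rw [pairingIn_same] at hp
      have h7 := (hθ.isMaxLength.neg_one_le γ₁).resolve_right (by omega)
      refine P.ne_zero σ ?_
      rw [hadd, h7, root_opp, neg_add_cancel]
    have h7 := (hθ.isMaxLength γ₂).resolve_left h6
    have h8 := root_reflectionPerm_eq (P := P) γ₁ θ
    rw [show P.pairingIn ℤ γ₁ θ = -1 by omega, neg_smul, one_smul, sub_neg_eq_add] at h8
    have h9 : P.root (P.opp (P.reflectionPerm θ γ₂)) = P.root θ - P.root γ₂ := by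
      rw [root_opp, root_reflectionPerm_eq, show P.pairingIn ℤ γ₂ θ = 1 by omega, one_smul]
      abel
    have h10 := h.isRootAut.add _ _ _ h8
    have h11 := h.isRootAut.sub h9
    rw [h.apply_highest] at h10 h11
    have h12 := (IsAdd.pairingIn θ).add _ _ _ h8
    rw [pairingIn_same] at h12
    have h13 := hs.2 _ ((h.mem_leastSet_iff hθ hα).mpr ⟨by omega, h1.add
      (Base.isPos_of_mem_support hα) h10⟩)
      (P.opp (P.reflectionPerm θ γ₂)) (by rw [h8, h9, hadd]; abel)
    exact ((h.mem_leastSet_iff hθ hα).mp h13).2.root_add_ne h2 hα (by rw [h11]; abel)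
  by_contra hns
  obtain ⟨μ, τ, hτ, hμ, hadd⟩ :=
    (h.isPos σ (Base.isPos_of_mem_support hσ) h0).exists_eq_add hns
  have hadd' := h.isRootAut_symm.add _ _ _ hadd
  rw [Equiv.symm_apply_apply] at hadd'
  have hτp := Base.isPos_of_mem_support (b := b) hτ
  exact (key _ _ hadd' (by simpa) (by simpa)).root_add_ne
    (key _ _ (hadd'.trans (add_comm _ _)) (by simpa) (by simpa)) hσ hadd'

/-- Since eσ is simple and orthogonal to α, subtracting it leaves the coefficients at the simple
roots not orthogonal to α unchanged. -/
lemma isSubStable_greatestSet (h : IsShortestTo b θ α v e) (hθ : IsHighestRoot b θ)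
    (hα : α ∈ b.support) (hσ : σ ∈ b.support) (h0 : P.pairingIn ℤ σ θ = 0)
    (hs : P.IsSubStable (leastSet b θ e) σ) : P.IsSubStable (greatestSet b θ α e) σ := by
  have heσ := h.apply_mem_support hθ hα hσ h0 hs
  have heα : P.pairingIn ℤ (e σ) α = 0 := by rw [h.pairingIn, h0]
  have hne : ∀ τ, P.pairingIn ℤ τ α ≠ 0 → τ ≠ e σ := by
    rintro τ hτ rfl
    exact hτ heα
  refine ⟨?_, fun γ hγ η hη ↦ ?_⟩
  · rintro (h1 | ⟨-, -, -, -, -, h1⟩)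
    · exact hs.1 h1
    · have hαα : P.pairingIn ℤ α α ≠ 0 := by simp
      have h2 := h1 α hα hαα
      rw [b.coeff_ne heσ (hne α hαα)] at h2
      have := hθ.one_le_coeff hα
      omega
  · rcases hγ with hγ | ⟨hγp, hγ0, hK⟩
    · exact Or.inl (hs.2 γ hγ η hη)
    · right
      have h1 := (IsAdd.pairingIn θ).sub hη
      have hηp := hγp.sub hσ hη
      have hη0 : P.pairingIn ℤ η θ = 0 := by rw [h1, hγ0, h0]; rfl
      refine ⟨hηp, hη0, h.isPos η hηp hη0, by rw [h.pairingIn, hη0], hK.2.2.1, fun τ hτ hτα ↦ ?_⟩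
      rw [(b.isAdd_coeff τ).sub (h.isRootAut.sub hη), b.coeff_ne heσ (hne τ hτα), sub_zero]
      exact hK.2.2.2 τ hτ hτα

end Orthogonal

/-! ### Simple roots not orthogonal to θ -/

section NotOrthogonal

variable {σ γ γ' : ι}

/-- In the situation of `isSubStable_greatestSet_of_notMem`, a chain of roots from `e γ'` to `θ`
uses only simple roots orthogonal to `α`. -/
lemma pairingIn_eq_zero_of_chain (h : IsShortestTo b θ α v e) (hθ : IsHighestRoot b θ)
    (hα : α ∈ b.support) (hσ : σ ∈ b.support) (hσθ : P.pairingIn ℤ σ θ = 1)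
    (heσ : ¬ b.IsPos (e σ)) (hγ : P.pairingIn ℤ γ θ = 1) (heγ : b.IsPos (e γ))
    (hγ' : P.root γ' = P.root γ - P.root σ) (hγp : b.IsPos γ') {μ ν τ : ι}
    (hμ : b.IsPos μ) (hμα : P.pairingIn ℤ μ α = 0)
    (hle : ∀ ρ ∈ b.support, b.coeff ρ γ' ≤ b.coeff ρ (e.symm μ))
    (hτ : τ ∈ b.support) (hν : P.root ν = P.root μ + P.root τ) : P.pairingIn ℤ τ α = 0 := by
  by_contra hτα
  have hνα := (IsAdd.pairingIn α).add _ _ _ hν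
  rw [hμα, zero_add] at hνα
  have hτp := Base.isPos_of_mem_support (b := b) hτ
  have hαL : P.IsMaxLength α := fun x ↦ by
    rcases hθ.isMaxLength (e.symm x) with h1 | h1
    · left; rw [← h.apply_highest, ← h1, Equiv.apply_symm_apply]
    · right; rwa [h.pairingIn_symm] at h1
  have hτne : τ ≠ α := by
    rintro rfl
    rcases hαL ν with rfl | h1
    · exact P.ne_zero μ (by simpa using hν)
    · rw [hνα, pairingIn_same] at h1; omega
  have hτα' : P.pairingIn ℤ τ α = -1 := by
    have h1 := b.pairingIn_le_zero_of_ne hτne hτ hα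
    rcases hαL.neg_one_le τ with rfl | h2
    · exact absurd (Base.isPos_of_mem_support hα) ((b.isPos_opp).mp hτp)
    · omega
  have hd' := h.isRootAut_symm.add _ _ _ hν
  -- If τ is not orthogonal to α, then ⟨ν, α⟩ = ⟨τ, α⟩ = -1, so c and d pair to 1 with θ, and d = c
  -- + e⁻¹μ while ed = -τ < 0.
  set c := P.opp (e.symm ν) with hc
  set d := P.opp (e.symm τ) with hd
  have hdc : P.root d = P.root c + P.root (e.symm μ) := by
    rw [hc, hd, root_opp, root_opp, hd']; abel
  have hcθ : P.pairingIn ℤ c θ = 1 := by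
    rw [hc, pairingIn_opp_left, h.pairingIn_symm, hνα, hτα']; rfl
  have hdθ : P.pairingIn ℤ d θ = 1 := by
    rw [hd, pairingIn_opp_left, h.pairingIn_symm, hτα']; rfl
  have hcp : b.IsPos c := hθ.isPos_of_pairingIn_pos (by omega)
  have hed : ¬ b.IsPos (e d) := by
    rw [hd, h.isRootAut.apply_opp, Equiv.apply_symm_apply, Base.isPos_opp, not_not]
    exact hτp
  have hμp := h.isPos_symm hμ hμα
  have hμθ : P.pairingIn ℤ (e.symm μ) θ = 0 := by rw [h.pairingIn_symm, hμα]
  by_cases hcσ : 1 ≤ b.coeff σ c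
  -- If c involves σ, then γ = γ' + σ ≤ e⁻¹μ + c = d coefficientwise, so ed would be positive like
  -- eγ.
  · have h1 : b.height (e γ) ≤ b.height (e d) := by
      refine h.height_le hθ (fun ρ hρ ↦ ?_) (by omega)
      have h2 := (b.isAdd_coeff ρ).sub hγ'
      have h3 := (b.isAdd_coeff ρ).add _ _ _ hdc
      have h4 := hle ρ hρ
      have h5 : b.coeff ρ σ ≤ b.coeff ρ c := by
        rcases eq_or_ne ρ σ with rfl | h6
        · rwa [b.coeff_self hσ]
        · rw [b.coeff_ne hσ h6]; exact hcp.coeff_nonneg ρ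
      omega
    rw [Base.isPos_iff] at heγ hed
    omega
  · have hcσ' : b.coeff σ c = 0 := by have := hcp.coeff_nonneg σ; omega
    -- Otherwise none of c, γ', e⁻¹μ involves σ. Passing from γ' to e⁻¹μ adds only simple roots
    -- other than σ, which can only lower the pairing with σ; the aim is ⟨d, σ⟩ < 0.
    have hnp : ∀ {x y : ι}, b.IsPos y → b.coeff σ y = 0 →
        (∀ ρ ∈ b.support, b.coeff ρ x ≤ b.coeff ρ y) → b.coeff σ x = 0 →
        P.pairingIn ℤ y σ ≤ P.pairingIn ℤ x σ := by
      intro x y _ hy hxy hx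
      have := (IsAdd.pairingIn σ).neg_fun.le_of_coeff_le hxy fun ρ hρ hlt ↦ by
        have hρσ : ρ ≠ σ := by rintro rfl; omega
        have := b.pairingIn_le_zero_of_ne hρσ hρ hσ
        omega
      omega
    have hγ'θ : P.pairingIn ℤ γ' θ = 0 := by
      have := (IsAdd.pairingIn θ).sub hγ'
      omega
    have hγ'σ : b.coeff σ γ' = 0 := hθ.coeff_eq_zero hγp hγ'θ (by omega)
    have hμσ : b.coeff σ (e.symm μ) = 0 := hθ.coeff_eq_zero hμp hμθ (by omega)
    have h1 := hnp hμp hμσ hle hγ'σ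
    have h2 : P.pairingIn ℤ c σ ≤ 0 := by
      rw [(IsAdd.pairingIn σ).eq_sum b c]
      refine Finset.sum_nonpos fun ρ hρ ↦ ?_
      rcases eq_or_ne ρ σ with rfl | h3
      · rw [hcσ', zero_mul]
      · exact mul_nonpos_of_nonneg_of_nonpos (hcp.coeff_nonneg ρ)
          (b.pairingIn_le_zero_of_ne h3 hρ hσ)
    -- Otherwise ⟨γ, σ⟩ ≥ 2, while γ has coefficient 1 at σ, so reflecting γ in σ would give a
    -- positive root with a negative coefficient.
    have h3 : P.pairingIn ℤ γ' σ < 0 := by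
      by_contra! h4
      have h5 : 0 < P.pairingIn ℤ γ σ := by
        have := (IsAdd.pairingIn σ).sub hγ'
        rw [pairingIn_same] at this
        omega
      have h6 := root_reflectionPerm_eq (P := P) γ σ
      have h7 := (b.isAdd_coeff σ).reflectionPerm b γ σ
      have h8 := (b.isAdd_coeff σ).sub hγ'
      rw [b.coeff_self hσ] at h7 h8
      have h9 := (IsAdd.pairingIn σ).sub hγ'
      rw [pairingIn_same] at h9
      have hγσ : γ ≠ σ := by
        rintro rfl
        exact P.ne_zero γ' (by rw [hγ', sub_self])
      have hγpos : b.IsPos γ := hθ.isPos_of_pairingIn_pos (by omega)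
      have := (hγpos.reflectionPerm hσ hγσ).coeff_nonneg σ
      omega
    have h4 := (IsAdd.pairingIn σ).add _ _ _ hdc
    obtain ⟨x, hx⟩ := exists_root_eq_add (P := P) (γ := d) (η := σ) (by omega) fun h5 ↦ by
      have := hθ.isPos_of_pairingIn_pos (γ := d) (by omega)
      rw [h5, Base.isPos_opp] at this
      exact this (Base.isPos_of_mem_support hσ)
    have h5 := (IsAdd.pairingIn θ).add _ _ _ hx
    -- The root d + σ pairs to 2 with θ, so it is θ, and α = ed + eσ would be a sum of two negative
    -- roots.
    obtain rfl := (hθ.isMaxLength x).resolve_right (by omega)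
    have h6 := b.height_add (h.isRootAut.add _ _ _ hx)
    rw [h.apply_highest, Base.height_one_of_mem_support hα] at h6
    rw [Base.isPos_iff] at heσ hed
    omega

/-- Here eσ < 0. If γ = θ, then e(θ - σ) = α - eσ > 0. If ⟨γ, θ⟩ = 1, then γ - σ is orthogonal to θ
and must be shown to be one of the added roots. If γ ⟂ θ, then γ - σ would be positive with negative
pairing. -/
lemma isSubStable_greatestSet_of_notMem (h : IsShortestTo b θ α v e) (hθ : IsHighestRoot b θ)
    (hα : α ∈ b.support) (hσ : σ ∈ b.support) (hσθ : 0 < P.pairingIn ℤ σ θ)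
    (hs : σ ∉ leastSet b θ e) : P.IsSubStable (greatestSet b θ α e) σ := by
  have hαp := Base.isPos_of_mem_support (b := b) hα
  have heσ : ¬ b.IsPos (e σ) := fun h1 ↦ hs ((h.mem_leastSet_iff hθ hα).mpr ⟨hσθ, h1⟩)
  have hσ1 : P.pairingIn ℤ σ θ = 1 := by
    rcases hθ.isMaxLength σ with rfl | h1
    · rw [h.apply_highest] at heσ
      exact absurd hαp heσ
    · omega
  refine ⟨?_, fun γ hγ γ' hγ' ↦ ?_⟩
  · rintro (h1 | ⟨-, h1, -⟩)
    · exact hs h1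
    · omega
  have hp := (IsAdd.pairingIn θ).sub hγ'
  have hγpos : b.IsPos γ := by
    rcases hγ with hγ | hγ
    · exact hθ.isPos_of_pairingIn_pos ((h.mem_leastSet_iff hθ hα).mp hγ).1
    · exact hγ.1
  have hγ'p := hγpos.sub hσ hγ'
  have hp' := hθ.pairingIn_nonneg hγ'p
  rcases hγ with hγ | ⟨-, hγ0, -⟩
  swap
  · omega
  obtain ⟨h1, h2⟩ := (h.mem_leastSet_iff hθ hα).mp hγ
  rcases hθ.isMaxLength γ with rfl | h3
  · left
    rw [h.mem_leastSet_iff hθ hα]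
    rw [pairingIn_same] at hp
    refine ⟨by omega, ?_⟩
    rw [← b.isPos_opp] at heσ
    refine hαp.add heσ ?_
    rw [h.isRootAut.sub hγ', h.apply_highest, root_opp]
    abel
  · right
    have hγ1 : P.pairingIn ℤ γ θ = 1 := by omega
    have hγ'0 : P.pairingIn ℤ γ' θ = 0 := by omega
    have hη := h.isPos γ' hγ'p hγ'0
    refine ⟨hγ'p, hγ'0, hη, by rw [h.pairingIn, hγ'0], ?_⟩
    have hchain := Base.exists_chain hη fun σ _ ↦ hθ.coeff_le σ (e γ')
    -- This invariant is carried along the chain from eγ' to θ; its value at θ is the extremality of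
    -- eγ', including θ ⟂ α.
    suffices H : b.IsPos θ ∧ P.pairingIn ℤ θ α = 0 ∧
        (∀ ρ ∈ b.support, b.coeff ρ γ' ≤ b.coeff ρ (e.symm θ)) ∧
        ∀ ρ ∈ b.support, P.pairingIn ℤ ρ α ≠ 0 → b.coeff ρ (e γ') = b.coeff ρ θ from
      ⟨H.2.1, H.2.2.2⟩
    refine hchain.rec (motive := fun x _ ↦ b.IsPos x ∧ P.pairingIn ℤ x α = 0 ∧
        (∀ ρ ∈ b.support, b.coeff ρ γ' ≤ b.coeff ρ (e.symm x)) ∧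
        ∀ ρ ∈ b.support, P.pairingIn ℤ ρ α ≠ 0 → b.coeff ρ (e γ') = b.coeff ρ x) ?_ ?_
    · exact ⟨hη, by rw [h.pairingIn, hγ'0], by simp, fun _ _ _ ↦ rfl⟩
    · rintro μ ν - ⟨τ, hτ, hν⟩ ⟨hμ, hμα, hle, hco⟩
      have hτα := h.pairingIn_eq_zero_of_chain hθ hα hσ hσ1 heσ hγ1 h2 hγ' hγ'p hμ hμα hle hτ hν
      have hτp := Base.isPos_of_mem_support (b := b) hτ
      refine ⟨hμ.add hτp hν, ?_, fun ρ hρ ↦ ?_, fun ρ hρ hρα ↦ ?_⟩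
      · have := (IsAdd.pairingIn α).add _ _ _ hν
        omega
      · have h4 := (b.isAdd_coeff ρ).add _ _ _ (h.isRootAut_symm.add _ _ _ hν)
        have h5 := (h.isPos_symm hτp hτα).coeff_nonneg ρ
        have h6 := hle ρ hρ
        omega
      · rw [hco ρ hρ hρα, (b.isAdd_coeff ρ).add _ _ _ hν, b.coeff_ne hτ, add_zero]
        rintro rfl
        exact hρα hτα

end NotOrthogonal

end IsShortestTo

end RootPairing

/-! ### Paths in the Dynkin diagram and the exceptional type A case -/

namespace RootPairing

variable {ι R M N : Type*} [Field R] [CharZero R] [AddCommGroup M] [Module R M]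
  [AddCommGroup N] [Module R N] {P : RootPairing ι R M N} [P.IsCrystallographic]
  [Finite ι] [P.IsReduced] {b : P.Base}

lemma pairingIn_neg_of_ne_zero {σ τ : ι} (hσ : σ ∈ b.support) (hτ : τ ∈ b.support) (hne : σ ≠ τ)
    (h : P.pairingIn ℤ σ τ ≠ 0) : P.pairingIn ℤ σ τ < 0 :=
  lt_of_le_of_ne (b.pairingIn_le_zero_of_ne hne hσ hτ) h

/-- Any two simple roots are joined by a path in the Dynkin diagram. -/
lemma Base.exists_path [P.IsIrreducible] {σ τ : ι} (hσ : σ ∈ b.support) (hτ : τ ∈ b.support) :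
    ∃ (n : ℕ) (p : ℕ → ι), p 0 = σ ∧ p n = τ ∧ (∀ i, p i ∈ b.support) ∧
      Set.InjOn p {i | i ≤ n} ∧ ∀ i < n, P.pairingIn ℤ (p i) (p (i + 1)) < 0 := by
  let G : SimpleGraph b.support :=
    { Adj := fun i j ↦ i ≠ j ∧ P.pairingIn ℤ i j ≠ 0
      symm := ⟨fun i j h ↦ ⟨h.1.symm, fun h0 ↦ h.2 (P.pairingIn_eq_zero_iff.mp h0)⟩⟩
      loopless := ⟨fun i h ↦ h.1 rfl⟩ }
  have hr : G.Reachable ⟨σ, hσ⟩ ⟨τ, hτ⟩ := by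
    refine b.induction_on_cartanMatrix (fun x ↦ G.Reachable ⟨σ, hσ⟩ x) (.refl _) fun i j hi hij ↦ ?_
    by_cases h : i = j
    · rwa [← h]
    · refine hi.trans (SimpleGraph.Adj.reachable ⟨h, fun h0 ↦ hij ?_⟩)
      exact P.pairingIn_eq_zero_iff.mp h0
  obtain ⟨p, hp⟩ := hr.exists_isPath
  refine ⟨p.length, fun i ↦ p.getVert i, by simp, by simp, fun i ↦ (p.getVert i).2,
    fun i hi j hj h ↦ hp.getVert_injOn hi hj (Subtype.ext h), fun i hi ↦ ?_⟩
  have h := p.adj_getVert_succ hi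
  exact pairingIn_neg_of_ne_zero (p.getVert i).2 (p.getVert (i + 1)).2
    (fun h1 ↦ h.1 (Subtype.ext h1)) h.2

/-- The sum of the vertices of a path in the Dynkin diagram is a root. -/
lemma exists_isAdd_sum_eq {n : ℕ} {p : ℕ → ι} (hp : ∀ i, p i ∈ b.support)
    (hinj : Set.InjOn p {i | i ≤ n})
    (hadj : ∀ i < n, P.pairingIn ℤ (p i) (p (i + 1)) < 0) {m : ℕ} (hm : m ≤ n) :
    ∃ γ, ∀ ψ : ι → ℤ, P.IsAdd ψ → ψ γ = ∑ i ∈ Finset.range (m + 1), ψ (p i) := by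
  induction m with
  | zero => exact ⟨p 0, fun ψ _ ↦ by simp⟩
  | succ m ih =>
    obtain ⟨γ, hγ⟩ := ih (by omega)
    have hne : ∀ i ∈ Finset.range (m + 1), p i ≠ p (m + 1) := fun i hi h ↦ by
      rw [Finset.mem_range] at hi
      have := hinj (show i ≤ n by omega) (show m + 1 ≤ n by omega) h
      omega
    have h1 : P.pairingIn ℤ γ (p (m + 1)) < 0 := by
      rw [hγ _ (IsAdd.pairingIn _), Finset.sum_range_succ]
      refine add_neg_of_nonpos_of_neg (Finset.sum_nonpos fun i hi ↦ ?_) (hadj m (by omega))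
      exact b.pairingIn_le_zero_of_ne (hne i (Finset.mem_range.mpr
        (by rw [Finset.mem_range] at hi; omega))) (hp i) (hp _)
    have h2 : γ ≠ P.opp (p (m + 1)) := by
      rintro rfl
      have h3 := hγ _ (b.isAdd_coeff (p (m + 1)))
      rw [Base.coeff_opp, b.coeff_self (hp _), Finset.sum_eq_zero fun i hi ↦
        b.coeff_ne (hp i) (hne i hi).symm] at h3
      omega
    obtain ⟨η, hη⟩ := exists_root_eq_add h1 h2
    exact ⟨η, fun ψ hψ ↦ by rw [Finset.sum_range_succ, ← hγ ψ hψ, hψ.add _ _ _ hη]⟩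

lemma sum_range_cartanMatrix_A {n i : ℕ} (hi : i ≤ n) :
    ∑ j ∈ Finset.range (n + 1), (if i = j then (2 : ℤ) else if i + 1 = j ∨ j + 1 = i then -1 else 0) =
      2 - (if i + 1 ≤ n then 1 else 0) - (if 1 ≤ i then 1 else 0) := by
  -- The subtraction i - 1 is truncated at 0, hence the guard 1 ≤ i in the last term.
  have h1 : ∀ j ∈ Finset.range (n + 1), (if i = j then (2 : ℤ) else
      if i + 1 = j ∨ j + 1 = i then -1 else 0) =
      (if i = j then 2 else 0) - (if i + 1 = j then 1 else 0) -
        (if i - 1 = j then if 1 ≤ i then 1 else 0 else 0) := by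
    intro j _
    split_ifs <;> omega
  rw [Finset.sum_congr rfl h1, Finset.sum_sub_distrib, Finset.sum_sub_distrib,
    Finset.sum_ite_eq, Finset.sum_ite_eq, Finset.sum_ite_eq]
  simp only [Finset.mem_range]
  split_ifs <;> omega

/-- If the highest root is the sum of the vertices of a path in the Dynkin diagram whose ends are
not orthogonal to it, then the path is a Dynkin diagram of type `A`. -/
lemma IsHighestRoot.pairingIn_path {θ : ι} (hθ : IsHighestRoot b θ) {n : ℕ} {p : ℕ → ι}
    (hn : n ≠ 0) (hp : ∀ i, p i ∈ b.support) (hinj : Set.InjOn p {i | i ≤ n})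
    (hadj : ∀ i < n, P.pairingIn ℤ (p i) (p (i + 1)) < 0)
    (hsum : ∀ ψ : ι → ℤ, P.IsAdd ψ → ψ θ = ∑ i ∈ Finset.range (n + 1), ψ (p i))
    (h0 : 0 < P.pairingIn ℤ (p 0) θ) (h1 : 0 < P.pairingIn ℤ (p n) θ) {i j : ℕ} (hi : i ≤ n)
    (hj : j ≤ n) :
    P.pairingIn ℤ (p j) (p i) = if i = j then 2 else if i + 1 = j ∨ j + 1 = i then -1 else 0 := by
  have hle : ∀ j ∈ Finset.range (n + 1), P.pairingIn ℤ (p j) (p i) ≤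
      if i = j then 2 else if i + 1 = j ∨ j + 1 = i then -1 else 0 := by
    intro j hj
    rw [Finset.mem_range] at hj
    split_ifs with h2 h3
    · rw [h2, pairingIn_same]
    · rcases h3 with rfl | rfl
      · have := pairingIn_neg_comm.mp (hadj i (by omega))
        omega
      · have := hadj j (by omega)
        omega
    · refine b.pairingIn_le_zero_of_ne (fun h4 ↦ h2 ?_) (hp j) (hp i)
      exact (hinj (show j ≤ n by omega) hi h4).symm
  -- Each pairing is at most the type A entry. Their sum is ⟨θ, p i⟩, nonnegative and positive at
  -- the ends, hence at least the type A row sum; so equality holds termwise.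
  refine (Finset.sum_eq_sum_iff_of_le hle).mp (le_antisymm (Finset.sum_le_sum hle) ?_) j
    (Finset.mem_range.mpr (by omega))
  rw [← hsum _ (IsAdd.pairingIn (p i)), sum_range_cartanMatrix_A hi]
  have h2 : 0 ≤ P.pairingIn ℤ θ (p i) := by
    by_contra! h3
    have := hθ.pairingIn_simple_nonneg (hp i)
    have := pairingIn_neg_comm.mp h3
    omega
  have h3 : i = 0 → 0 < P.pairingIn ℤ θ (p i) := by rintro rfl; exact pairingIn_pos_comm.mp h0
  have h4 : i = n → 0 < P.pairingIn ℤ θ (p i) := by rintro rfl; exact pairingIn_pos_comm.mp h1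
  split_ifs <;> omega

namespace IsShortestTo

variable {θ α σ : ι} {v : Equiv.Perm (ι × ℤ)} {e : Equiv.Perm ι}

/-- If γ involved σ, then σ ≤ γ with equal pairings with θ, so eγ would be at least as high as eσ >
0. -/
lemma coeff_eq_zero (h : IsShortestTo b θ α v e) (hθ : IsHighestRoot b θ) (hσ : σ ∈ b.support)
    (hσθ : P.pairingIn ℤ σ θ = 1) (heσ : b.IsPos (e σ)) {γ : ι} (hγ : P.pairingIn ℤ γ θ = 1)
    (heγ : ¬ b.IsPos (e γ)) : b.coeff σ γ = 0 := by
  have hp : b.IsPos γ := hθ.isPos_of_pairingIn_pos (by omega)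
  by_contra h0
  have h1 := hp.coeff_nonneg σ
  have h2 := h.height_le hθ (γ := σ) (η := γ) (fun ρ hρ ↦ ?_) (by omega)
  · rw [Base.isPos_iff] at heσ heγ
    omega
  · rcases eq_or_ne ρ σ with rfl | h3
    · rw [b.coeff_self hσ]; omega
    · rw [b.coeff_ne hσ h3]; exact hp.coeff_nonneg ρ

/-- If a simple root not orthogonal to `θ` belongs to the least ideal, then `Δ` is of type `A` and
`α` is one of the two end roots. -/
lemma isEndOfTypeA [P.IsIrreducible] (h : IsShortestTo b θ α v e) (hθ : IsHighestRoot b θ)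
    (hα : α ∈ b.support) (hσ : σ ∈ b.support) (hσθ : 0 < P.pairingIn ℤ σ θ)
    (hs : σ ∈ leastSet b θ e) : IsEndOfTypeA b α := by
  have heσ := ((h.mem_leastSet_iff hθ hα).mp hs).2
  by_cases hσeq : σ = θ
  · subst hσeq
    have huniq : ∀ τ ∈ b.support, τ = σ := fun τ hτ ↦ by
      by_contra h1
      have := hθ.one_le_coeff hτ
      rw [b.coeff_ne hσ h1] at this
      omega
    have : Unique b.support := ⟨⟨⟨σ, hσ⟩⟩, fun x ↦ Subtype.ext (huniq x x.2)⟩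
    refine ⟨1, Equiv.ofUnique _ _, fun i j ↦ ?_, 0, ?_, Or.inl rfl⟩
    · rw [Subsingleton.elim i j]
      simp [CartanMatrix.A]
    · rw [huniq α hα, huniq _ (Subtype.prop _)]
  have hσ1 : P.pairingIn ℤ σ θ = 1 := by
    have := (hθ.isMaxLength σ).resolve_left hσeq; omega
  obtain ⟨γ, hγ⟩ := exists_root_eq_sub (pairingIn_pos_comm.mp hσθ) (Ne.symm hσeq)
  have hγθ := (IsAdd.pairingIn θ).sub hγ
  rw [pairingIn_same, hσ1] at hγθ
  have hγp : b.IsPos γ := hθ.isPos_of_pairingIn_pos (by omega)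
  -- The simple root α = e(θ - σ) + eσ is not a sum of two positive roots. So γ = θ - σ does not
  -- involve σ, and another simple root σ' in it accounts for ⟨γ, θ⟩ = 1.
  have heγ : ¬ b.IsPos (e γ) := fun h1 ↦ by
    have h2 := h.isRootAut.sub hγ
    rw [h.apply_highest] at h2
    exact h1.root_add_ne heσ hα (by rw [h2]; abel)
  have hγσ := h.coeff_eq_zero hθ hσ hσ1 heσ (by omega) heγ
  obtain ⟨σ', hσ', hpos⟩ : ∃ σ' ∈ b.support, 0 < b.coeff σ' γ * P.pairingIn ℤ σ' θ := by
    by_contra! h1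
    have := Finset.sum_nonpos h1
    rw [← (IsAdd.pairingIn θ).eq_sum b γ] at this
    omega
  have hσ'θ : 0 < P.pairingIn ℤ σ' θ := pos_of_mul_pos_right hpos (hγp.coeff_nonneg σ')
  have hne : σ ≠ σ' := by
    rintro rfl
    rw [hγσ, zero_mul] at hpos
    exact hpos.false
  obtain ⟨n, p, hp0, hpn, hp, hinj, hadj⟩ := b.exists_path hσ hσ'
  have hn : n ≠ 0 := by
    rintro rfl
    exact hne (hp0.symm.trans hpn)
  obtain ⟨x, hsum⟩ := exists_isAdd_sum_eq hp hinj hadj le_rfl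
  -- The two ends of the path make ⟨x, θ⟩ ≥ 2.
  obtain rfl : x = θ := by
    refine (hθ.isMaxLength x).resolve_right fun h1 ↦ ?_
    rw [hsum _ (IsAdd.pairingIn θ), Finset.sum_range_succ, hpn,
      ← Nat.succ_pred_eq_of_ne_zero hn, Finset.sum_range_succ', hp0] at h1
    have := Finset.sum_nonneg fun i (_ : i ∈ Finset.range n.pred) ↦
      hθ.pairingIn_simple_nonneg (hp (i + 1))
    omega
  have hcartan : ∀ i j, i ≤ n → j ≤ n → _ := fun i j hi hj ↦ hθ.pairingIn_path hn hp hinj hadj hsum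
    (by rwa [hp0]) (by rwa [hpn]) hi hj
  have hsurj : ∀ τ ∈ b.support, ∃ i ≤ n, p i = τ := by
    intro τ hτ
    by_contra! h1
    have h2 := hsum _ (b.isAdd_coeff τ)
    rw [Finset.sum_eq_zero fun i hi ↦ b.coeff_ne (hp i)
      (h1 i (by rw [Finset.mem_range] at hi; omega)).symm] at h2
    have := hθ.one_le_coeff hτ
    omega
  let f : Fin (n + 1) → b.support := fun i ↦ ⟨p i, hp i⟩
  have hf : Function.Bijective f := by
    refine ⟨fun i j hij ↦ Fin.ext (hinj (Nat.lt_succ_iff.mp i.2) (Nat.lt_succ_iff.mp j.2)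
      (congrArg Subtype.val hij)), fun τ ↦ ?_⟩
    obtain ⟨i, hi, h1⟩ := hsurj τ τ.2
    exact ⟨⟨i, by omega⟩, Subtype.ext h1⟩
  refine ⟨n + 1, Equiv.ofBijective f hf, fun i j ↦ ?_, ?_⟩
  · have h1 := hcartan j i (Nat.lt_succ_iff.mp j.2) (Nat.lt_succ_iff.mp i.2)
    simp only [Equiv.ofBijective_apply, Base.cartanMatrix, Base.cartanMatrixIn_def, f, h1,
      CartanMatrix.A, Matrix.of_apply, Fin.ext_iff]
    split_ifs <;> omega
  obtain ⟨i, hi, rfl⟩ := hsurj α hα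
  refine ⟨⟨i, by omega⟩, rfl, ?_⟩
  by_contra! hend
  obtain ⟨k, rfl⟩ : ∃ k, i = k + 1 := Nat.exists_eq_succ_of_ne_zero hend.1
  have hk : k + 2 ≤ n := by have := hend.2; dsimp only at this; omega
  have hk1 := hcartan (k + 1) k hi (by omega)
  have hk2 := hcartan (k + 1) (k + 2) hi hk
  have hk3 := hcartan (k + 2) k hk (by omega)
  simp only [Nat.succ_ne_self, or_true, if_true, if_false] at hk1
  rw [if_neg (by omega), if_pos (by omega)] at hk2
  rw [if_neg (by omega), if_neg (by omega)] at hk3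
  -- If α were an interior vertex, its two neighbours would give orthogonal roots c, d that pair to
  -- 1 with θ and do not involve σ. Then θ - c - d is a root orthogonal to θ that still involves σ,
  -- which is impossible.
  have key : ∀ τ ∈ b.support, P.pairingIn ℤ τ (p (k + 1)) = -1 →
      P.pairingIn ℤ (P.opp (e.symm τ)) x = 1 ∧ b.coeff σ (P.opp (e.symm τ)) = 0 := by
    intro τ hτ h1
    have h2 : P.pairingIn ℤ (P.opp (e.symm τ)) x = 1 := by
      rw [pairingIn_opp_left, h.pairingIn_symm, h1]; rfl
    refine ⟨h2, h.coeff_eq_zero hθ hσ hσ1 heσ h2 ?_⟩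
    rw [h.isRootAut.apply_opp, Equiv.apply_symm_apply, Base.isPos_opp, not_not]
    exact Base.isPos_of_mem_support hτ
  obtain ⟨hc1, hc2⟩ := key _ (hp k) hk1
  obtain ⟨hd1, hd2⟩ := key _ (hp (k + 2)) hk2
  have hcd : P.pairingIn ℤ (P.opp (e.symm (p k))) (P.opp (e.symm (p (k + 2)))) = 0 := by
    rw [pairingIn_opp_left, pairingIn_opp_right, neg_neg, h.isRootAut_symm.pairingIn, hk3]
  set c := P.opp (e.symm (p k))
  set d := P.opp (e.symm (p (k + 2)))
  have hne' : ∀ {y}, P.pairingIn ℤ y x = 1 → x ≠ y := by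
    rintro y h1 rfl
    rw [pairingIn_same] at h1
    omega
  obtain ⟨y, hy⟩ := exists_root_eq_sub (P := P) (γ := x) (η := c)
    (pairingIn_pos_comm.mp (by omega)) (hne' hc1)
  have hyd := (IsAdd.pairingIn d).sub hy
  have hyσ := (b.isAdd_coeff σ).sub hy
  have hyx := (IsAdd.pairingIn x).sub hy
  rw [pairingIn_same] at hyx
  have hxd : 0 < P.pairingIn ℤ x d := pairingIn_pos_comm.mp (by omega)
  have hxσ := hθ.one_le_coeff hσ
  obtain ⟨z, hz⟩ := exists_root_eq_sub (P := P) (γ := y) (η := d) (by omega) (by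
    intro h1
    rw [h1] at hyσ
    omega)
  have hzσ := (b.isAdd_coeff σ).sub hz
  have hzx := (IsAdd.pairingIn x).sub hz
  have := hθ.coeff_eq_zero (γ := z) (σ := σ) (Base.isPos_of_coeff_pos (σ := σ) (by omega))
    (by omega) hσθ
  omega

end IsShortestTo

end RootPairing

namespace LieAlgebra

/-! ### Root spaces and their brackets -/

section RootSpaces

variable {K L : Type*} [Field K] [CharZero K] [LieRing L] [LieAlgebra K L] [IsKilling K L]
  [FiniteDimensional K L] {H : LieSubalgebra K L} [H.IsCartanSubalgebra] [IsTriangularizable K H L]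

lemma root_eq_add_iff {ω χ ψ : H.root} :
    (rootSystem H).root ω = (rootSystem H).root χ + (rootSystem H).root ψ ↔
      (ω.1 : H → K) = χ.1 + ψ.1 := by
  rw [← DFunLike.coe_injective.eq_iff]
  rfl

/-- If `χ`, `ψ` and `χ + ψ` are roots, then the root spaces of `χ` and `ψ` do not commute. -/
lemma exists_lie_ne_zero {ω χ ψ : H.root}
    (h : (rootSystem H).root ω = (rootSystem H).root χ + (rootSystem H).root ψ) :
    ∃ x ∈ rootSpace H χ.1, ∃ y ∈ rootSpace H ψ.1, ⁅x, y⁆ ≠ 0 := by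
  rw [root_eq_add_iff] at h
  -- With this sign the lowering element f of the sl₂-triple lies in the root space of χ. Since ψ +
  -- χ is on the α-string of ψ, applying f to the top vector once more after reaching weight ψ is
  -- still nonzero.
  set α : Weight K H L := -χ.1 with hα
  have hα0 : α.IsNonZero := hα ▸ (LieSubalgebra.isNonZero_coe_root χ).neg
  have hχ : (χ.1 : H → K) = -α := by simp [hα]
  have hbot : 1 ≤ chainBotCoeff α ψ.1 := by
    have h1 := (rootSpace_zsmul_add_ne_bot_iff α ψ.1 hα0 (-1)).mp (by
      rw [show ((-1 : ℤ) • (α : H → K) + ψ.1) = ω.1 by rw [h, hχ]; simp]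
      exact ω.1.genWeightSpace_ne_bot)
    omega
  have hlen := chainBotCoeff_add_chainTopCoeff α ψ.1
  set m := chainTopCoeff α ψ.1
  obtain ⟨x, hx, x_ne0⟩ := (chainTop α ψ.1).exists_ne_zero
  obtain ⟨_, e, f, isSl2, he, hf⟩ := exists_isSl2Triple_of_weight_isNonZero hα0
  obtain rfl := isSl2.h_eq_coroot hα0 he hf
  have prim : isSl2.HasPrimitiveVectorWith x (chainLength α ψ.1 : K) :=
    have := lie_mem_genWeightSpace_of_mem_genWeightSpace he hx
    ⟨x_ne0, (chainLength_smul _ _ hx).symm, by rwa [genWeightSpace_add_chainTop _ _ hα0] at this⟩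
  have h2 := toEnd_pow_apply_mem hf hx m
  have h3 := prim.pow_toEnd_f_ne_zero_of_eq_nat rfl (i := m + 1) (by omega)
  refine ⟨f, by rwa [hχ], (toEnd K L L f ^ m) x, ?_, ?_⟩
  · convert h2 using 2
    rw [coe_chainTop']
    simp only [m, smul_neg, neg_add_cancel_left]
  · rwa [pow_succ', Module.End.mul_apply, toEnd_apply_apply] at h3

/-- Root spaces are lines, so one nonzero bracket spans the root space of ω. -/
lemma rootSpace_le_of_lie_mem {ω χ ψ : H.root}
    (h : (rootSystem H).root ω = (rootSystem H).root χ + (rootSystem H).root ψ)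
    {A : Submodule K L}
    (hA : ∀ x ∈ rootSpace H χ.1, ∀ y ∈ rootSpace H ψ.1, ⁅x, y⁆ ∈ A) :
    (rootSpace H ω.1).toSubmodule ≤ A := by
  obtain ⟨x, hx, y, hy, hne⟩ := exists_lie_ne_zero h
  have h1 := lie_mem_genWeightSpace_of_mem_genWeightSpace hx hy
  rw [← root_eq_add_iff.mp h] at h1
  intro z hz
  obtain ⟨c, hc⟩ := (finrank_eq_one_iff_of_nonzero' ⟨⁅x, y⁆, h1⟩
    (by rwa [ne_eq, LieSubmodule.mk_eq_zero])).mp (finrank_rootSpace_eq_one ω.1 (LieSubalgebra.isNonZero_coe_root ω)) ⟨z, hz⟩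
  have h2 : c • ⁅x, y⁆ = z := congrArg Subtype.val hc
  rw [← h2]
  exact A.smul_mem c (hA x hx y hy)

lemma lie_mem_of_forall_root {χ ψ : H.root}
    (hne : (rootSystem H).root χ ≠ -(rootSystem H).root ψ) {A : Submodule K L}
    (hA : ∀ ω : H.root, (rootSystem H).root ω = (rootSystem H).root χ + (rootSystem H).root ψ →
      (rootSpace H ω.1).toSubmodule ≤ A) {x y : L}
    (hx : x ∈ rootSpace H χ.1) (hy : y ∈ rootSpace H ψ.1) : ⁅x, y⁆ ∈ A := by
  have h1 := lie_mem_genWeightSpace_of_mem_genWeightSpace hx hy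
  by_cases h2 : genWeightSpace L ((χ.1 : H → K) + (ψ.1 : H → K)) = ⊥
  · rw [h2, LieSubmodule.mem_bot] at h1
    rw [h1]
    exact A.zero_mem
  · let ω : Weight K H L := ⟨_, h2⟩
    have hω : ω.IsNonZero := by
      intro h3
      refine hne (eq_neg_of_add_eq_zero_left ?_)
      rw [← DFunLike.coe_injective.eq_iff]
      exact h3
    exact hA ⟨ω, by simpa using hω⟩ (root_eq_add_iff.mpr rfl) h1

variable (H) in
/-- The sum of the Cartan subalgebra and the root spaces of the roots in `S`. -/
noncomputable def cartanSup (S : Set H.root) : Submodule K L :=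
  H.toSubmodule ⊔ ⨆ γ ∈ S, (rootSpace H γ.1).toSubmodule

lemma rootSpace_le_cartanSup_iff {S : Set H.root} {γ : H.root} :
    (rootSpace H γ.1).toSubmodule ≤ cartanSup H S ↔ γ ∈ S := by
  refine ⟨fun h ↦ by_contra fun hγ ↦ ?_, fun h ↦ le_sup_of_le_right (le_iSup₂_of_le γ h le_rfl)⟩
  have hind := (LieModule.iSupIndep_genWeightSpace K H L) γ.1
  have h1 : cartanSup H S ≤
      (⨆ χ, ⨆ (_ : χ ≠ (γ.1 : H → K)), genWeightSpace L χ : LieSubmodule K H L).toSubmodule := by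
    refine sup_le ?_ (iSup₂_le fun η hη ↦ ?_)
    · have h2 : (rootSpace H (0 : H → K)).toSubmodule = H.toSubmodule := by
        rw [rootSpace_zero_eq]; rfl
      rw [← h2, LieSubmodule.toSubmodule_le_toSubmodule]
      refine le_iSup₂_of_le (0 : H → K) (fun h3 ↦ ?_) le_rfl
      exact (LieSubalgebra.isNonZero_coe_root γ) h3.symm
    · rw [LieSubmodule.toSubmodule_le_toSubmodule]
      refine le_iSup₂_of_le (η.1 : H → K) (fun h3 ↦ hγ ?_) le_rfl
      rwa [← Subtype.ext (DFunLike.coe_injective h3) (a1 := η) (a2 := γ)]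
  have h3 : rootSpace H γ.1 ≤ _ := (LieSubmodule.toSubmodule_le_toSubmodule _ _).mp (h.trans h1)
  exact γ.1.genWeightSpace_ne_bot' (disjoint_self.mp (hind.mono_right h3))

/-- A subspace stable under the Cartan subalgebra is determined by its intersection with the Cartan
subalgebra and by the root spaces which it contains. -/
lemma le_of_rootSpace_le {A B : Submodule K L} (hA : ∀ h ∈ H, ∀ x ∈ A, ⁅h, x⁆ ∈ A)
    (hH : ∀ x ∈ A, x ∈ H → x ∈ B)
    (hr : ∀ γ : H.root, (rootSpace H γ.1).toSubmodule ≤ A → (rootSpace H γ.1).toSubmodule ≤ B) :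
    A ≤ B := by
  let A' : LieSubmodule K H L := { A with lie_mem := fun {h x} hx ↦ hA h h.2 x hx }
  have h1 : A' = ⨆ χ : Weight K H L, A' ⊓ genWeightSpace L χ := eq_iSup_inf_genWeightSpace _ _ _ _
  have h2 : A = A'.toSubmodule := rfl
  rw [h2, h1, LieSubmodule.iSup_toSubmodule]
  refine iSup_le fun χ ↦ ?_
  rw [LieSubmodule.inf_toSubmodule]
  by_cases hχ : χ.IsZero
  · rintro x ⟨hx, hx'⟩
    refine hH x hx ?_
    have h3 : x ∈ rootSpace H (0 : H → K) := by rw [← hχ]; exact hx'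
    rwa [rootSpace_zero_eq] at h3
  · have ha := Submodule.isAtom_iff_finrank_eq_one.mpr (finrank_rootSpace_eq_one χ hχ)
    by_cases h : (rootSpace H χ).toSubmodule ≤ A
    · exact inf_le_right.trans (hr ⟨χ, by simpa using hχ⟩ h)
    · have h4 := (ha.not_le_iff_disjoint.mp h).symm.eq_bot
      exact (le_of_eq h4).trans bot_le

end RootSpaces

end LieAlgebra

namespace RootPairing

/-! ### From linear maps to permutations, and from inversions to ideals -/

section Rootlet

variable {ι R M N : Type*} [Field R] [CharZero R] [AddCommGroup M] [Module R M]
  [AddCommGroup N] [Module R N] {P : RootPairing ι R M N} [P.IsCrystallographic] {b : P.Base}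

lemma delta_sub_affineRoot (γ : ι) (k : ℤ) :
    ((0, (k : R)) : M × R) - P.affineRoot γ 0 = P.affineRoot (P.opp γ) k := by
  simp [affineRoot]

lemma mem_inversionSet_iff {w : (M × R) ≃ₗ[R] (M × R)} {g : Equiv.Perm (ι × ℤ)}
    (hw : ∀ x : ι × ℤ, w (P.affineRoot x.1 x.2) = P.affineRoot (g x).1 (g x).2) {y : ι × ℤ} :
    P.affineRoot y.1 y.2 ∈ inversionSet b w ↔ AffinePos b y ∧ ¬ AffinePos b (g y) := by
  rw [inversionSet, Set.mem_ofPred_eq, affineRoot_mem_positiveAffineRoots, hw,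
    ← affineRoot_affineNeg, affineRoot_mem_positiveAffineRoots, affinePos_neg]

variable [Finite ι] [P.IsReduced] {θ α : ι}

lemma HasRootlet.isRootlet {g : Equiv.Perm (ι × ℤ)} (hg : HasRootlet b θ α g) :
    IsRootlet b θ (minusculeSet b g) α := by
  obtain ⟨w, hwmem, hw⟩ := exists_mem_affineWeylGroup hg.mem
  refine ⟨w, ⟨hwmem, Set.ext fun x ↦ ⟨fun hx ↦ ?_, ?_⟩⟩, ?_⟩
  · obtain ⟨y, rfl, -⟩ := (mem_positiveAffineRoots b).mp hx.1
    rw [mem_inversionSet_iff hw] at hx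
    obtain ⟨γ, hγ, rfl⟩ := hg.minuscule y hx.1 hx.2
    exact ⟨γ, ⟨hγ, hx.2⟩, by simpa using (delta_sub_affineRoot (P := P) γ 1).symm⟩
  · rintro ⟨γ, hγ, rfl⟩
    have h1 := delta_sub_affineRoot (P := P) γ 1
    rw [Int.cast_one] at h1
    rw [h1, mem_inversionSet_iff (y := (P.opp γ, 1)) hw]
    exact ⟨Or.inr le_rfl, hγ.2⟩
  · have h1 := delta_sub_affineRoot (P := P) θ 2
    rw [Int.cast_ofNat] at h1
    rw [h1, hw (P.opp θ, 2), hg.rootlet]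

lemma IsRootlet.exists_hasRootlet {I : Set ι} (hI : ∀ γ ∈ I, b.IsPos γ)
    (h : IsRootlet b θ I α) : ∃ g, HasRootlet b θ α g ∧ minusculeSet b g = I := by
  obtain ⟨w, ⟨hwmem, hinv⟩, hrt⟩ := h
  obtain ⟨g, hg, hw⟩ := exists_mem_affineWeylPerm hwmem
  have key : ∀ y, (AffinePos b y ∧ ¬ AffinePos b (g y)) ↔ ∃ γ ∈ I, y = (P.opp γ, 1) := by
    intro y
    have h1 : ∀ γ, ((0, 1) : M × R) - P.affineRoot γ 0 = P.affineRoot (P.opp γ) 1 := fun γ ↦ by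
      simpa using delta_sub_affineRoot (P := P) γ 1
    rw [← mem_inversionSet_iff hw, hinv]
    refine exists_congr fun γ ↦ and_congr_right fun _ ↦ ?_
    rw [h1]
    refine ⟨fun h ↦ ?_, fun h ↦ by rw [h]⟩
    have := affineRoot_injective h
    exact Prod.ext this.1 this.2
  refine ⟨g, ⟨hg, fun y hy hgy ↦ ?_, ?_⟩, Set.ext fun γ ↦ ⟨fun hγ ↦ ?_, fun hγ ↦ ?_⟩⟩
  · obtain ⟨γ, hγ, rfl⟩ := (key y).mp ⟨hy, hgy⟩
    exact ⟨γ, hI γ hγ, rfl⟩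
  · have h1 := delta_sub_affineRoot (P := P) θ 2
    rw [Int.cast_ofNat] at h1
    rw [h1, hw (P.opp θ, 2)] at hrt
    have := affineRoot_injective hrt
    exact Prod.ext this.1 this.2
  · obtain ⟨η, hη, h1⟩ := (key (P.opp γ, 1)).mp ⟨Or.inr le_rfl, hγ.2⟩
    rwa [opp_injective (congrArg Prod.fst h1)]
  · exact ⟨hI γ hγ, ((key (P.opp γ, 1)).mpr ⟨γ, hγ, rfl⟩).2⟩

/-- The combinatorial description of the sets of roots of abelian ideals. -/
structure IsAbelianIdealSet (b : P.Base) (I : Set ι) : Prop where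
  isPos : ∀ γ ∈ I, b.IsPos γ
  add_mem : ∀ γ ∈ I, ∀ η, b.IsPos η → ∀ ζ, P.root ζ = P.root γ + P.root η → ζ ∈ I
  root_ne_add : ∀ γ ∈ I, ∀ η ∈ I, ∀ ζ, P.root ζ ≠ P.root γ + P.root η

/-- Ideal: δ - γ = (δ - ζ) + η is inverted and η, of level 0, is not, so δ - ζ is. Abelian:
otherwise 2δ - ζ = (δ - γ) + (δ - η) would be an inversion of level 2. -/
lemma HasRootlet.isAbelianIdealSet {g : Equiv.Perm (ι × ℤ)} (hg : HasRootlet b θ α g) :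
    IsAbelianIdealSet b (minusculeSet b g) where
  isPos γ hγ := hγ.1
  add_mem γ hγ η hη ζ hζ := by
    refine ⟨hγ.1.add hη hζ, fun h1 ↦ hγ.2 ?_⟩
    have h2 : AffinePos b (g (η, 0)) := by
      by_contra h3
      obtain ⟨κ, -, h4⟩ := hg.minuscule _ (Or.inl ⟨rfl, hη⟩) h3
      exact zero_ne_one (congrArg Prod.snd h4)
    have h3 := hg.isAffineAut.apply_add (x := (P.opp γ, 1)) (y := (P.opp ζ, 1)) (z := (η, 0))
      (by simp [hζ]) rfl
    exact h1.add h2 h3.1 h3.2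
  root_ne_add γ hγ η hη ζ hζ := by
    have h1 := hg.isAffineAut.apply_add (x := (P.opp ζ, 2)) (y := (P.opp γ, 1))
      (z := (P.opp η, 1)) (by simp [hζ, add_comm]) rfl
    have h2 : ¬ AffinePos b (g (P.opp ζ, 2)) := by
      rw [← affinePos_neg]
      refine (affinePos_neg.mpr hγ.2).add (affinePos_neg.mpr hη.2) ?_ ?_
      · simp [h1.1, add_comm]
      · simp [h1.2, add_comm]
    obtain ⟨κ, -, h4⟩ := hg.minuscule _ (Or.inr one_le_two) h2
    have := congrArg Prod.snd h4
    simp at this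

end Rootlet

end RootPairing

namespace LieAlgebra

open RootPairing

/-! ### Abelian ideals, their normalisers and standard parabolic subalgebras -/

section Ideals

variable {L : Type*} [LieRing L] [LieAlgebra ℂ L] [FiniteDimensional ℂ L] [IsKilling ℂ L]
  {H : LieSubalgebra ℂ L} [H.IsCartanSubalgebra] {b : (rootSystem H).Base}

lemma rootSpace_le_borel {γ : H.root} (hγ : b.IsPos γ) :
    (rootSpace H γ.1).toSubmodule ≤ borel b :=
  rootSpace_le_cartanSup_iff.mpr hγ

lemma cartan_le_borel : H.toSubmodule ≤ borel b := le_sup_left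

lemma coe_opp (γ : H.root) : (((rootSystem H).opp γ).1 : H → ℂ) = -(γ.1 : H → ℂ) := by
  have h := root_opp (P := rootSystem H) γ
  rw [← DFunLike.coe_injective.eq_iff] at h
  exact h

lemma lie_mem_of_mem_iSup {S T : Set H.root} {B : Submodule ℂ L}
    (h : ∀ γ ∈ S, ∀ η ∈ T, ∀ x ∈ rootSpace H γ.1, ∀ y ∈ rootSpace H η.1, ⁅x, y⁆ ∈ B) {x y : L}
    (hx : x ∈ ⨆ γ ∈ S, (rootSpace H γ.1).toSubmodule)
    (hy : y ∈ ⨆ γ ∈ T, (rootSpace H γ.1).toSubmodule) : ⁅x, y⁆ ∈ B := by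
  have h1 : ∀ γ ∈ S, ∀ x ∈ rootSpace H γ.1, ⁅x, y⁆ ∈ B := fun γ hγ x hx ↦ by
    have h2 : ⨆ γ ∈ T, (rootSpace H γ.1).toSubmodule ≤ B.comap (ad ℂ L x) :=
      iSup₂_le fun η hη z hz ↦ h γ hγ η hη x hx z hz
    exact h2 hy
  have h2 : ⨆ γ ∈ S, (rootSpace H γ.1).toSubmodule ≤ B.comap (ad ℂ L y) :=
    iSup₂_le fun γ hγ z hz ↦ by
      rw [Submodule.mem_comap, ad_apply, ← lie_skew, neg_mem_iff]
      exact h1 γ hγ z hz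
  have h3 := h2 hx
  rwa [Submodule.mem_comap, ad_apply, ← lie_skew, neg_mem_iff] at h3

lemma exists_isAbelianIdeal {I : Set H.root} (hI : IsAbelianIdealSet b I) :
    ∃ a : LieSubalgebra ℂ L, IsAbelianIdeal b a ∧ rootsOf H a = I := by
  set A : Submodule ℂ L := ⨆ γ ∈ I, (rootSpace H γ.1).toSubmodule with hA
  have hne : ∀ {γ η : H.root}, b.IsPos γ → b.IsPos η →
      (rootSystem H).root γ ≠ -(rootSystem H).root η := by
    intro γ η hγ hη h
    rw [← eq_opp_iff] at h
    rw [h, Base.isPos_opp] at hγ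
    exact hγ hη
  have hzero : ∀ x ∈ A, ∀ y ∈ A, ⁅x, y⁆ = 0 := fun x hx y hy ↦ by
    rw [← Submodule.mem_bot ℂ]
    exact lie_mem_of_mem_iSup (fun γ hγ η hη x hx y hy ↦ lie_mem_of_forall_root
      (hne (hI.isPos γ hγ) (hI.isPos η hη))
      (fun ω hω ↦ absurd hω (hI.root_ne_add γ hγ η hη ω)) hx hy) hx hy
  have hH : ∀ x ∈ H, ∀ y ∈ A, ⁅x, y⁆ ∈ A := fun x hx y hy ↦ by
    have h2 : A ≤ A.comap (ad ℂ L x) := iSup₂_le fun η hη z hz ↦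
      le_iSup₂_of_le (f := fun (γ : H.root) (_ : γ ∈ I) ↦ (rootSpace H γ.1).toSubmodule)
        η hη le_rfl ((rootSpace H η.1).lie_mem (x := ⟨x, hx⟩) hz)
    exact h2 hy
  have hlie : ∀ x ∈ borel b, ∀ y ∈ A, ⁅x, y⁆ ∈ A := fun x hx y hy ↦ by
    obtain ⟨h, hh, z, hz, rfl⟩ := Submodule.mem_sup.mp hx
    rw [add_lie]
    refine A.add_mem (hH h hh y hy) (lie_mem_of_mem_iSup (fun γ hγ η hη x hx y hy ↦ ?_) hz hy)
    refine lie_mem_of_forall_root (hne hγ (hI.isPos η hη)) (fun ω hω ↦ ?_) hx hy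
    rw [add_comm] at hω
    exact le_iSup₂_of_le (f := fun (γ : H.root) (_ : γ ∈ I) ↦ (rootSpace H γ.1).toSubmodule) ω
      (hI.add_mem η hη γ hγ ω hω) le_rfl
  have hle : A ≤ borel b := iSup₂_le fun γ hγ ↦ rootSpace_le_borel (hI.isPos γ hγ)
  have hsub : ∀ {x y}, x ∈ A → y ∈ A → ⁅x, y⁆ ∈ A := fun {x y} hx hy ↦ by
    rw [hzero x hx y hy]
    exact A.zero_mem
  refine ⟨{ A with lie_mem' := hsub }, ⟨hle, hlie, hzero⟩, Set.ext fun γ ↦ ⟨fun hγ ↦ ?_, fun hγ ↦ ?_⟩⟩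
  · refine (rootSpace_le_cartanSup_iff (H := H)).mp (le_trans ?_ le_sup_right)
    exact hγ
  · exact le_iSup₂_of_le (f := fun (γ : H.root) (_ : γ ∈ I) ↦ (rootSpace H γ.1).toSubmodule) γ
      hγ le_rfl

namespace IsAbelianIdeal

variable {a : LieSubalgebra ℂ L} (ha : IsAbelianIdeal b a)
include ha

lemma isPos {γ : H.root} (hγ : γ ∈ rootsOf H a) : b.IsPos γ :=
  rootSpace_le_cartanSup_iff.mp (le_trans hγ ha.le_borel)

/-- If γ(x) ≠ 0 for a positive γ, then [x, y] = γ(x)y puts a root vector y in the ideal, where it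
must commute with x. So all roots vanish at x. -/
lemma eq_zero_of_mem_cartan {x : L} (hx : x ∈ a) (hxH : x ∈ H) : x = 0 := by
  have hpos : ∀ γ : H.root, b.IsPos γ → γ.1 ⟨x, hxH⟩ = 0 := by
    intro γ hγ
    by_contra h0
    obtain ⟨y, hy, y_ne0⟩ := γ.1.exists_ne_zero
    have h1 : ⁅x, y⁆ = γ.1 ⟨x, hxH⟩ • y := lie_eq_smul_of_mem_rootSpace hy ⟨x, hxH⟩
    have h2 := ha.lie_mem y (rootSpace_le_borel hγ hy) x hx
    have hya : y ∈ a := by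
      rw [← lie_skew, neg_mem_iff, h1] at h2
      exact (a.toSubmodule.smul_mem_iff h0).mp h2
    have h3 := ha.lie_eq_zero x hx y hya
    rw [h1, smul_eq_zero] at h3
    exact h3.elim h0 y_ne0
  have h4 : (⟨x, hxH⟩ : H) ∈ ⨅ χ : Weight ℂ H L, χ.ker := by
    rw [Submodule.mem_iInf]
    intro χ
    change χ ⟨x, hxH⟩ = 0
    by_cases hχ : χ.IsZero
    · rw [hχ.eq]; rfl
    · let γ : H.root := ⟨χ, by simpa using hχ⟩
      by_cases hγ : b.IsPos γ
      · exact hpos γ hγ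
      · have h5 := hpos _ (b.isPos_opp.mpr hγ)
        have h6 := congrFun (coe_opp γ) ⟨x, hxH⟩
        rw [h5, Pi.neg_apply, zero_eq_neg] at h6
        exact h6
  rw [iInf_ker_weight_eq_bot, Submodule.mem_bot] at h4
  exact congrArg Subtype.val h4

lemma le_of_rootsOf_subset {a' : LieSubalgebra ℂ L} (h : rootsOf H a ⊆ rootsOf H a') : a ≤ a' :=
  le_of_rootSpace_le (A := a.toSubmodule) (B := a'.toSubmodule)
    (fun x hx y hy ↦ ha.lie_mem x (cartan_le_borel hx) y hy)
    (fun x hx hxH ↦ by rw [ha.eq_zero_of_mem_cartan hx hxH]; exact a'.zero_mem) fun _ hγ ↦ h hγ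

lemma borel_le_normalizer : borel b ≤ a.normalizer.toSubmodule := fun x hx ↦ by
  rw [LieSubalgebra.mem_toSubmodule, LieSubalgebra.mem_normalizer_iff]
  exact fun y hy ↦ ha.lie_mem x hx y hy

/-- The root space of `-σ` lies in the normaliser of an abelian ideal if and only if the set of
roots of the ideal is stable under subtracting `σ`. -/
lemma rootSpace_opp_le_normalizer_iff {σ : H.root} :
    (rootSpace H ((rootSystem H).opp σ).1).toSubmodule ≤ a.normalizer.toSubmodule ↔
      (rootSystem H).IsSubStable (rootsOf H a) σ := by
  constructor
  · intro h
    have hmem : ∀ x ∈ rootSpace H ((rootSystem H).opp σ).1, ∀ y ∈ a, ⁅x, y⁆ ∈ a := fun x hx y hy ↦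
      (LieSubalgebra.mem_normalizer_iff _ _).mp (h hx) y hy
    refine ⟨fun hσa ↦ ?_, fun γ hγ η hη ↦ ?_⟩
    · obtain ⟨t, e, f, isSl2, he, hf⟩ :=
        exists_isSl2Triple_of_weight_isNonZero (LieSubalgebra.isNonZero_coe_root σ)
      obtain rfl := isSl2.h_eq_coroot (LieSubalgebra.isNonZero_coe_root σ) he hf
      rw [← coe_opp] at hf
      have h1 := hmem f hf e (hσa he)
      rw [← lie_skew, neg_mem_iff, isSl2.lie_e_f] at h1
      -- If σ were a root of the ideal, [e, f] would be a nonzero element of its intersection with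
      -- the Cartan subalgebra.
      exact isSl2.h_ne_zero (ha.eq_zero_of_mem_cartan h1 (coroot σ.1).2)
    · refine rootSpace_le_of_lie_mem (χ := (rootSystem H).opp σ) (ψ := γ) ?_
        fun x hx y hy ↦ hmem x hx y (hγ hy)
      rw [hη, root_opp]
      abel
  · rintro ⟨hσa, hsub⟩ x hx
    rw [LieSubalgebra.mem_toSubmodule, LieSubalgebra.mem_normalizer_iff]
    suffices H : a.toSubmodule ≤ a.toSubmodule.comap (ad ℂ L x) from fun y hy ↦ H hy
    have h1 : a.toSubmodule ≤ ⨆ γ ∈ rootsOf H a, (rootSpace H γ.1).toSubmodule :=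
      le_of_rootSpace_le (fun x hx y hy ↦ ha.lie_mem x (cartan_le_borel hx) y hy)
        (fun x hx hxH ↦ by rw [ha.eq_zero_of_mem_cartan hx hxH]; exact Submodule.zero_mem _)
        fun γ hγ ↦ le_iSup₂_of_le
          (f := fun (γ : H.root) (_ : γ ∈ rootsOf H a) ↦ (rootSpace H γ.1).toSubmodule) γ hγ le_rfl
    refine h1.trans (iSup₂_le fun γ hγ y hy ↦ lie_mem_of_forall_root (fun h ↦ hσa ?_)
      (fun ω hω ↦ hsub γ hγ ω ?_) hx hy)
    · rw [root_opp, neg_inj] at h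
      rwa [(rootSystem H).root.injective h]
    · rw [hω, root_opp]
      abel

end IsAbelianIdeal

lemma mem_simpleRootsOutsideLevi_iff {p : LieSubalgebra ℂ L} (hp : borel b ≤ p.toSubmodule)
    {σ : H.root} : σ ∈ simpleRootsOutsideLevi b p ↔
      σ ∈ b.support ∧ ¬ (rootSpace H ((rootSystem H).opp σ).1).toSubmodule ≤ p.toSubmodule := by
  refine and_congr_right fun hσ ↦ not_congr ?_
  refine (rootSpace_le_cartanSup_iff (H := H)).trans ?_
  rw [Set.mem_ofPred_eq, coe_opp]
  exact and_iff_right ((rootSpace_le_borel (Base.isPos_of_mem_support hσ)).trans hp)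

lemma rootSpace_le_of_root_eq_add {p : LieSubalgebra ℂ L} {ω χ ψ : H.root}
    (h : (rootSystem H).root ω = (rootSystem H).root χ + (rootSystem H).root ψ)
    (hχ : (rootSpace H χ.1).toSubmodule ≤ p.toSubmodule)
    (hψ : (rootSpace H ψ.1).toSubmodule ≤ p.toSubmodule) :
    (rootSpace H ω.1).toSubmodule ≤ p.toSubmodule :=
  rootSpace_le_of_lie_mem h fun _ hx _ hy ↦ p.lie_mem (hχ hx) (hψ hy)

/-- A standard parabolic subalgebra is determined by the set of simple roots outside its Levi
subalgebra. -/
lemma le_of_simpleRootsOutsideLevi_subset {p q : LieSubalgebra ℂ L}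
    (hp : borel b ≤ p.toSubmodule) (hq : borel b ≤ q.toSubmodule)
    (h : simpleRootsOutsideLevi b q ⊆ simpleRootsOutsideLevi b p) : p ≤ q := by
  have hsimple : ∀ σ ∈ b.support,
      (rootSpace H ((rootSystem H).opp σ).1).toSubmodule ≤ p.toSubmodule →
      (rootSpace H ((rootSystem H).opp σ).1).toSubmodule ≤ q.toSubmodule := fun σ hσ h1 ↦ by
    by_contra h2
    exact ((mem_simpleRootsOutsideLevi_iff hp).mp
      (h ((mem_simpleRootsOutsideLevi_iff hq).mpr ⟨hσ, h2⟩))).2 h1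
  have hneg : ∀ γ : H.root, b.IsPos γ →
      (rootSpace H ((rootSystem H).opp γ).1).toSubmodule ≤ p.toSubmodule →
      (rootSpace H ((rootSystem H).opp γ).1).toSubmodule ≤ q.toSubmodule := by
    intro γ hγ h1
    generalize hn : (b.height γ).toNat = n
    induction n using Nat.strong_induction_on generalizing γ with | _ n ih
    by_cases hγs : γ ∈ b.support
    · exact hsimple γ hγs h1
    obtain ⟨η, σ, hσ, hη, hadd⟩ := hγ.exists_eq_add hγs
    have hσp := Base.isPos_of_mem_support (b := b) hσ
    have hht := b.height_add hadd
    -- With γ = η + σ, adding the positive roots η and σ to -γ shows that p contains the root spaces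
    -- of -σ and -η; both pass to q, and their bracket gives that of -γ.
    have h2 := rootSpace_le_of_root_eq_add (p := p) (ω := (rootSystem H).opp σ)
      (by rw [root_opp, root_opp, hadd]; abel) h1 ((rootSpace_le_borel hη).trans hp)
    have h3 := rootSpace_le_of_root_eq_add (p := p) (ω := (rootSystem H).opp η)
      (by rw [root_opp, root_opp, hadd]; abel) h1 ((rootSpace_le_borel hσp).trans hp)
    have h4 := ih _ (by rw [Base.isPos_iff] at hη hσp; omega) η hη h3 rfl
    exact rootSpace_le_of_root_eq_add (by rw [root_opp, root_opp, root_opp, hadd]; abel) h4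
      (hsimple σ hσ h2)
  refine le_of_rootSpace_le (A := p.toSubmodule) (B := q.toSubmodule)
    (fun x hx y hy ↦ p.lie_mem (hp (cartan_le_borel hx)) hy)
    (fun x _ hxH ↦ hq (cartan_le_borel hxH)) fun γ hγ ↦ ?_
  by_cases hpos : b.IsPos γ
  · exact (rootSpace_le_borel hpos).trans hq
  · have h1 := hneg _ (b.isPos_opp.mpr hpos)
    rw [opp_opp] at h1
    exact h1 hγ

end Ideals

end LieAlgebra

theorem theorem3p5 {L : Type*} [LieRing L] [LieAlgebra ℂ L] [FiniteDimensional ℂ L]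
    [LieAlgebra.IsSimple ℂ L] (H : LieSubalgebra ℂ L) [H.IsCartanSubalgebra]
    (b : (rootSystem H).Base) (θ : H.root) (hθ : RootPairing.IsHighestRoot b θ)
    (α : H.root) (hα : α ∈ b.support) (hlong : RootPairing.IsLongRoot (rootSystem H) α) :
    ∃ amin amax : LieSubalgebra ℂ L,
      IsLeast (abelianIdealsWithRootlet b θ α) amin ∧
      IsGreatest (abelianIdealsWithRootlet b θ α) amax ∧
      simpleRootsOutsideLevi b amax.normalizer ⊆ simpleRootsOutsideLevi b amin.normalizer ∧
      amin.normalizer ≤ amax.normalizer ∧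
      (¬ RootPairing.IsEndOfTypeA b α →
        simpleRootsOutsideLevi b amax.normalizer =
          simpleRootsOutsideLevi b amin.normalizer ∩
            {β : H.root | (rootSystem H).IsOrthogonal β θ}) := by
  have hαp := RootPairing.Base.isPos_of_mem_support (b := b) hα
  obtain ⟨v, e, h⟩ := RootPairing.IsShortestTo.exists_of_isMaxLength hθ hlong.isMaxLength hαp
  obtain ⟨g, hg, hgI⟩ : ∃ g, RootPairing.HasRootlet b θ α g ∧
      RootPairing.minusculeSet b g = RootPairing.leastSet b θ e :=
    ⟨_, h.hasRootlet hθ hαp, h.minusculeSet_eq hθ⟩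
  obtain ⟨g', hg', hgI'⟩ := h.exists_minusculeSet_eq hθ hα
  have hI := hg.isAbelianIdealSet
  have hI' := hg'.isAbelianIdealSet
  have hr := hg.isRootlet
  have hr' := hg'.isRootlet
  rw [hgI] at hI hr
  rw [hgI'] at hI' hr'
  obtain ⟨amin, hmin, hrmin⟩ := exists_isAbelianIdeal hI
  obtain ⟨amax, hmax, hrmax⟩ := exists_isAbelianIdeal hI'
  have hne : ∀ {a : LieSubalgebra ℂ L}, θ ∈ rootsOf H a → a ≠ ⊥ := by
    rintro a hθa rfl
    exact θ.1.genWeightSpace_ne_bot' (LieSubmodule.toSubmodule_injective (le_bot_iff.mp hθa))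
  have hθI : θ ∈ RootPairing.leastSet b θ e := Or.inl rfl
  have hmem : amin ∈ abelianIdealsWithRootlet b θ α :=
    ⟨hmin, hne (by rwa [hrmin]), by rwa [hrmin]⟩
  have hmem' : amax ∈ abelianIdealsWithRootlet b θ α :=
    ⟨hmax, hne (by rw [hrmax]; exact Or.inl hθI), by rwa [hrmax]⟩
  have hB := hmin.borel_le_normalizer
  have hB' := hmax.borel_le_normalizer
  have hS : ∀ σ, σ ∈ simpleRootsOutsideLevi b amin.normalizer ↔ σ ∈ b.support ∧
      ¬ (rootSystem H).IsSubStable (RootPairing.leastSet b θ e) σ := fun σ ↦ by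
    rw [mem_simpleRootsOutsideLevi_iff hB]
    rw [hmin.rootSpace_opp_le_normalizer_iff, hrmin]
  have hS' : ∀ σ, σ ∈ simpleRootsOutsideLevi b amax.normalizer ↔ σ ∈ b.support ∧
      ¬ (rootSystem H).IsSubStable (RootPairing.greatestSet b θ α e) σ := fun σ ↦ by
    rw [mem_simpleRootsOutsideLevi_iff hB']
    rw [hmax.rootSpace_opp_le_normalizer_iff, hrmax]
  have hsub : simpleRootsOutsideLevi b amax.normalizer ⊆
      simpleRootsOutsideLevi b amin.normalizer := fun σ hσ ↦ by
    rw [hS'] at hσ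
    refine (hS σ).mpr ⟨hσ.1, fun hs ↦ hσ.2 ?_⟩
    -- Off θ^⊥, of the stability of the least set only σ ∉ I_min is used.
    rcases (hθ.pairingIn_simple_nonneg hσ.1).eq_or_lt with h0 | h0
    · exact h.isSubStable_greatestSet hθ hα hσ.1 h0.symm hs
    · exact h.isSubStable_greatestSet_of_notMem hθ hα hσ.1 h0 hs.1
  refine ⟨amin, amax, ⟨hmem, fun a ⟨ha, _, hrt⟩ ↦ hmin.le_of_rootsOf_subset ?_⟩,
    ⟨hmem', fun a ⟨ha, _, hrt⟩ ↦ ha.le_of_rootsOf_subset ?_⟩, hsub,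
    le_of_simpleRootsOutsideLevi_subset hB hB' hsub, fun hA ↦ Set.ext fun σ ↦ ?_⟩
  · obtain ⟨u, hu, huI⟩ := hrt.exists_hasRootlet fun γ hγ ↦ ha.isPos hγ
    rw [hrmin, ← huI]
    exact hu.leastSet_subset hθ h
  · obtain ⟨u, hu, huI⟩ := hrt.exists_hasRootlet fun γ hγ ↦ ha.isPos hγ
    rw [hrmax, ← huI]
    exact hu.subset_greatestSet hθ h
  · have horth : (rootSystem H).IsOrthogonal σ θ ↔ (rootSystem H).pairingIn ℤ σ θ = 0 := by
      rw [RootPairing.IsOrthogonal, ← RootPairing.pairing_eq_zero_iff, and_self,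
        ← (rootSystem H).algebraMap_pairingIn ℤ, FaithfulSMul.algebraMap_eq_zero_iff,
        RootPairing.pairingIn_eq_zero_iff]
    rw [Set.mem_inter_iff, Set.mem_ofPred_eq, horth]
    refine ⟨fun hσ ↦ ⟨hsub hσ, ?_⟩, fun ⟨hσ, h0⟩ ↦ ?_⟩
    · rw [hS'] at hσ
      by_contra h0
      have h1 := lt_of_le_of_ne (hθ.pairingIn_simple_nonneg hσ.1) (Ne.symm h0)
      refine hσ.2 (h.isSubStable_greatestSet_of_notMem hθ hα hσ.1 h1 fun hs ↦ hA ?_)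
      exact h.isEndOfTypeA hθ hα hσ.1 h1 hs
    · rw [hS] at hσ
      exact (hS' σ).mpr ⟨hσ.1, fun hs ↦ hσ.2 (h.isSubStable_leastSet hθ hα h0 hs)⟩
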